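/- **Setting.** Work in bounded continuous logic: all predicates and metrics take values in $[0,1]$, structures are complete metric spaces in which the symbols are uniformly continuous with prescribed moduli, terms are built from variables, constants and function symbols, and quantifier-free formulas are built from atomic formulas (including the metric) by continuous connectives $[0,1]^{\mathbb N}\to[0,1]$, possibly with countably many free variables. Tuples $x=(x_i)$ carry the metric $\sup_i 2^{-i}d(x_i,y_i)$. A first-order structure is viewed as a continuous one with the discrete metric, a predicate having value $0$ where it holds and $1$ where it fails. All formulas and terms below are uniform in the models of the theory considered, and uniform limits are uniform over all these models. Let $p$ be a prime and $\alpha\in(0,1)$. * $\mathrm{TPERF}_{p,\varpi}$ is the first-order theory, in the language of rings with a binary predicate $\div$ and constants $\varpi_i$ ($i\ge 1$), of commutative rings $R$ such that: $x\div y$ iff $x$ divides $y$; $x\div y$ or $y\div x$ for all $x,y$; if $x\ne0$ and $x=yx$ then $y$ is a unit; $p=0$; $x\mapsto x^p$ is surjective; $\varpi_1\neq 0$, $\varpi_1^p=0$ and $\varpi_1\div x$ whenever $x^p=0$; $\varpi_{i+1}^p=\varpi_i$ for $i\ge1$. * $\mathrm{PERF}_{|p|=0,|\varpi|=\alpha}$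 is the continuous theory, in the language of rings with a binary predicate $\mathrm D$ and constants $\varpi_i$ ($i\ge0$, $\varpi:=\varpi_0$), of complete domains $N$ (written also $\mathcal O(N)$) with an ultrametric multiplicative norm $|x|=d(x,0)\le 1$, $d(x,y)=|x-y|$, such that: $\inf_z\min(|xz-y|,|yz-x|)=0$ for all $x,y$; $|p|=0$; $\inf_x\big||x|-\tfrac12\big|=0$; $\inf_y|x-y^p|=0$ for all $x$; $\mathrm D(x,y)=\inf_z|y-xz|$; $|\varpi_0|=\alpha$; $\varpi_{i+1}^p=\varpi_i$ for $i\ge0$. * For $R\models\mathrm{TPERF}_{p,\varpi}$, let $\Omega(R)=\{x\in R^{\mathbb N}: x_{i+1}^p=x_i \text{ for all } i\}$, and let $R^\flat=\varprojlim_{x\mapsto x^p}R$ be the ring with underlying set $\Omega(R)$ and coordinatewise operations. Put $\varpi^\flat=(0,\varpi_1,\varpi_2,\dots)\in R^\flat$, and write $v^\flat(x)\le v^\flat(y)$ if $x_i\div y_i$ for all $i$. Let $R^\flat_\alpha$ be $R^\flat$ with the norm $|x|^\flat_\alpha=\inf\{\alpha^{m/n}: m\ge0,\ n\ge1,\ m\,v^\flat(\varpi^\flat)\le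 n\,v^\flat(x)\}$ (the rank one coarsening of $v^\flat$ normalized by $|\varpi^\flat|^\flat_\alpha=\alpha$), with $\mathrm D(x,y)=\inf_z|y-xz|^\flat_\alpha$ and with $\varpi_j$ interpreted as $(\varpi^\flat)^{p^{-j}}$. * For $N\models\mathrm{PERF}_{|p|=0,|\varpi|=\alpha}$, let $N^\natural$ be the first-order structure $\mathcal O(N)/(\varpi_0)$ with its divisibility relation and with $\varpi_i$ interpreted as the residue $\mathrm{res}_\varpi(\varpi_i)$, $i\ge1$. A *quantifier-free interpretation* of structures $I(M)$ in the models $M$ of a theory $T$ is given by a set $\widehat N\subseteq M^x$ of finite or countable tuples and a surjection $\widehat N\to I(M)$ such that: there is a quantifier-free definable pseudometric $\partial$ on $M^x$ whose restriction to $\widehat N$ is the pullback of the metric of $I(M)$; the $\partial$-distance to $\widehat N$ is quantifier-free definable; each predicate symbol of $I(M)$ pulls back to the restriction to $\widehat N$ of a $\partial$-invariant quantifier-free definable predicate; each function symbol and constant of $I(M)$ is induced by a function on $\widehat N$ that is a uniform limit of (tuples of) terms. A pair of quantifier-free interpretations $I$ of models of $T_2$ in models of $T_1$ and $J$ of models of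 $T_1$ in models of $T_2$ is a *quantifier-free bi-interpretation* between $T_1$ and $T_2$ if, for every $M\models T_1$, there is an isomorphism $J(I(M))\cong M$ such that, with $\widehat M$ the domain of the composite interpretation, the resulting map $f:\widehat M\to M$ is a uniform limit of terms and the predicate $d(f(u),y)$ is quantifier-free definable, i.e. the restriction of a quantifier-free definable predicate in $(u,y)$ that is invariant in $u$ under a quantifier-free definable pseudometric extending the pullback by $f$ of the metric, the distance to $\widehat M$ for this pseudometric being also quantifier-free definable; and symmetrically for $I(J(N))\cong N$ for every $N\models T_2$. **Theorem.** Let $p$ be a prime and $\alpha\in(0,1)$. Let $R$ range over the models of $\mathrm{TPERF}_{p,\varpi}$ and $N$ over the models of $\mathrm{PERF}_{|p|=0,|\varpi|=\alpha}$. 1. The set $\Omega(R)$ is quantifier-free (continuously) definable in $R$: the distance from $x\in R^{\mathbb N}$ to $\Omega(R)$ is given by a quantifier-free formula. 2. $R^\flat_\alpha$ is a model of $\mathrm{PERF}_{|p|=0,|\varpi|=\alpha}$, and the map $\mathrm{id}_\Omega:\Omega(R)\to R^\flat$ is a quantifier-free interpretation of $R^\flat_\alpha$ in $R$. 3. $N^\natural$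 is a model of $\mathrm{TPERF}_{p,\varpi}$, and the map $\mathrm{res}_\varpi:\mathcal O(N)\to\mathcal O(N)/(\varpi)$ is a quantifier-free interpretation of $N^\natural$ in $N$. 4. The maps $\mathrm{id}_\Omega$ and $\mathrm{res}_\varpi$ form a quantifier-free bi-interpretation between $\mathrm{TPERF}_{p,\varpi}$ and $\mathrm{PERF}_{|p|=0,|\varpi|=\alpha}$. -/

import Mathlib

universe u

noncomputable section

namespace ContLogic

/-! ### Bounded continuous logic: languages, structures, formulas -/

/-- A language of continuous logic, with all predicates valued in `[0,1]` and structures of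
diameter at most `1`. Constants are the function symbols of arity `0`. -/
structure CLang where
  Fn : Type
  fnArity : Fn → ℕ
  fnModulus : Fn → Set.Ioc (0 : ℝ) 1 → Set.Ioc (0 : ℝ) 1
  Rel : Type
  relArity : Rel → ℕ
  relModulus : Rel → Set.Ioc (0 : ℝ) 1 → Set.Ioc (0 : ℝ) 1

/-- The raw data of a structure; the requirements on these data are in `Str.IsStructure`. -/
structure Str (L : CLang) where
  carrier : Type u
  d : carrier → carrier → unitInterval
  fn : ∀ f : L.Fn, (Fin (L.fnArity f) → carrier) → carrier
  rel : ∀ r : L.Rel, (Fin (L.relArity r) → carrier) → unitInterval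

variable {L L₁ L₂ L₃ : CLang}

/-- The distance `sup_i 2⁻ⁱ d(u_i, v_i)` between two finite or countable tuples. For tuples indexed
by `Fin k` or by `ℕ`, `Encodable.encode i` is `i` itself. -/
def Str.tupleDist (A : Str.{u} L) {ι : Type} [Encodable ι] (u v : ι → A.carrier) : ℝ :=
  ⨆ i, (1 / 2 : ℝ) ^ Encodable.encode i * (A.d (u i) (v i) : ℝ)

/-- The requirements on a structure: a nonempty complete metric space, in which the symbols of the
language are uniformly continuous with the moduli given by the language. -/
structure Str.IsStructure (A : Str.{u} L) : Prop where
  nonempty : Nonempty A.carrier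
  d_eq_zero : ∀ x y, A.d x y = 0 ↔ x = y
  d_comm : ∀ x y, A.d x y = A.d y x
  d_triangle : ∀ x y z, (A.d x z : ℝ) ≤ A.d x y + A.d y z
  complete : ∀ s : ℕ → A.carrier,
    (∀ ε : ℝ, 0 < ε → ∃ N, ∀ m ≥ N, ∀ n ≥ N, (A.d (s m) (s n) : ℝ) ≤ ε) →
      ∃ x, ∀ ε : ℝ, 0 < ε → ∃ N, ∀ n ≥ N, (A.d (s n) x : ℝ) ≤ ε
  fn_unifCont : ∀ f (ε : Set.Ioc (0 : ℝ) 1) (u v : Fin (L.fnArity f) → A.carrier),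
    A.tupleDist u v < L.fnModulus f ε → (A.d (A.fn f u) (A.fn f v) : ℝ) ≤ ε
  rel_unifCont : ∀ r (ε : Set.Ioc (0 : ℝ) 1) (u v : Fin (L.relArity r) → A.carrier),
    A.tupleDist u v < L.relModulus r ε → |(A.rel r u : ℝ) - A.rel r v| ≤ ε

/-- A first-order structure seen as a continuous one: the metric is discrete, and a predicate takes
the value `0` where it holds and `1` where it fails. -/
structure Str.IsDiscrete (A : Str.{u} L) : Prop where
  d_eq_one : ∀ x y, x ≠ y → A.d x y = 1
  rel_eq : ∀ r v, A.rel r v = 0 ∨ A.rel r v = 1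

/-- Isomorphisms of structures. -/
structure Str.Iso (A B : Str.{u} L) where
  toEquiv : A.carrier ≃ B.carrier
  map_d : ∀ x y, B.d (toEquiv x) (toEquiv y) = A.d x y
  map_fn : ∀ f v, toEquiv (A.fn f v) = B.fn f (fun i => toEquiv (v i))
  map_rel : ∀ r v, B.rel r (fun i => toEquiv (v i)) = A.rel r v

/-- Terms with variables in `V`. -/
inductive Term (L : CLang) (V : Type) : Type where
  | var (v : V) : Term L V
  | app (f : L.Fn) (ts : Fin (L.fnArity f) → Term L V) : Term L V

def Term.eval {V : Type} (A : Str.{u} L) (v : V → A.carrier) : Term L V → A.carrier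
  | .var x => v x
  | .app f ts => A.fn f (fun i => (ts i).eval A v)

/-- Formulas with free variables in `V` and `n` further variables that are to be bound. Connectives
are the continuous functions `[0,1]^ℕ → [0,1]`. -/
inductive Formula (L : CLang) (V : Type) : ℕ → Type where
  | dist {n : ℕ} (s t : Term L (V ⊕ Fin n)) : Formula L V n
  | rel {n : ℕ} (r : L.Rel) (ts : Fin (L.relArity r) → Term L (V ⊕ Fin n)) : Formula L V n
  | conn {n : ℕ} (c : C(ℕ → unitInterval, unitInterval)) (φ : ℕ → Formula L V n) : Formula L V n
  | sup {n : ℕ} (φ : Formula L V (n + 1)) : Formula L V n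
  | inf {n : ℕ} (φ : Formula L V (n + 1)) : Formula L V n

def Formula.realize {V : Type} (A : Str.{u} L) (v : V → A.carrier) :
    ∀ {n : ℕ}, Formula L V n → (Fin n → A.carrier) → unitInterval
  | _, .dist s t, b => A.d (s.eval A (Sum.elim v b)) (t.eval A (Sum.elim v b))
  | _, .rel r ts, b => A.rel r (fun i => (ts i).eval A (Sum.elim v b))
  | _, .conn c φ, b => c (fun k => (φ k).realize A v b)
  | _, .sup φ, b => ⨆ a : A.carrier, φ.realize A v (Fin.snoc b a)
  | _, .inf φ, b => ⨅ a : A.carrier, φ.realize A v (Fin.snoc b a)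

def Formula.IsQF {V : Type} : ∀ {n : ℕ}, Formula L V n → Prop
  | _, .dist _ _ => True
  | _, .rel _ _ => True
  | _, .conn _ φ => ∀ k, (φ k).IsQF
  | _, .sup _ => False
  | _, .inf _ => False

/-- The value of a formula all of whose variables are free. -/
def Formula.eval {V : Type} (φ : Formula L V 0) (A : Str.{u} L) (v : V → A.carrier) :
    unitInterval :=
  φ.realize A v Fin.elim0

/-! ### Definable sets and interpretations

A theory `T` is given by its models, as a predicate on structures. Everything is uniform in the
models of `T`: the formulas and terms do not depend on the model, and uniform limits are uniform
over all models. -/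

/-- The set `X(A) ⊆ A^ι` is quantifier-free definable: a quantifier-free formula gives the distance
to it. -/
def IsQFDefinable (T : Str.{u} L → Prop) {ι : Type} [Encodable ι]
    (X : ∀ A : Str.{u} L, T A → Set (ι → A.carrier)) : Prop :=
  ∃ φ : Formula L ι 0, φ.IsQF ∧
    ∀ (A : Str.{u} L) (h : T A) (x : ι → A.carrier),
      (φ.eval A x : ℝ) = ⨅ y : X A h, A.tupleDist x y

/-- The data of a uniform family of maps `dom A → target A` from a set `dom A` of `ι`-tuples in a
model `A` of `T` to an `L₂`-structure. -/
structure InterpMap (L₁ L₂ : CLang) (T : Str.{u} L₁ → Prop) where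
  ι : Type
  enc : Encodable ι
  target : ∀ A : Str.{u} L₁, T A → Str.{u} L₂
  dom : ∀ (A : Str.{u} L₁) (_ : T A), Set (ι → A.carrier)
  map : ∀ (A : Str.{u} L₁) (h : T A), dom A h → (target A h).carrier

attribute [instance] InterpMap.enc

variable {T : Str.{u} L₁ → Prop}

/-- `pd` defines a pseudometric `∂` on `A^ι`, `ds` defines the `∂`-distance to `dom A`, both are
quantifier-free, and the map induces a surjective isometry from `dom A / ∂` to `target A`. -/
structure InterpMap.IsQFPresentedBy (I : InterpMap.{u} L₁ L₂ T)
    (pd : Formula L₁ (I.ι ⊕ I.ι) 0) (ds : Formula L₁ I.ι 0) : Prop where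
  pd_qf : pd.IsQF
  ds_qf : ds.IsQF
  pd_self : ∀ A, T A → ∀ x : I.ι → A.carrier, pd.eval A (Sum.elim x x) = 0
  pd_comm : ∀ A, T A → ∀ x y : I.ι → A.carrier,
    pd.eval A (Sum.elim x y) = pd.eval A (Sum.elim y x)
  pd_triangle : ∀ A, T A → ∀ x y z : I.ι → A.carrier,
    (pd.eval A (Sum.elim x z) : ℝ) ≤ pd.eval A (Sum.elim x y) + pd.eval A (Sum.elim y z)
  ds_eq : ∀ (A : Str.{u} L₁) (h : T A) (x : I.ι → A.carrier),
    ds.eval A x = ⨅ y : I.dom A h, pd.eval A (Sum.elim x y)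
  isometry : ∀ (A : Str.{u} L₁) (h : T A) (x y : I.dom A h),
    (I.target A h).d (I.map A h x) (I.map A h y) = pd.eval A (Sum.elim x y)
  surjective : ∀ (A : Str.{u} L₁) (h : T A), Function.Surjective (I.map A h)

/-- The sequence of (tuples of) terms `t` converges uniformly to the function `F` on `X`. -/
def IsTermLimit (T : Str.{u} L → Prop) {W κ : Type} [Encodable κ]
    (X : ∀ A : Str.{u} L, T A → Set (W → A.carrier))
    (t : ℕ → κ → Term L W)
    (F : ∀ (A : Str.{u} L) (h : T A), X A h → κ → A.carrier) : Prop :=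
  ∀ ε : ℝ, 0 < ε → ∃ N, ∀ n ≥ N, ∀ (A : Str.{u} L) (h : T A) (w : X A h),
    A.tupleDist (fun j => (t n j).eval A w.1) (F A h w) ≤ ε

/-- The `k`-tuples of elements of `dom A`, as families of elements of `A`. -/
def InterpMap.domPow (I : InterpMap.{u} L₁ L₂ T) (k : ℕ) (A : Str.{u} L₁) (h : T A) :
    Set (Fin k × I.ι → A.carrier) :=
  {z | ∀ j, (fun i => z (j, i)) ∈ I.dom A h}

/-- The map `dom A ^ k → (target A) ^ k` induced by an `InterpMap`. -/
def InterpMap.mapPow (I : InterpMap.{u} L₁ L₂ T) (k : ℕ) (A : Str.{u} L₁) (h : T A)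
    (z : I.domPow k A h) : Fin k → (I.target A h).carrier :=
  fun j => I.map A h ⟨fun i => z.1 (j, i), z.2 j⟩

/-- The maps form a quantifier-free interpretation of `target A` in `A`: predicates pull back to
quantifier-free definable predicates on `dom A / ∂` (restrictions of `∂`-invariant ones),
and functions and constants are induced by uniform limits of terms. -/
def InterpMap.IsQFInterpretation (I : InterpMap.{u} L₁ L₂ T) : Prop :=
  ∃ (pd : Formula L₁ (I.ι ⊕ I.ι) 0) (ds : Formula L₁ I.ι 0),
    I.IsQFPresentedBy pd ds ∧
    (∀ r : L₂.Rel, ∃ φ : Formula L₁ (Fin (L₂.relArity r) × I.ι) 0, φ.IsQF ∧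
      (∀ A, T A → ∀ z z' : Fin (L₂.relArity r) × I.ι → A.carrier,
        (∀ j, pd.eval A (Sum.elim (fun i => z (j, i)) (fun i => z' (j, i))) = 0) →
          φ.eval A z = φ.eval A z') ∧
      ∀ (A : Str.{u} L₁) (h : T A) (z : I.domPow (L₂.relArity r) A h),
        φ.eval A z = (I.target A h).rel r (I.mapPow _ A h z)) ∧
    (∀ f : L₂.Fn, ∃ (t : ℕ → I.ι → Term L₁ (Fin (L₂.fnArity f) × I.ι))
      (F : ∀ (A : Str.{u} L₁) (h : T A), I.domPow (L₂.fnArity f) A h → I.dom A h),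
      IsTermLimit T (I.domPow (L₂.fnArity f)) t (fun A h z => (F A h z).1) ∧
      ∀ (A : Str.{u} L₁) (h : T A) (z : I.domPow (L₂.fnArity f) A h),
        I.map A h (F A h z) = (I.target A h).fn f (I.mapPow _ A h z))

/-- The composition of two interpretation maps, the second one being applied in the structures
interpreted by the first one. -/
def InterpMap.comp {T₂ : Str.{u} L₂ → Prop} (I : InterpMap.{u} L₁ L₂ T)
    (J : InterpMap.{u} L₂ L₃ T₂) (hI : ∀ A h, T₂ (I.target A h)) : InterpMap.{u} L₁ L₃ T where
  ι := J.ι × I.ι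
  enc := inferInstance
  target A h := J.target (I.target A h) (hI A h)
  dom A h := {u | ∃ hu : ∀ j, (fun i => u (j, i)) ∈ I.dom A h,
    (fun j => I.map A h ⟨fun i => u (j, i), hu j⟩) ∈ J.dom (I.target A h) (hI A h)}
  map A h u := J.map (I.target A h) (hI A h)
    ⟨fun j => I.map A h ⟨fun i => u.1 (j, i), u.2.choose j⟩, u.2.choose_spec⟩

/-- Given an interpretation `K` of `L`-structures in models `A` of `T`, and isomorphisms
`e A : target A ≅ A`, the resulting interpretation of `A` in itself is quantifier-free homotopic to
the identity: the induced map `dom A → A` is a uniform limit of terms, and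
the predicate `d(f(u), y)` is quantifier-free definable on `dom A / ∂ × A`. -/
def InterpMap.IsQFHomotopicToId {T : Str.{u} L → Prop} (K : InterpMap.{u} L L T)
    (e : ∀ A h, (K.target A h).Iso A) : Prop :=
  ∃ (pd : Formula L (K.ι ⊕ K.ι) 0) (ds : Formula L K.ι 0),
    K.IsQFPresentedBy pd ds ∧
    (∃ Φ : Formula L (K.ι ⊕ Unit) 0, Φ.IsQF ∧
      (∀ A, T A → ∀ (u u' : K.ι → A.carrier) (y : A.carrier),
        pd.eval A (Sum.elim u u') = 0 →
          Φ.eval A (Sum.elim u fun _ => y) = Φ.eval A (Sum.elim u' fun _ => y)) ∧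
      ∀ (A : Str.{u} L) (h : T A) (u : K.dom A h) (y : A.carrier),
        Φ.eval A (Sum.elim u.1 fun _ => y) = A.d ((e A h).toEquiv (K.map A h u)) y) ∧
    ∃ t : ℕ → Unit → Term L K.ι,
      IsTermLimit T K.dom t (fun A h u _ => (e A h).toEquiv (K.map A h u))

/-- `I` and `J` form a quantifier-free bi-interpretation between the theories `T₁` and `T₂`. -/
def IsQFBiInterpretation (T₁ : Str.{u} L₁ → Prop) (T₂ : Str.{u} L₂ → Prop)
    (I : InterpMap.{u} L₁ L₂ T₁) (J : InterpMap.{u} L₂ L₁ T₂) : Prop :=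
  ∃ (hI : ∀ A h, T₂ (I.target A h)) (hJ : ∀ B h, T₁ (J.target B h)),
    I.IsQFInterpretation ∧ J.IsQFInterpretation ∧
    (∃ e : ∀ A h, ((I.comp J hI).target A h).Iso A, (I.comp J hI).IsQFHomotopicToId e) ∧
    (∃ e : ∀ B h, ((J.comp I hJ).target B h).Iso B, (J.comp I hJ).IsQFHomotopicToId e)

/-! ### The languages of rings with one binary predicate and named constants -/

/-- Function symbols of rings, with additional constants indexed by `C`. -/
inductive RingFn (C : Type) : Type where
  | add | mul | neg | zero | one
  | const (c : C)

def RingFn.arity {C : Type} : RingFn C → ℕ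
  | .add => 2
  | .mul => 2
  | .neg => 1
  | .zero => 0
  | .one => 0
  | .const _ => 0

/-- The modulus of continuity `ε ↦ ε / 2`: an error of `δ` on the argument gives an error of at most
`2δ` on the value. -/
def halfModulus (ε : Set.Ioc (0 : ℝ) 1) : Set.Ioc (0 : ℝ) 1 :=
  ⟨ε / 2, half_pos ε.2.1, (half_le_self ε.2.1.le).trans ε.2.2⟩

/-- Rings with constants indexed by `C` and one binary predicate for each element of `P`. -/
def ringLang (C P : Type) : CLang where
  Fn := RingFn C
  fnArity := RingFn.arity
  fnModulus _ := halfModulus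
  Rel := P
  relArity _ := 2
  relModulus _ := halfModulus

inductive DivRel : Type where
  | div

inductive DRel : Type where
  | D

/-- Rings with a divisibility predicate and constants `ϖ_i`, `i ≥ 1`. -/
abbrev LDiv : CLang := ringLang ℕ+ DivRel

/-- Rings with the predicate `D` and constants `ϖ_i`, `i ≥ 0`. -/
abbrev LD : CLang := ringLang ℕ DRel

section
variable {C P : Type} (A : Str.{u} (ringLang C P))

def Str.add (x y : A.carrier) : A.carrier := A.fn RingFn.add ![x, y]
def Str.mul (x y : A.carrier) : A.carrier := A.fn RingFn.mul ![x, y]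
def Str.neg (x : A.carrier) : A.carrier := A.fn RingFn.neg ![x]
def Str.zero : A.carrier := A.fn RingFn.zero ![]
def Str.one : A.carrier := A.fn RingFn.one ![]
def Str.const (c : C) : A.carrier := A.fn (RingFn.const c) ![]
def Str.pred (r : P) (x y : A.carrier) : unitInterval := A.rel r ![x, y]

/-- The axioms of commutative rings. -/
structure Str.IsCommRing : Prop where
  add_assoc : ∀ x y z, A.add (A.add x y) z = A.add x (A.add y z)
  add_comm : ∀ x y, A.add x y = A.add y x
  zero_add : ∀ x, A.add A.zero x = x
  neg_add_cancel : ∀ x, A.add (A.neg x) x = A.zero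
  mul_assoc : ∀ x y z, A.mul (A.mul x y) z = A.mul x (A.mul y z)
  mul_comm : ∀ x y, A.mul x y = A.mul y x
  one_mul : ∀ x, A.mul A.one x = x
  left_distrib : ∀ x y z, A.mul x (A.add y z) = A.add (A.mul x y) (A.mul x z)

variable {A}

/-- The ring structure on a model of the axioms of commutative rings. -/
abbrev Str.IsCommRing.commRing (h : A.IsCommRing) : CommRing A.carrier :=
  @CommRing.ofMinimalAxioms A.carrier ⟨A.add⟩ ⟨A.mul⟩ ⟨A.neg⟩ ⟨A.zero⟩ ⟨A.one⟩
    h.add_assoc h.zero_add h.neg_add_cancel h.mul_assoc h.mul_comm h.one_mul h.left_distrib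

end

/-- The structure given by a ring, a distance function, constants and binary predicates. -/
def ringStr {C P : Type} (R : Type u) [CommRing R] (d : R → R → unitInterval) (c : C → R)
    (r : P → R → R → unitInterval) : Str.{u} (ringLang C P) where
  carrier := R
  d := d
  fn f := match f with
    | .add => fun v : Fin 2 → R => v 0 + v 1
    | .mul => fun v : Fin 2 → R => v 0 * v 1
    | .neg => fun v : Fin 1 → R => - v 0
    | .zero => fun _ => 0
    | .one => fun _ => 1
    | .const i => fun _ => c i
  rel i := fun v : Fin 2 → R => r i (v 0) (v 1)

/-! ### Truncated perfect valuation rings -/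

/-- Pseudo-uniformizers of a truncated perfect valuation ring with divisibility predicate `dv`. -/
def IsPseudoUniformizer (p : ℕ) {R : Type u} [CommRing R] (dv : R → R → Prop) (ϖ : R) : Prop :=
  ϖ ≠ 0 ∧ ϖ ^ p = 0 ∧ ∀ x : R, x ^ p = 0 → dv ϖ x

/-- Truncated perfect valuation rings with divisibility predicate `dv` and named `ϖ_i`, `i ≥ 1`. -/
structure TPERFAxioms (p : ℕ) (R : Type u) [CommRing R] (dv : R → R → Prop) (ϖ : ℕ+ → R) :
    Prop where
  dv_iff : ∀ x y, dv x y ↔ x ∣ y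
  dv_total : ∀ x y, dv x y ∨ dv y x
  unit : ∀ x y, x ≠ 0 → x = y * x → IsUnit y
  p_eq_zero : (p : R) = 0
  frobenius_surjective : ∀ x : R, ∃ y : R, y ^ p = x
  pseudoUniformizer : IsPseudoUniformizer p dv (ϖ 1)
  root : ∀ i, ϖ (i + 1) ^ p = ϖ i

/-- The (models of the) theory `TPERF_{p,ϖ}`. -/
structure TPERF (p : ℕ) (A : Str.{u} LDiv) : Prop where
  isStructure : A.IsStructure
  isDiscrete : A.IsDiscrete
  isCommRing : A.IsCommRing
  axioms_hold : @TPERFAxioms p A.carrier isCommRing.commRing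
    (fun x y => A.pred DivRel.div x y = 0) A.const

/-! ### Perfectoid valuation rings of characteristic `p` -/

/-- Valuation rings of perfectoid fields of characteristic `p`, with metric `d`, predicate `D` and
named `ϖ_i`, `i ≥ 0`. The norm is `|x| = d(x, 0)`. -/
structure PERFAxioms (p : ℕ) (α : ℝ) (R : Type u) [CommRing R] (d : R → R → unitInterval)
    (D : R → R → unitInterval) (ϖ : ℕ → R) : Prop where
  isDomain : IsDomain R
  d_eq : ∀ x y, d x y = d (x - y) 0
  norm_one : d 1 0 = 1
  norm_mul : ∀ x y, d (x * y) 0 = d x 0 * d y 0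
  norm_add_le : ∀ x y, d (x + y) 0 ≤ max (d x 0) (d y 0)
  valuation : ∀ x y, ⨅ z, min (d (x * z) y) (d (y * z) x) = 0
  norm_p : d (p : R) 0 = 0
  exists_norm : ⨅ x, |(d x 0 : ℝ) - 1 / 2| = 0
  frobenius : ∀ x, ⨅ y, d x (y ^ p) = 0
  D_eq : ∀ x y, D x y = ⨅ z, d y (x * z)
  norm_uniformizer : (d (ϖ 0) 0 : ℝ) = α
  root : ∀ i, ϖ (i + 1) ^ p = ϖ i

/-- The (models of the) theory `PERF_{|p|=0,|ϖ|=α}`. -/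
structure PERF (p : ℕ) (α : ℝ) (A : Str.{u} LD) : Prop where
  isStructure : A.IsStructure
  isCommRing : A.IsCommRing
  axioms_hold : @PERFAxioms p α A.carrier isCommRing.commRing A.d (A.pred DRel.D) A.const

/-! ### The tilt -/

/-- The sequence `0, ϖ_1, ϖ_2, …`. -/
def uniformizerSeq {R : Type u} [CommRing R] (ϖ : ℕ+ → R) : ℕ → R
  | 0 => 0
  | i + 1 => ϖ i.succPNat

theorem TPERFAxioms.uniformizerSeq_root {p : ℕ} {R : Type u} [CommRing R]
    {dv : R → R → Prop} {ϖ : ℕ+ → R} (h : TPERFAxioms p R dv ϖ) (i : ℕ) :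
    uniformizerSeq ϖ (i + 1) ^ p = uniformizerSeq ϖ i := by
  cases i with
  | zero => exact h.pseudoUniformizer.2.1
  | succ i => exact h.root i.succPNat

section Tilt
variable (p : ℕ) [Fact p.Prime] {R : Type u} [CommRing R] [CharP R p]

/-- The comparison `v♭(x) ≤ v♭(y)` on `R♭ = lim_{x ↦ x^p} R`. -/
def flatLE (dv : R → R → Prop) (x y : Perfection R p) : Prop :=
  ∀ i, dv (x.1 i) (y.1 i)

/-- The norm on `R♭` associated with the rank one coarsening of `v♭` for which `ϖ` has norm `α`:
the infimum of `α^(m/n)` over all `m / n` with `m v♭(ϖ) ≤ n v♭(x)`. -/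
def flatNorm (α : Set.Ioo (0 : ℝ) 1) (dv : R → R → Prop) (ϖ x : Perfection R p) :
    unitInterval :=
  ⨅ q : {q : ℕ × ℕ // 0 < q.2 ∧ flatLE p dv (ϖ ^ q.1) (x ^ q.2)},
    ⟨α.1 ^ ((q.1.1 : ℝ) / (q.1.2 : ℝ)),
      Real.rpow_nonneg α.2.1.le _, Real.rpow_le_one α.2.1.le α.2.2.le (by positivity)⟩

variable {p}

/-- The element `(ϖ♭)^(1/p^j) = (ϖ_j, ϖ_{j+1}, …)` of `R♭`, where `ϖ_0 = 0`. -/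
def TPERFAxioms.flatUniformizer {dv : R → R → Prop} {ϖ : ℕ+ → R} (h : TPERFAxioms p R dv ϖ)
    (j : ℕ) : Perfection R p :=
  ⟨fun i => uniformizerSeq ϖ (i + j), fun i => by
    have := h.uniformizerSeq_root (i + j)
    rwa [← Nat.add_right_comm] at this⟩

/-- The structure `R♭_α`. -/
def TPERFAxioms.flat {dv : R → R → Prop} {ϖ : ℕ+ → R} (h : TPERFAxioms p R dv ϖ)
    (α : Set.Ioo (0 : ℝ) 1) : Str.{u} LD :=
  ringStr (Perfection R p)
    (fun x y => flatNorm p α dv (h.flatUniformizer 0) (x - y))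
    h.flatUniformizer
    (fun _ x y => ⨅ z, flatNorm p α dv (h.flatUniformizer 0) (y - x * z))

end Tilt

section
variable {p : ℕ} [hp : Fact p.Prime]

theorem TPERF.charP {A : Str.{u} LDiv} (h : TPERF p A) :
    letI := h.isCommRing.commRing
    CharP A.carrier p := by
  let _ := h.isCommRing.commRing
  have : Nontrivial A.carrier := ⟨⟨_, _, h.axioms_hold.pseudoUniformizer.1⟩⟩
  exact (CharP.charP_iff_prime_eq_zero hp.out).2 h.axioms_hold.p_eq_zero

/-- The structure `A♭_α` for a model `A` of `TPERF_{p,ϖ}`. -/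
def tilt (α : Set.Ioo (0 : ℝ) 1) (A : Str.{u} LDiv) (h : TPERF p A) : Str.{u} LD :=
  letI := h.isCommRing.commRing
  haveI := h.charP
  h.axioms_hold.flat α

/-- The set `Ω(A)` of sequences `x` with `x_{i+1}^p = x_i`. -/
def Omega (A : Str.{u} LDiv) (h : TPERF p A) : Set (ℕ → A.carrier) :=
  letI := h.isCommRing.commRing
  {x | ∀ i, x (i + 1) ^ p = x i}

/-- The map `id_Ω : Ω(A) → A♭_α`. -/
def tiltInterp (p : ℕ) [Fact p.Prime] (α : Set.Ioo (0 : ℝ) 1) :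
    InterpMap.{u} LDiv LD (TPERF p) where
  ι := ℕ
  enc := inferInstance
  target := tilt α
  dom := Omega
  map A h x := (⟨x.1, x.2⟩ : letI := h.isCommRing.commRing; Perfection A.carrier p)

end

/-! ### The truncation -/

open Classical in
/-- The structure `(R/(ϖ_0), res(ϖ_i) | i ≥ 1)`, with its divisibility predicate. -/
def quotientStr {R : Type u} [CommRing R] (ϖ : ℕ → R) : Str.{u} LDiv :=
  ringStr (R ⧸ Ideal.span {ϖ 0})
    (fun x y => if x = y then 0 else 1)
    (fun i => Ideal.Quotient.mk _ (ϖ i))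
    (fun _ x y => if x ∣ y then 0 else 1)

section
variable {p : ℕ} {α : ℝ}

/-- The structure `B♮` for a model `B` of `PERF_{|p|=0,|ϖ|=α}`. -/
def truncation (B : Str.{u} LD) (h : PERF p α B) : Str.{u} LDiv :=
  letI := h.isCommRing.commRing
  quotientStr B.const

/-- The map `res_ϖ : B → B/(ϖ)`. -/
def resInterp (p : ℕ) (α : ℝ) : InterpMap.{u} LD LDiv (PERF p α) where
  ι := Unit
  enc := inferInstance
  target := truncation
  dom _ _ := Set.univ
  map B h x :=
    letI := h.isCommRing.commRing
    Ideal.Quotient.mk (Ideal.span {B.const 0}) (x.1 ())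

end

end ContLogic

end

/-! Everything rests on comparing coefficients in R♭ with its norm. In R, total divisibility and the
choice of ϖ_1 show that x^(p^k) = 0 forces ϖ_k ∣ x. Hence the k-th coefficient of x ∈ R♭ vanishes
exactly when v♭(x) ≥ p^k v♭(ϖ♭) (`flatLE_of_coeff_eq_zero`, `coeff_eq_zero_of_flatLE`), and v♭ is
decided at any single index where the multiple does not vanish (`flatLE_of_coeff_dvd`). A zero k-th
coefficient gives norm at most α^(p^k), and norm below α^(p^k) gives a zero k-th coefficient. So the
norm topology is the inverse limit topology, and R♭ is complete with approximate divisibility.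

Conversely, completeness of N makes divisibility total and N perfect, so N → N/(ϖ) lifts to g : N →
(N/(ϖ))♭. If u represents the i-th coefficient of g(x), then x^(1/p^i) - u lies in (ϖ), and
additivity of Frobenius gives |x - u^(p^i)| ≤ α^(p^i). Thus g is an isometric isomorphism whose
inverse is lim u_i^(p^i), at a rate independent of N (`exists_equiv_perfection`): a uniform limit of
terms. For the other composite, coefficient 0 maps R♭ onto R with kernel (ϖ♭), so that map is a
variable.

Quantifier-freeness uses uniform limits (`exists_limit_connective`). Over R, the norm of a lift of r
≠ 0 at index i depends only on r, and finitely many conditions ϖ_(i+k)^m ∣ r determine it up to 1 -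
α^(1/p^k). Cutting these norms off at 1, α, α^p, … and taking suprema extends the norm to all
sequences; the distance to Ω is approximated through the sequences of powers of single entries. The
predicate D(x, y) is 0 if x ∣ y and |y| otherwise. In N this leaves a gap: D(ϖ, y) is 0 or at least
α, so rescaling by 1/α yields the discrete predicates of N/(ϖ). -/

noncomputable section

namespace ContLogic

variable {L L₁ L₂ L₃ : CLang}

/-! ### Calculus of quantifier-free formulas -/

/-- A connective computing limits of sequences that converge at a prescribed rate. -/
theorem exists_limit_connective (ε : ℕ → ℝ) (hε : Filter.Tendsto ε Filter.atTop (nhds 0)) :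
    ∃ c : C(ℕ → unitInterval, unitInterval), ∀ (a : ℕ → unitInterval) (l : unitInterval),
      (∀ n, |(a n : ℝ) - l| ≤ ε n) → c a = l := by
  classical
  -- What convergence at rate ε implies without naming the limit. This closed condition defines the
  -- domain on which the limit is continuous.
  let S : Set (ℕ → unitInterval) := {a | ∀ m n, |(a m : ℝ) - a n| ≤ ε m + ε n}
  have hS : IsClosed S := by
    simp only [S, Set.ofPred_forall]
    refine isClosed_iInter fun m => isClosed_iInter fun n => isClosed_le ?_ continuous_const
    fun_prop
  have hlim : ∀ a : S, ∃ l : unitInterval, ∀ n, |(a.1 n : ℝ) - l| ≤ ε n := by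
    rintro ⟨a, ha⟩
    have hc : CauchySeq a := by
      refine Metric.cauchySeq_iff.2 fun δ hδ => ?_
      obtain ⟨N, hN⟩ := Filter.eventually_atTop.1 (hε.eventually (gt_mem_nhds (half_pos hδ)))
      refine ⟨N, fun m hm n hn => ?_⟩
      rw [Subtype.dist_eq, Real.dist_eq]
      linarith [ha m n, hN m hm, hN n hn]
    obtain ⟨l, hl⟩ := cauchySeq_tendsto_of_complete hc
    refine ⟨l, fun n => ?_⟩
    have h1 : Filter.Tendsto (fun m => |(a n : ℝ) - a m|) Filter.atTop (nhds |(a n : ℝ) - l|) :=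
      (tendsto_const_nhds.sub ((continuous_subtype_val.tendsto l).comp hl)).abs
    have h2 : Filter.Tendsto (fun m => ε n + ε m) Filter.atTop (nhds (ε n + 0)) :=
      tendsto_const_nhds.add hε
    simpa using le_of_tendsto_of_tendsto' h1 h2 fun m => ha n m
  choose l hl using hlim
  have hcont : Continuous l := by
    have : TendstoUniformly (fun n (a : S) => a.1 n) l Filter.atTop := by
      refine Metric.tendstoUniformly_iff.2 fun δ hδ => ?_
      filter_upwards [hε.eventually (gt_mem_nhds hδ)] with n hn a
      rw [dist_comm, Subtype.dist_eq, Real.dist_eq]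
      exact (hl a n).trans_lt hn
    exact this.continuous (Filter.Frequently.of_forall fun n =>
      (continuous_apply n).comp continuous_subtype_val)
  -- Tietze extension from the closed set `S` to the whole cube; the values outside `S` are
  -- irrelevant.
  obtain ⟨g, hg⟩ := ContinuousMap.exists_restrict_eq hS ⟨l, hcont⟩
  refine ⟨g, fun a b hab => ?_⟩
  have ha : a ∈ S := fun m n => by
    have := abs_sub_le (a m : ℝ) b (a n)
    rw [abs_sub_comm (b : ℝ)] at this
    linarith [hab m, hab n]
  have h1 : g a = l ⟨a, ha⟩ := congrArg (fun f => f ⟨a, ha⟩) hg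
  rw [h1]
  refine Subtype.ext (eq_of_forall_dist_le fun δ hδ => ?_)
  obtain ⟨n, hn⟩ := (hε.eventually (gt_mem_nhds (half_pos hδ))).exists
  have := abs_sub_le ((l ⟨a, ha⟩ : unitInterval) : ℝ) (a n) b
  rw [abs_sub_comm _ (a n : ℝ)] at this
  rw [Real.dist_eq]
  linarith [hl ⟨a, ha⟩ n, hab n]

/-- The function `F` on tuples in models of `T` is given by a quantifier-free formula. -/
def QFDef (T : Str.{u} L → Prop) {V : Type}
    (F : ∀ A : Str.{u} L, T A → (V → A.carrier) → unitInterval) : Prop :=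
  ∃ φ : Formula L V 0, φ.IsQF ∧ ∀ A h v, φ.eval A v = F A h v

section
variable {T : Str.{u} L → Prop} {V : Type}

theorem QFDef.conn {F : ℕ → ∀ A : Str.{u} L, T A → (V → A.carrier) → unitInterval}
    (hF : ∀ n, QFDef T (F n)) (c : C(ℕ → unitInterval, unitInterval)) :
    QFDef T (fun A h v => c fun n => F n A h v) := by
  choose φ hφ hφ' using hF
  refine ⟨.conn c φ, hφ, fun A h v => ?_⟩
  simp only [Formula.eval, Formula.realize]
  exact congrArg c (funext fun n => hφ' n A h v)

theorem QFDef.congr {F G : ∀ A : Str.{u} L, T A → (V → A.carrier) → unitInterval}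
    (hF : QFDef T F) (h : ∀ A hA v, F A hA v = G A hA v) : QFDef T G := by
  obtain ⟨φ, h1, h2⟩ := hF
  exact ⟨φ, h1, fun A hA v => (h2 A hA v).trans (h A hA v)⟩

/-- Atomic formulas take terms over `V ⊕ Fin n`; renaming along `Sum.inl` lets terms over `V` be
used in them. -/
theorem exists_rename {V W : Type} (σ : V → W) (t : Term L V) : ∃ t' : Term L W,
    ∀ (A : Str.{u} L) (w : W → A.carrier), t'.eval A w = t.eval A fun v => w (σ v) := by
  induction t with
  | var v => exact ⟨.var (σ v), fun _ _ => rfl⟩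
  | app f ts ih =>
    choose ts' h using ih
    exact ⟨.app f ts', fun A w => congrArg (A.fn f) (funext fun i => h i A w)⟩

theorem QFDef.dist (s t : Term L V) :
    QFDef T (fun A _ v => A.d (s.eval A v) (t.eval A v)) := by
  obtain ⟨s', hs⟩ := exists_rename.{u} (Sum.inl : V → V ⊕ Fin 0) s
  obtain ⟨t', ht⟩ := exists_rename.{u} (Sum.inl : V → V ⊕ Fin 0) t
  exact ⟨.dist s' t', trivial, fun A _ v => by
    simp [Formula.eval, Formula.realize, hs, ht]⟩

theorem QFDef.rel (r : L.Rel) (ts : Fin (L.relArity r) → Term L V) :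
    QFDef T (fun A _ v => A.rel r fun i => (ts i).eval A v) := by
  choose ts' h using fun i => exists_rename.{u} (Sum.inl : V → V ⊕ Fin 0) (ts i)
  exact ⟨.rel r ts', trivial, fun A _ v => by simp [Formula.eval, Formula.realize, h]⟩

/-- Formulas start from atomic ones, so a constant connective still needs some term to be fed with.
-/
theorem QFDef.const [hV : Nonempty (Term L V)] (a : unitInterval) :
    QFDef T (fun (A : Str.{u} L) _ (_ : V → A.carrier) => a) :=
  (QFDef.conn (F := fun _ A _ v => A.d (hV.some.eval A v) (hV.some.eval A v))
    (fun _ => QFDef.dist _ _) (ContinuousMap.const _ a))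

variable {F G : ∀ A : Str.{u} L, T A → (V → A.carrier) → unitInterval}

theorem QFDef.map (hF : QFDef T F) {g : unitInterval → unitInterval} (hg : Continuous g) :
    QFDef T (fun A h v => g (F A h v)) :=
  QFDef.conn (F := fun _ => F) (fun _ => hF) ⟨fun a => g (a 0), by fun_prop⟩

theorem QFDef.map₂ (hF : QFDef T F) (hG : QFDef T G)
    {g : unitInterval → unitInterval → unitInterval} (hg : Continuous (Function.uncurry g)) :
    QFDef T (fun A h v => g (F A h v) (G A h v)) := by
  refine (QFDef.conn (F := fun n => if n = 0 then F else G) (fun n => ?_)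
    ⟨fun a => Function.uncurry g (a 0, a 1), by fun_prop⟩).congr fun A h v => ?_
  · split_ifs <;> assumption
  · simp

theorem QFDef.min (hF : QFDef T F) (hG : QFDef T G) :
    QFDef T (fun A h v => F A h v ⊓ G A h v) :=
  hF.map₂ hG (continuous_fst.inf continuous_snd)

theorem QFDef.max (hF : QFDef T F) (hG : QFDef T G) :
    QFDef T (fun A h v => F A h v ⊔ G A h v) :=
  hF.map₂ hG (continuous_fst.sup continuous_snd)

variable {F : ℕ → ∀ A : Str.{u} L, T A → (V → A.carrier) → unitInterval}

theorem QFDef.finsetInf (hF : ∀ n, QFDef T (F n)) (s : Finset ℕ) :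
    QFDef T (fun A h v => s.inf fun n => F n A h v) :=
  QFDef.conn hF ⟨fun a => s.inf a,
    (Continuous.finset_inf_apply fun n _ => continuous_apply n).congr fun _ => rfl⟩

theorem QFDef.finsetSup (hF : ∀ n, QFDef T (F n)) (s : Finset ℕ) :
    QFDef T (fun A h v => s.sup fun n => F n A h v) :=
  QFDef.conn hF ⟨fun a => s.sup a,
    (Continuous.finset_sup_apply fun n _ => continuous_apply n).congr fun _ => rfl⟩

/-- Uniform limits of quantifier-free formulas, also on subsets of the tuples. -/
theorem exists_formula_of_limit (hF : ∀ n, QFDef T (F n)) (ε : ℕ → ℝ)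
    (hε : Filter.Tendsto ε Filter.atTop (nhds 0)) :
    ∃ φ : Formula L V 0, φ.IsQF ∧
      (∀ A h v l, (∀ n, |(F n A h v : ℝ) - (l : unitInterval)| ≤ ε n) → φ.eval A v = l) ∧
      (∀ A (h : T A) v v', (∀ n, F n A h v = F n A h v') → φ.eval A v = φ.eval A v') := by
  obtain ⟨c, hc⟩ := exists_limit_connective ε hε
  obtain ⟨φ, h1, h2⟩ := QFDef.conn hF c
  exact ⟨φ, h1, fun A h v l hl => (h2 A h v).trans (hc _ _ hl),
    fun A h v v' e => by
      rw [h2 A h, h2 A h]; exact congrArg c (funext e)⟩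

theorem QFDef.limit (hF : ∀ n, QFDef T (F n)) (ε : ℕ → ℝ)
    (hε : Filter.Tendsto ε Filter.atTop (nhds 0))
    (h : ∀ n A h v, |(F n A h v : ℝ) - G A h v| ≤ ε n) : QFDef T G := by
  obtain ⟨φ, h1, h2, -⟩ := exists_formula_of_limit hF ε hε
  exact ⟨φ, h1, fun A hA v => h2 A hA v _ fun n => h n A hA v⟩

end

/-! ### Distances between tuples -/

section
variable (A : Str.{u} L) {ι : Type} [Encodable ι]

theorem Str.tupleDist_bdd (u v : ι → A.carrier) :
    BddAbove (Set.range fun i => (1 / 2 : ℝ) ^ Encodable.encode i * (A.d (u i) (v i) : ℝ)) := by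
  refine ⟨1, ?_⟩
  rintro _ ⟨i, rfl⟩
  exact mul_le_one₀ (pow_le_one₀ (by norm_num) (by norm_num)) (A.d _ _).2.1 (A.d _ _).2.2

theorem Str.le_tupleDist (u v : ι → A.carrier) (i : ι) :
    (1 / 2 : ℝ) ^ Encodable.encode i * (A.d (u i) (v i) : ℝ) ≤ A.tupleDist u v :=
  le_ciSup (A.tupleDist_bdd u v) i

theorem Str.tupleDist_le {u v : ι → A.carrier} {a : ℝ} (ha : 0 ≤ a)
    (h : ∀ i, (1 / 2 : ℝ) ^ Encodable.encode i * (A.d (u i) (v i) : ℝ) ≤ a) :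
    A.tupleDist u v ≤ a :=
  Real.iSup_le h ha

theorem Str.tupleDist_nonneg (u v : ι → A.carrier) : 0 ≤ A.tupleDist u v :=
  Real.iSup_nonneg fun _ => mul_nonneg (by positivity) (A.d _ _).2.1

/-- For arity at most 2 every weight 2⁻ⁱ is at least 1/2. This is why the modulus ε/2 suits every
symbol that is non-expanding for the maximum of the distances. -/
theorem Str.d_le_of_tupleDist_lt {n : ℕ} (hn : n ≤ 2) (u v : Fin n → A.carrier) {ε : ℝ}
    (h : A.tupleDist u v < ε / 2) (i : Fin n) : (A.d (u i) (v i) : ℝ) < ε := by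
  have h1 := (A.le_tupleDist u v i).trans_lt h
  have h2 : (1 / 2 : ℝ) ^ 1 ≤ (1 / 2 : ℝ) ^ Encodable.encode i :=
    pow_le_pow_of_le_one (by norm_num) (by norm_num)
      (show i.1 ≤ 1 by have := i.2; lia)
  nlinarith [(A.d (u i) (v i)).2.1]

end

/-! ### Terms and structures in the languages of rings -/

section
variable {C P V : Type}

def Term.add (s t : Term (ringLang C P) V) : Term (ringLang C P) V := .app RingFn.add ![s, t]
def Term.mul (s t : Term (ringLang C P) V) : Term (ringLang C P) V := .app RingFn.mul ![s, t]
def Term.neg (s : Term (ringLang C P) V) : Term (ringLang C P) V := .app RingFn.neg ![s]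
def Term.zero : Term (ringLang C P) V := .app RingFn.zero ![]
def Term.one : Term (ringLang C P) V := .app RingFn.one ![]
def Term.const (c : C) : Term (ringLang C P) V := .app (RingFn.const c) ![]
def Term.pow (s : Term (ringLang C P) V) : ℕ → Term (ringLang C P) V
  | 0 => .one
  | n + 1 => .mul (.pow s n) s

instance : Nonempty (Term (ringLang C P) V) := ⟨.zero⟩

variable (A : Str.{u} (ringLang C P)) (v : V → A.carrier)

theorem Str.fn_add (w : Fin 2 → A.carrier) : A.fn RingFn.add w = A.add (w 0) (w 1) :=
  congrArg (A.fn RingFn.add) (funext fun i => by fin_cases i <;> rfl)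
theorem Str.fn_mul (w : Fin 2 → A.carrier) : A.fn RingFn.mul w = A.mul (w 0) (w 1) :=
  congrArg (A.fn RingFn.mul) (funext fun i => by fin_cases i <;> rfl)
theorem Str.fn_neg (w : Fin 1 → A.carrier) : A.fn RingFn.neg w = A.neg (w 0) :=
  congrArg (A.fn RingFn.neg) (funext fun i => by fin_cases i; rfl)
theorem Str.fn_zero (w : Fin 0 → A.carrier) : A.fn RingFn.zero w = A.zero :=
  congrArg (A.fn RingFn.zero) (funext fun i => i.elim0)
theorem Str.fn_one (w : Fin 0 → A.carrier) : A.fn RingFn.one w = A.one :=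
  congrArg (A.fn RingFn.one) (funext fun i => i.elim0)
theorem Str.fn_const (c : C) (w : Fin 0 → A.carrier) : A.fn (RingFn.const c) w = A.const c :=
  congrArg (A.fn (RingFn.const c)) (funext fun i => i.elim0)
theorem Str.rel_eq_pred (r : P) (w : Fin 2 → A.carrier) : A.rel r w = A.pred r (w 0) (w 1) :=
  congrArg (A.rel r) (funext fun i => by fin_cases i <;> rfl)

theorem Term.eval_add (s t : Term (ringLang C P) V) :
    (s.add t).eval A v = A.add (s.eval A v) (t.eval A v) := A.fn_add _
theorem Term.eval_mul (s t : Term (ringLang C P) V) :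
    (s.mul t).eval A v = A.mul (s.eval A v) (t.eval A v) := A.fn_mul _
theorem Term.eval_neg (s : Term (ringLang C P) V) :
    s.neg.eval A v = A.neg (s.eval A v) := A.fn_neg _
theorem Term.eval_zero : (Term.zero : Term (ringLang C P) V).eval A v = A.zero := A.fn_zero _
theorem Term.eval_one : (Term.one : Term (ringLang C P) V).eval A v = A.one := A.fn_one _
theorem Term.eval_const (c : C) :
    (Term.const c : Term (ringLang C P) V).eval A v = A.const c :=
  A.fn_const c _

variable {A}

theorem Term.eval_sub (h : A.IsCommRing) (s t : Term (ringLang C P) V) :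
    letI := h.commRing
    (s.add t.neg).eval A v = s.eval A v - t.eval A v := by
  let _ := h.commRing
  rw [eval_add, eval_neg, sub_eq_add_neg]; rfl

theorem Term.eval_pow (h : A.IsCommRing) (s : Term (ringLang C P) V) (n : ℕ) :
    letI := h.commRing
    (s.pow n).eval A v = s.eval A v ^ n := by
  let _ := h.commRing
  induction n with
  | zero => rw [pow_zero]; exact eval_one A v
  | succ n ih => rw [pow_succ, ← ih]; exact eval_mul A v _ _

variable {T : Str.{u} (ringLang C P) → Prop}

theorem QFDef.pred (r : P) (s t : Term (ringLang C P) V) :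
    QFDef T (fun A _ v => A.pred r (s.eval A v) (t.eval A v)) :=
  (QFDef.rel (L := ringLang C P) r ![s, t]).congr fun A _ _ => A.rel_eq_pred r _

theorem ringStr_isCommRing (R : Type u) [CommRing R] (d : R → R → unitInterval) (c : C → R)
    (r : P → R → R → unitInterval) : (ringStr R d c r).IsCommRing where
  add_assoc := fun x y z : R => _root_.add_assoc x y z
  add_comm := fun x y : R => _root_.add_comm x y
  zero_add := fun x : R => _root_.zero_add x
  neg_add_cancel := fun x : R => _root_.neg_add_cancel x
  mul_assoc := fun x y z : R => _root_.mul_assoc x y z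
  mul_comm := fun x y : R => _root_.mul_comm x y
  one_mul := fun x : R => _root_.one_mul x
  left_distrib := fun x y z : R => _root_.mul_add x y z

/-- The ring rebuilt from the symbols has its own auxiliary data (powers, scalar multiples), so it
is not the given instance by definition. Rewriting along this equality transfers ring theory to the
models. -/
theorem commRing_ringStr (R : Type u) [inst : CommRing R] (d : R → R → unitInterval) (c : C → R)
    (r : P → R → R → unitInterval) (h : (ringStr R d c r).IsCommRing) : h.commRing = inst :=
  CommRing.ext rfl rfl

end

end ContLogic
end

noncomputable section

namespace ContLogic

/-! ### The tilt of a truncated perfect valuation ring -/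

namespace TPERFAxioms

variable {p : ℕ} {R : Type u} [CommRing R] {dv : R → R → Prop} {ϖ : ℕ+ → R}
  (h : TPERFAxioms p R dv ϖ)
include h

theorem dvd_total (x y : R) : x ∣ y ∨ y ∣ x := by
  rw [← h.dv_iff, ← h.dv_iff]; exact h.dv_total x y

/-- Whichever of y and 1 - y divides the other is a unit, their sum being 1. Since x(1 - y) = 0 and
x ≠ 0, it is y. This is derived from total divisibility because the variables of the field `unit`
are natural numbers, not ring elements. -/
theorem isUnit_of_eq_mul {x y : R} (hx : x ≠ 0) (e : x = x * y) : IsUnit y := by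
  rcases h.dvd_total y (1 - y) with ⟨c, hc⟩ | ⟨c, hc⟩
  · exact IsUnit.of_mul_eq_one (1 + c) (by linear_combination -hc)
  · refine absurd ?_ hx
    linear_combination (1 + c) * e + x * hc

theorem uniformizerSeq_pow (i n : ℕ) :
    uniformizerSeq ϖ (i + n) ^ p ^ n = uniformizerSeq ϖ i := by
  induction n with
  | zero => simp
  | succ n ih => rw [pow_succ', pow_mul, ← add_assoc, h.uniformizerSeq_root, ih]

theorem uniformizerSeq_one_ne_zero : uniformizerSeq ϖ 1 ≠ 0 := h.pseudoUniformizer.1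

/-- The defining property of ϖ_1 gives ϖ_1 ∣ x^(p^k). If instead ϖ_(k+1) = xy, raising to the power
p^k shows that ϖ_1 is a multiple of itself by c·y^(p^k). That factor is then a unit, hence so is y.
-/
theorem uniformizerSeq_dvd {x : R} : ∀ {k : ℕ}, x ^ p ^ k = 0 → uniformizerSeq ϖ k ∣ x
  | 0, hx => by simp_all
  | k + 1, hx => by
    have h1 : uniformizerSeq ϖ 1 ∣ x ^ p ^ k :=
      (h.dv_iff _ _).1 (h.pseudoUniformizer.2.2 _ (by rw [← pow_mul, ← pow_succ, hx]))
    obtain ⟨c, hc⟩ := h1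
    refine (h.dvd_total x (uniformizerSeq ϖ (k + 1))).elim (fun ⟨y, hy⟩ => ?_) id
    have e : uniformizerSeq ϖ 1 = uniformizerSeq ϖ 1 * (c * y ^ p ^ k) := by
      rw [← mul_assoc, ← hc, ← mul_pow, ← hy, add_comm k 1, h.uniformizerSeq_pow]
    -- Primality is not assumed here. The degenerate case is p = 0, where ϖ_1^0 = 0 collapses the
    -- ring.
    by_cases hk : p ^ k = 0
    · have := h.isUnit_of_eq_mul h.uniformizerSeq_one_ne_zero e
      have hp : p = 0 := by
        by_contra hp; exact pow_ne_zero k hp hk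
      rcases k with _ | k
      · simp at hk
      · have := h.pseudoUniformizer.2.1
        rw [hp, pow_zero] at this
        rw [← mul_one x, this, mul_zero]; exact dvd_zero _
    · have hu := isUnit_of_mul_isUnit_right
        (h.isUnit_of_eq_mul h.uniformizerSeq_one_ne_zero e)
      obtain ⟨v, hv⟩ := isUnit_iff_exists_inv.1 ((isUnit_pow_iff hk).1 hu)
      exact ⟨v, by rw [hy, mul_assoc, hv, mul_one]⟩

variable [Fact p.Prime] [CharP R p]

omit h in
theorem coeff_pow (x : Perfection R p) (i n : ℕ) :
    Perfection.coeff R p (i + n) x ^ p ^ n = Perfection.coeff R p i x := by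
  induction n with
  | zero => simp
  | succ n ih => rw [pow_succ', pow_mul, ← add_assoc, Perfection.coeff_pow_p', ih]

omit h in
theorem coeff_pow_sub (x : Perfection R p) {i k : ℕ} (hik : i ≤ k) :
    Perfection.coeff R p k x ^ p ^ (k - i) = Perfection.coeff R p i x := by
  conv_lhs => enter [1]; rw [← Nat.add_sub_cancel' hik]
  exact coeff_pow x i _

theorem exists_coeff (r : R) (i : ℕ) : ∃ x : Perfection R p, Perfection.coeff R p i x = r :=
  Perfection.coeff_surjective (fun y => h.frobenius_surjective y) i r

theorem flatLE_iff {x y : Perfection R p} : flatLE p dv x y ↔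
    ∀ i, Perfection.coeff R p i x ∣ Perfection.coeff R p i y :=
  forall_congr' fun _ => h.dv_iff _ _

theorem coeff_flatUniformizer (i k : ℕ) :
    Perfection.coeff R p i (h.flatUniformizer k) = uniformizerSeq ϖ (i + k) := rfl

theorem coeff_zero_flatUniformizer_pow {m : ℕ} (hm : m ≠ 0) :
    Perfection.coeff R p 0 (h.flatUniformizer 0 ^ m) = 0 := by
  rw [map_pow, coeff_flatUniformizer, uniformizerSeq, zero_pow hm]

theorem flatUniformizer_pow (i k : ℕ) :
    h.flatUniformizer (i + k) ^ p ^ k = h.flatUniformizer i := by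
  ext n
  rw [map_pow, coeff_flatUniformizer, coeff_flatUniformizer, ← add_assoc, h.uniformizerSeq_pow]

theorem flatLE_refl (x : Perfection R p) : flatLE p dv x x :=
  h.flatLE_iff.2 fun _ => dvd_rfl

/-! ### The comparison `v♭` as a total, cancellative preorder -/

variable {x y z : Perfection R p}

theorem flatLE_trans (h1 : flatLE p dv x y) (h2 : flatLE p dv y z) : flatLE p dv x z :=
  h.flatLE_iff.2 fun i => (h.flatLE_iff.1 h1 i).trans (h.flatLE_iff.1 h2 i)

theorem flatLE_mul {x' y' : Perfection R p} (h1 : flatLE p dv x y) (h2 : flatLE p dv x' y') :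
    flatLE p dv (x * x') (y * y') :=
  h.flatLE_iff.2 fun i => by
    rw [map_mul, map_mul]
    exact mul_dvd_mul (h.flatLE_iff.1 h1 i) (h.flatLE_iff.1 h2 i)

theorem flatLE_pow (h1 : flatLE p dv x y) (n : ℕ) : flatLE p dv (x ^ n) (y ^ n) :=
  h.flatLE_iff.2 fun i => by
    rw [map_pow, map_pow]
    exact pow_dvd_pow_of_dvd (h.flatLE_iff.1 h1 i) n

theorem flatLE_add (h1 : flatLE p dv x y) (h2 : flatLE p dv x z) : flatLE p dv x (y + z) :=
  h.flatLE_iff.2 fun i => by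
    rw [map_add]
    exact dvd_add (h.flatLE_iff.1 h1 i) (h.flatLE_iff.1 h2 i)

theorem flatLE_of_dvd (h1 : x ∣ y) : flatLE p dv x y :=
  h.flatLE_iff.2 fun _ => map_dvd _ h1

/-- Divisibility at one index where the multiple does not vanish decides the comparison. -/
theorem flatLE_of_coeff_dvd {i : ℕ} (hy : Perfection.coeff R p i y ≠ 0)
    (hd : Perfection.coeff R p i x ∣ Perfection.coeff R p i y) : flatLE p dv x y := by
  refine h.flatLE_iff.2 fun j => ?_
  rcases le_total j i with hj | hj
  · rw [← coeff_pow_sub x hj, ← coeff_pow_sub y hj]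
    exact pow_dvd_pow_of_dvd hd _
  -- Beyond i the alternative is x_j = y_j c. Brought down to index i and combined with x_i ∣ y_i ≠
  -- 0, it makes c a unit.
  · refine (h.dvd_total _ _).elim id fun ⟨c, hc⟩ => ?_
    obtain ⟨e, he⟩ := hd
    have h1 : Perfection.coeff R p i x = Perfection.coeff R p i y * c ^ p ^ (j - i) := by
      rw [← coeff_pow_sub x hj, ← coeff_pow_sub y hj, hc, mul_pow]
    have h2 : IsUnit (c ^ p ^ (j - i)) := by
      rw [h1, mul_assoc] at he
      exact isUnit_of_mul_isUnit_left (h.isUnit_of_eq_mul hy he)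
    obtain ⟨v, hv⟩ := isUnit_iff_exists_inv.1
      ((isUnit_pow_iff (pow_ne_zero _ (Fact.out : p.Prime).ne_zero)).1 h2)
    exact ⟨v, by rw [hc, mul_assoc, hv, mul_one]⟩

/-- Divisibility at one index passes to all smaller ones by taking p-th powers. Failures at i and at
j would therefore both contradict the comparison at i + j. -/
theorem flatLE_total (x y : Perfection R p) : flatLE p dv x y ∨ flatLE p dv y x := by
  by_contra! hn
  simp only [h.flatLE_iff, not_forall] at hn
  obtain ⟨⟨i, hi⟩, j, hj⟩ := hn
  have aux : ∀ {x y : Perfection R p} {i k : ℕ}, i ≤ k →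
      Perfection.coeff R p k x ∣ Perfection.coeff R p k y →
      Perfection.coeff R p i x ∣ Perfection.coeff R p i y := fun {x y i k} hik hd => by
    rw [← coeff_pow_sub x hik, ← coeff_pow_sub y hik]
    exact pow_dvd_pow_of_dvd hd _
  rcases h.dvd_total (Perfection.coeff R p (i + j) x) (Perfection.coeff R p (i + j) y) with hd | hd
  · exact hi (aux (Nat.le_add_right i j) hd)
  · exact hj (aux (Nat.le_add_left j i) hd)

/-- Beyond k, the j-th coefficient of (ϖ♭)^(p^k) is ϖ_(j-k), and x_j^(p^(j-k)) = x_k = 0, so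
`uniformizerSeq_dvd` applies. With the next lemma, the kernel of coefficient k is the set of
elements above (ϖ♭)^(p^k). -/
theorem flatLE_of_coeff_eq_zero {k : ℕ} (hx : Perfection.coeff R p k x = 0) :
    flatLE p dv (h.flatUniformizer 0 ^ p ^ k) x := by
  refine h.flatLE_iff.2 fun j => ?_
  rcases le_total j k with hj | hj
  · rw [← coeff_pow_sub x hj, hx, zero_pow (pow_ne_zero _ (Fact.out : p.Prime).ne_zero)]
    exact dvd_zero _
  · have e : uniformizerSeq ϖ j ^ p ^ k = uniformizerSeq ϖ (j - k) := by
      conv_lhs => rw [← Nat.sub_add_cancel hj]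
      exact h.uniformizerSeq_pow _ _
    rw [map_pow, coeff_flatUniformizer, add_zero, e]
    exact h.uniformizerSeq_dvd (by rw [coeff_pow_sub x hj, hx])

theorem coeff_eq_zero_of_flatLE {k : ℕ} (hx : flatLE p dv (h.flatUniformizer 0 ^ p ^ k) x) :
    Perfection.coeff R p k x = 0 := by
  have h1 := h.flatLE_iff.1 hx k
  have h2 := h.uniformizerSeq_pow 0 k
  rw [zero_add] at h2
  rwa [map_pow, coeff_flatUniformizer, add_zero, h2, uniformizerSeq, zero_dvd_iff] at h1

/-- Bounding nonzero elements by powers of ϖ♭ is what makes R♭ a domain and its coarsened norm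
positive away from zero. -/
theorem exists_flatLE_pow (hx : x ≠ 0) :
    ∃ k, flatLE p dv x (h.flatUniformizer 0 ^ k) := by
  obtain ⟨k, hk⟩ : ∃ k, Perfection.coeff R p k x ≠ 0 := by
    by_contra! hn; exact hx (Perfection.ext fun n => by rw [hn, map_zero])
  exact ⟨p ^ k, (h.flatLE_total _ _).resolve_right fun h' => hk (h.coeff_eq_zero_of_flatLE h')⟩

theorem flatUniformizer_pow_ne_zero (n : ℕ) : h.flatUniformizer 0 ^ n ≠ 0 := by
  intro e
  have e' : h.flatUniformizer 0 ^ p ^ n = 0 :=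
    pow_eq_zero_of_le (Nat.lt_pow_self (Fact.out : p.Prime).one_lt).le e
  have h1 : Perfection.coeff R p (1 + n) (h.flatUniformizer 0 ^ p ^ n) = 0 := by
    rw [e', map_zero]
  rw [map_pow, coeff_flatUniformizer, add_zero, h.uniformizerSeq_pow] at h1
  exact h.uniformizerSeq_one_ne_zero h1

theorem flat_mul_ne_zero (hx : x ≠ 0) (hy : y ≠ 0) : x * y ≠ 0 := by
  intro e
  obtain ⟨m, hm⟩ := h.exists_flatLE_pow hx
  obtain ⟨n, hn⟩ := h.exists_flatLE_pow hy
  have h1 := h.flatLE_mul hm hn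
  rw [e, ← pow_add] at h1
  refine h.flatUniformizer_pow_ne_zero (m + n) (Perfection.ext fun i => ?_)
  simpa using h.flatLE_iff.1 h1 i

theorem flat_isDomain : IsDomain (Perfection R p) := by
  have : Nontrivial (Perfection R p) := ⟨⟨_, _, h.flatUniformizer_pow_ne_zero 0⟩⟩
  have : NoZeroDivisors (Perfection R p) := ⟨fun {a b} e => by
    by_contra! hn; exact h.flat_mul_ne_zero hn.1 hn.2 e⟩
  exact NoZeroDivisors.to_isDomain _

/-- At an index where yz does not vanish, x_i = y_i c, and cancelling the nonzero (yz)_i turns c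
into a unit. One such index suffices. -/
theorem flatLE_cancel (hz : z ≠ 0) (hxy : flatLE p dv (x * z) (y * z)) : flatLE p dv x y := by
  by_cases hy : y = 0
  · rw [hy]; exact h.flatLE_of_dvd (dvd_zero _)
  refine (h.flatLE_total x y).elim id fun hyx => ?_
  obtain ⟨i, hi⟩ : ∃ i, Perfection.coeff R p i (y * z) ≠ 0 := by
    by_contra! hn
    exact h.flat_mul_ne_zero hy hz (Perfection.ext fun n => by rw [hn, map_zero])
  obtain ⟨c, hc⟩ := h.flatLE_iff.1 hyx i
  obtain ⟨e, he⟩ := h.flatLE_iff.1 hxy i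
  have hy0 : Perfection.coeff R p i y ≠ 0 := fun e0 => hi (by rw [map_mul, e0, zero_mul])
  refine h.flatLE_of_coeff_dvd hy0 ?_
  have hu : IsUnit (c * e) := h.isUnit_of_eq_mul hi (by
    conv_lhs => rw [he]
    rw [map_mul, map_mul, hc]; ring)
  obtain ⟨v, hv⟩ := isUnit_iff_exists_inv.1 (isUnit_of_mul_isUnit_left hu)
  exact ⟨v, by rw [hc, mul_assoc, hv, mul_one]⟩

theorem le_of_flatUniformizer_pow_le {m n : ℕ}
    (hmn : flatLE p dv (h.flatUniformizer 0 ^ m) (h.flatUniformizer 0 ^ n)) : m ≤ n := by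
  by_contra! hlt
  obtain ⟨k, rfl⟩ := Nat.exists_eq_add_of_lt hlt
  have h1 : flatLE p dv (h.flatUniformizer 0 ^ (k + 1)) 1 :=
    h.flatLE_cancel (h.flatUniformizer_pow_ne_zero n) (by
      rwa [one_mul, ← pow_add, add_comm, ← add_assoc])
  have h2 := h.flatLE_iff.1 h1 0
  rw [h.coeff_zero_flatUniformizer_pow k.succ_ne_zero, zero_dvd_iff, map_one] at h2
  exact h.uniformizerSeq_one_ne_zero (by rw [← mul_one (uniformizerSeq ϖ 1), h2, mul_zero])

end TPERFAxioms

end ContLogic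
end

noncomputable section

namespace ContLogic

/-! ### The norm on the tilt -/

/-- Density of the rationals after taking logarithms to base α. -/
theorem exists_rpow_between {α s t : ℝ} (h0 : 0 < α) (h1 : α < 1) (hs : 0 ≤ s) (hst : s < t)
    (ht : t ≤ 1) : ∃ m n : ℕ, 0 < n ∧ s < α ^ ((m : ℝ) / n) ∧ α ^ ((m : ℝ) / n) < t := by
  have ht0 : 0 < t := hs.trans_lt hst
  -- The lower end s may be 0, which has no logarithm; t / 2 replaces it.
  have hs' : 0 < max s (t / 2) := lt_max_of_lt_right (half_pos ht0)
  obtain ⟨q, hq1, hq2⟩ := exists_rat_btwn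
    ((Real.logb_lt_logb_iff_of_base_lt_one h0 h1 ht0 hs').2 (max_lt hst (half_lt_self ht0)))
  have hq0 : (0 : ℝ) ≤ q := (Real.logb_nonneg_of_base_lt_one h0 h1 ht0 ht).trans hq1.le
  have hq : ((q.num.toNat : ℝ) / (q.den : ℝ)) = q := by
    have hn : 0 ≤ q.num := Rat.num_nonneg.2 (by exact_mod_cast hq0)
    have : ((q.num.toNat : ℤ) : ℝ) = q.num := by rw [Int.toNat_of_nonneg hn]
    rw [← Int.cast_natCast, this]
    exact_mod_cast Rat.num_div_den q
  refine ⟨q.num.toNat, q.den, q.pos, ?_, ?_⟩ <;> rw [hq]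
  · refine (le_max_left _ _).trans_lt ((Real.logb_lt_logb_iff_of_base_lt_one h0 h1 (Real.rpow_pos_of_pos h0 _) hs').1 ?_)
    rwa [Real.logb_rpow h0 h1.ne]
  · refine (Real.logb_lt_logb_iff_of_base_lt_one h0 h1 ht0 (Real.rpow_pos_of_pos h0 _)).1 ?_
    rwa [Real.logb_rpow h0 h1.ne]

namespace TPERFAxioms

variable {p : ℕ} {R : Type u} [CommRing R] {dv : R → R → Prop} {ϖ : ℕ+ → R}
  (h : TPERFAxioms p R dv ϖ) [Fact p.Prime] [CharP R p] (α : Set.Ioo (0 : ℝ) 1)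

/-- The norm `|x|♭_α`. -/
def norm (x : Perfection R p) : unitInterval := flatNorm p α dv (h.flatUniformizer 0) x

variable {α} {x y : Perfection R p}
include h

theorem norm_le {m n : ℕ} (hn : 0 < n) (hx : flatLE p dv (h.flatUniformizer 0 ^ m) (x ^ n)) :
    (h.norm α x : ℝ) ≤ α.1 ^ ((m : ℝ) / n) :=
  Subtype.coe_le_coe.2 (iInf_le (fun q : {q : ℕ × ℕ // 0 < q.2 ∧
    flatLE p dv (h.flatUniformizer 0 ^ q.1) (x ^ q.2)} =>
    (⟨α.1 ^ ((q.1.1 : ℝ) / (q.1.2 : ℝ)), Real.rpow_nonneg α.2.1.le _,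
      Real.rpow_le_one α.2.1.le α.2.2.le (by positivity)⟩ : unitInterval)) ⟨(m, n), hn, hx⟩)

theorem le_norm {b : ℝ} (hb : ∀ m n : ℕ, 0 < n →
    flatLE p dv (h.flatUniformizer 0 ^ m) (x ^ n) → b ≤ α.1 ^ ((m : ℝ) / n)) :
    b ≤ h.norm α x := by
  rcases le_or_gt b 0 with hb0 | hb0
  · exact hb0.trans (h.norm α x).2.1
  have hb1 : b ≤ 1 := by
    have := hb 0 1 one_pos (h.flatLE_of_dvd (by simp))
    simpa using this
  have : (⟨b, hb0.le, hb1⟩ : unitInterval) ≤ h.norm α x :=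
    le_iInf fun q => Subtype.coe_le_coe.1 (hb q.1.1 q.1.2 q.2.1 q.2.2)
  exact Subtype.coe_le_coe.2 this

theorem rpow_le_norm {m n : ℕ} (hn : 0 < n)
    (hx : flatLE p dv (x ^ n) (h.flatUniformizer 0 ^ m)) :
    α.1 ^ ((m : ℝ) / n) ≤ h.norm α x := by
  refine h.le_norm fun M N hN hMN => ?_
  have h1 := h.flatLE_pow hMN n
  have h2 := h.flatLE_pow hx N
  rw [← pow_mul] at h1 h2
  rw [← pow_mul, mul_comm N n] at h1
  rw [← pow_mul] at h2
  have h3 : M * n ≤ m * N := h.le_of_flatUniformizer_pow_le (h.flatLE_trans h1 h2)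
  refine Real.rpow_le_rpow_of_exponent_ge α.2.1 α.2.2.le ?_
  rw [div_le_div_iff₀ (by exact_mod_cast hN) (by exact_mod_cast hn)]
  exact_mod_cast h3

/-- By totality, an exponent m/n that is not admissible for the infimum satisfies the opposite
comparison. So the norm, defined as an infimum, can also be approached from below. -/
theorem exists_of_lt_norm {t : ℝ} (ht0 : 0 ≤ t) (ht : t < h.norm α x) : ∃ m n : ℕ, 0 < n ∧
    t ≤ α.1 ^ ((m : ℝ) / n) ∧ flatLE p dv (x ^ n) (h.flatUniformizer 0 ^ m) := by
  obtain ⟨m, n, hn, h1, h2⟩ := exists_rpow_between α.2.1 α.2.2 ht0 ht (h.norm α x).2.2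
  exact ⟨m, n, hn, h1.le, (h.flatLE_total _ _).resolve_right fun h' =>
    (h.norm_le hn h').not_gt h2⟩

theorem norm_anti (hxy : flatLE p dv x y) : (h.norm α y : ℝ) ≤ h.norm α x :=
  h.le_norm fun _ n hn hm => h.norm_le hn (h.flatLE_trans hm (h.flatLE_pow hxy n))

/-- For ≤, exponents admissible for x and for y add up. For ≥, the reverse comparisons from
`exists_of_lt_norm` add up in the same way. -/
theorem norm_mul : (h.norm α (x * y) : ℝ) = h.norm α x * h.norm α y := by
  apply le_antisymm
  · have key : ∀ m n : ℕ, 0 < n → flatLE p dv (h.flatUniformizer 0 ^ m) (y ^ n) →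
        (h.norm α (x * y) : ℝ) ≤ h.norm α x * α.1 ^ ((m : ℝ) / n) := fun m n hn hm => by
      have hpos : 0 < α.1 ^ ((m : ℝ) / n) := Real.rpow_pos_of_pos α.2.1 _
      rw [← div_le_iff₀ hpos]
      refine h.le_norm fun M N hN hM => ?_
      rw [div_le_iff₀ hpos, ← Real.rpow_add α.2.1, div_add_div _ _
        (by exact_mod_cast hN.ne') (by exact_mod_cast hn.ne')]
      have := h.norm_le (α := α) (x := x * y) (m := M * n + N * m) (n := N * n) (by positivity)
        (by
          have h1 := h.flatLE_mul (h.flatLE_pow hM n) (h.flatLE_pow hm N)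
          rw [← pow_mul, ← pow_mul, ← pow_mul, ← pow_mul, ← pow_add, mul_comm n N, mul_comm m N,
            ← mul_pow] at h1
          exact h1)
      push_cast at this
      exact this
    rcases (h.norm α x).2.1.eq_or_lt with h0 | h0
    · rw [← h0, zero_mul]
      have := key 0 1 one_pos (h.flatLE_of_dvd (by simp))
      rwa [← h0, zero_mul] at this
    · rw [← div_le_iff₀' h0]
      exact h.le_norm fun m n hn hm => (div_le_iff₀' h0).2 (key m n hn hm)
  · refine mul_le_of_forall_lt_of_nonneg (h.norm α x).2.1 (h.norm α _).2.1
      fun s hs0 hs t ht0 ht => ?_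
    obtain ⟨m, n, hn, h1, h2⟩ := h.exists_of_lt_norm hs0 hs
    obtain ⟨M, N, hN, h3, h4⟩ := h.exists_of_lt_norm ht0 ht
    refine (mul_le_mul h1 h3 ht0 (Real.rpow_nonneg α.2.1.le _)).trans ?_
    rw [← Real.rpow_add α.2.1, div_add_div _ _
        (by exact_mod_cast hn.ne') (by exact_mod_cast hN.ne')]
    have := h.rpow_le_norm (α := α) (x := x * y) (m := m * N + n * M) (n := n * N) (by positivity)
        (by
          have h1 := h.flatLE_mul (h.flatLE_pow h2 N) (h.flatLE_pow h4 n)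
          rw [← pow_mul, ← pow_mul, ← pow_mul, ← pow_mul, ← pow_add, mul_comm N n, mul_comm M n,
            ← mul_pow] at h1
          exact h1)
    push_cast at this
    exact this

theorem norm_add_le : h.norm α (x + y) ≤ max (h.norm α x) (h.norm α y) := by
  rcases h.flatLE_total x y with hxy | hxy
  · exact le_max_of_le_left (h.norm_anti (h.flatLE_add (h.flatLE_refl x) hxy))
  · exact le_max_of_le_right (h.norm_anti (h.flatLE_add hxy (h.flatLE_refl y)))

theorem norm_flatUniformizer_pow (m : ℕ) : (h.norm α (h.flatUniformizer 0 ^ m) : ℝ) = α.1 ^ m := by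
  have h1 := h.norm_le (α := α) (x := h.flatUniformizer 0 ^ m) (m := m) (n := 1) one_pos
    (by rw [pow_one]; exact h.flatLE_refl _)
  have h2 := h.rpow_le_norm (α := α) (x := h.flatUniformizer 0 ^ m) (m := m) (n := 1) one_pos
    (by rw [pow_one]; exact h.flatLE_refl _)
  simp only [Nat.cast_one, div_one, Real.rpow_natCast] at h1 h2
  exact le_antisymm h1 h2

theorem norm_one : h.norm α 1 = 1 :=
  Subtype.ext (by simpa using h.norm_flatUniformizer_pow (α := α) 0)

theorem norm_zero : h.norm α 0 = 0 := by
  refine Subtype.ext (le_antisymm ?_ (h.norm α 0).2.1)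
  refine ge_of_tendsto' (tendsto_pow_atTop_nhds_zero_of_lt_one α.2.1.le α.2.2) fun m => ?_
  rw [← h.norm_flatUniformizer_pow]
  exact h.norm_anti (h.flatLE_of_dvd (dvd_zero _))

theorem norm_eq_zero : h.norm α x = 0 ↔ x = 0 := by
  refine ⟨fun e => ?_, fun e => e ▸ h.norm_zero⟩
  by_contra hx
  obtain ⟨k, hk⟩ := h.exists_flatLE_pow hx
  have := h.norm_anti (α := α) hk
  rw [h.norm_flatUniformizer_pow, e] at this
  exact (pow_pos α.2.1 k).not_ge this

theorem norm_neg : h.norm α (-x) = h.norm α x :=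
  le_antisymm (h.norm_anti (h.flatLE_of_dvd (dvd_neg.2 dvd_rfl)))
    (h.norm_anti (h.flatLE_of_dvd (neg_dvd.2 dvd_rfl)))

theorem norm_pow (n : ℕ) : (h.norm α (x ^ n) : ℝ) = (h.norm α x : ℝ) ^ n := by
  induction n with
  | zero => simp [h.norm_one]
  | succ n ih => rw [pow_succ, h.norm_mul, ih, pow_succ]

theorem norm_le_of_coeff_eq_zero {k : ℕ} (hx : Perfection.coeff R p k x = 0) :
    (h.norm α x : ℝ) ≤ α.1 ^ p ^ k := by
  rw [← h.norm_flatUniformizer_pow]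
  exact h.norm_anti (h.flatLE_of_coeff_eq_zero hx)

/-- The inequality is strict because the coarsening can give norm α^(p^k) also to elements that v♭
places strictly below (ϖ♭)^(p^k). -/
theorem coeff_eq_zero_of_norm_lt {k : ℕ} (hx : (h.norm α x : ℝ) < α.1 ^ p ^ k) :
    Perfection.coeff R p k x = 0 := by
  rw [← h.norm_flatUniformizer_pow] at hx
  exact h.coeff_eq_zero_of_flatLE
    ((h.flatLE_total _ _).resolve_right fun h' => (h.norm_anti h').not_gt hx)

theorem norm_flatUniformizer (k m : ℕ) :
    (h.norm α (h.flatUniformizer k ^ m) : ℝ) = (α.1 ^ ((1 : ℝ) / p ^ k)) ^ m := by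
  rw [h.norm_pow]
  congr 1
  have h1 := congrArg (fun x => (h.norm α x : ℝ)) (h.flatUniformizer_pow 0 k)
  have h2 := h.norm_flatUniformizer_pow (α := α) 1
  simp only [pow_one] at h2
  simp only [zero_add, h.norm_pow, h2] at h1
  rw [← h1, ← Real.rpow_natCast, ← Real.rpow_mul (h.norm α _).2.1]
  push_cast
  rw [mul_one_div_cancel, Real.rpow_one]
  exact pow_ne_zero _ (by exact_mod_cast (Fact.out : p.Prime).ne_zero)

/-- Elements with a common nonzero coefficient have the same norm. -/
theorem norm_eq_of_coeff_eq {i : ℕ} (hx : Perfection.coeff R p i x ≠ 0)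
    (hxy : Perfection.coeff R p i x = Perfection.coeff R p i y) : h.norm α x = h.norm α y :=
  le_antisymm (h.norm_anti (h.flatLE_of_coeff_dvd hx hxy.symm.dvd))
    (h.norm_anti (h.flatLE_of_coeff_dvd (hxy ▸ hx) hxy.dvd))

end TPERFAxioms

end ContLogic
end

noncomputable section

namespace ContLogic

/-! ### The tilt is a model -/

theorem isStructure_of_norm {C P : Type} {K : Type u} [CommRing K] (nm : K → unitInterval)
    (zero_iff : ∀ x, nm x = 0 ↔ x = 0) (neg : ∀ x, nm (-x) = nm x)
    (mul : ∀ x y, (nm (x * y) : ℝ) = nm x * nm y)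
    (add_le : ∀ x y, nm (x + y) ≤ max (nm x) (nm y))
    (complete : ∀ s : ℕ → K,
      (∀ ε : ℝ, 0 < ε → ∃ N, ∀ m ≥ N, ∀ n ≥ N, (nm (s m - s n) : ℝ) ≤ ε) →
        ∃ x, ∀ ε : ℝ, 0 < ε → ∃ N, ∀ n ≥ N, (nm (s n - x) : ℝ) ≤ ε) (c : C → K) :
    (ringStr (P := P) K (fun x y => nm (x - y)) c
      (fun _ x y => ⨅ z, nm (y - x * z))).IsStructure := by
  have mul_le : ∀ x y, nm (x * y) ≤ nm x := fun x y => Subtype.coe_le_coe.1 (by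
    rw [mul]; exact mul_le_of_le_one_right (nm x).2.1 (nm y).2.2)
  have hD : ∀ x y x' y' : K, (⨅ z, nm (y' - x' * z)) ≤
      max (⨅ z, nm (y - x * z)) (max (nm (x - x')) (nm (y - y'))) := fun x y x' y' => by
    by_contra! hlt
    obtain ⟨h1, h2⟩ := max_lt_iff.1 hlt
    obtain ⟨z, hz⟩ := iInf_lt_iff.1 h1
    refine (iInf_le (fun z => nm (y' - x' * z)) z).not_gt ?_
    -- The same z serves both infima, so the ultrametric inequality makes D non-expanding.
    have e : y' - x' * z = (y - x * z) + ((x - x') * z + -(y - y')) := by ring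
    rw [e]
    refine (add_le _ _).trans_lt (max_lt hz ((add_le _ _).trans_lt (max_lt ?_ ?_)))
    · exact (mul_le _ _).trans_lt (max_lt_iff.1 h2).1
    · rw [neg]; exact (max_lt_iff.1 h2).2
  have hadd : ∀ (e : unitInterval) (x y : Fin 2 → K), (∀ i, nm (x i - y i) ≤ e) →
      nm ((x 0 + x 1) - (y 0 + y 1)) ≤ e := fun e x y h => by
    rw [add_sub_add_comm]
    exact (add_le _ _).trans (max_le (h 0) (h 1))
  have hmul : ∀ (e : unitInterval) (x y : Fin 2 → K), (∀ i, nm (x i - y i) ≤ e) →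
      nm (x 0 * x 1 - y 0 * y 1) ≤ e := fun e x y h => by
    have e : x 0 * x 1 - y 0 * y 1 = (x 0 - y 0) * x 1 + (x 1 - y 1) * y 0 := by ring
    rw [e]
    exact (add_le _ _).trans (max_le ((mul_le _ _).trans (h 0)) ((mul_le _ _).trans (h 1)))
  have hneg : ∀ (e : unitInterval) (x y : Fin 1 → K), (∀ i, nm (x i - y i) ≤ e) →
      nm (-x 0 - -y 0) ≤ e := fun e x y h => by
    rw [neg_sub_neg, ← neg, neg_sub]
    exact h 0
  have hrel : ∀ (ε : Set.Ioc (0 : ℝ) 1) (x y : Fin 2 → K), (∀ i, (nm (x i - y i) : ℝ) ≤ ε) →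
      |((⨅ z, nm (x 1 - x 0 * z) : unitInterval) : ℝ) -
        (⨅ z, nm (y 1 - y 0 * z) : unitInterval)| ≤ ε := fun ε x y h => by
    have h' : ∀ i, (nm (y i - x i) : ℝ) ≤ ε := fun i => by rw [← neg, neg_sub]; exact h i
    have h1 := Subtype.coe_le_coe.2 (hD (x 0) (x 1) (y 0) (y 1))
    have h2 := Subtype.coe_le_coe.2 (hD (y 0) (y 1) (x 0) (x 1))
    have e1 : ∀ a b c d : unitInterval, (c : ℝ) ≤ ε → (d : ℝ) ≤ ε →
        (a : ℝ) ≤ (max b (max c d) : unitInterval) → (a : ℝ) ≤ b + ε :=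
      fun a b c d hc hd hle => by
        rcases le_max_iff.1 (Subtype.coe_le_coe.1 hle) with h' | h'
        · linarith [Subtype.coe_le_coe.2 h', ε.2.1]
        rcases le_max_iff.1 h' with h' | h' <;>
          linarith [Subtype.coe_le_coe.2 h', b.2.1]
    rw [abs_le]
    constructor
    · linarith [e1 _ _ _ _ (h 0) (h 1) h1]
    · linarith [e1 _ _ _ _ (h' 0) (h' 1) h2]
  refine ⟨⟨(0 : K)⟩, fun x y => ?_, fun x y => ?_, fun x y z => ?_, complete, ?_, ?_⟩
  · exact (zero_iff _).trans sub_eq_zero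
  · have key : ∀ x y : K, nm (x - y) = nm (y - x) := fun x y => by rw [← neg, neg_sub]
    exact key x y
  · have key : ∀ x y z : K, (nm (x - z) : ℝ) ≤ nm (x - y) + nm (y - z) := fun x y z => by
      have h1 : (nm (x - z) : ℝ) ≤ max (nm (x - y) : ℝ) (nm (y - z)) := by
        have := add_le (x - y) (y - z)
        rw [sub_add_sub_cancel] at this
        exact_mod_cast this
      exact h1.trans (max_le_add_of_nonneg (nm _).2.1 (nm _).2.1)
    exact key x y z
  · intro f ε x y hxy
    have key : ∀ {n : ℕ} (_ : n ≤ 2) (x y : Fin n → K),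
        (ringStr (P := P) K (fun x y => nm (x - y)) c
          (fun _ x y => ⨅ z, nm (y - x * z))).tupleDist x y < (ε : ℝ) / 2 →
        ∀ i, nm (x i - y i) ≤ ⟨ε.1, ε.2.1.le, ε.2.2⟩ := fun hn x y hxy i =>
      Subtype.coe_le_coe.1 (Str.d_le_of_tupleDist_lt (ringStr (P := P) K (fun x y => nm (x - y)) c
          (fun _ x y => ⨅ z, nm (y - x * z))) hn x y hxy i).le
    suffices hs : (ringStr (P := P) K (fun x y => nm (x - y)) c
          (fun _ x y => ⨅ z, nm (y - x * z))).d ((ringStr K _ c _).fn f x)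
          ((ringStr K _ c _).fn f y) ≤ ⟨ε.1, ε.2.1.le, ε.2.2⟩ from Subtype.coe_le_coe.2 hs
    have h0 : nm 0 ≤ ⟨ε.1, ε.2.1.le, ε.2.2⟩ := by
      rw [(zero_iff 0).2 rfl]; exact ε.2.1.le
    cases f with
    | add => exact hadd _ x y (key le_rfl x y hxy)
    | mul => exact hmul _ x y (key le_rfl x y hxy)
    | neg => exact hneg _ x y (key one_le_two x y hxy)
    | zero => exact (congrArg nm (sub_self (0 : K))).trans_le h0
    | one => exact (congrArg nm (sub_self (1 : K))).trans_le h0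
    | const i => exact (congrArg nm (sub_self (c i))).trans_le h0
  · intro r ε x y hxy
    have h := fun i => (Str.d_le_of_tupleDist_lt (n := 2) _ le_rfl x y hxy i).le
    exact hrel ε x y h

theorem PERF.of_ringStr {p : ℕ} {α : ℝ} {K : Type u} [CommRing K] {d D : K → K → unitInterval}
    {c : ℕ → K} (hs : (ringStr (P := DRel) K d c fun _ => D).IsStructure)
    (ha : PERFAxioms p α K d D c) : PERF p α (ringStr (P := DRel) K d c fun _ => D) := by
  refine ⟨hs, ringStr_isCommRing K d c _, ?_⟩
  rw [commRing_ringStr K d c _ _]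
  exact ha

theorem tendsto_rpow_one_div_pow {α : ℝ} (h0 : 0 < α) {p : ℕ} (hp : 1 < p) :
    Filter.Tendsto (fun k : ℕ => α ^ ((1 : ℝ) / p ^ k)) Filter.atTop (nhds 1) := by
  have : Filter.Tendsto (fun k : ℕ => (1 : ℝ) / p ^ k) Filter.atTop (nhds 0) := by
    simp only [one_div, ← inv_pow]
    exact tendsto_pow_atTop_nhds_zero_of_lt_one (by positivity)
      (inv_lt_one_of_one_lt₀ (by exact_mod_cast hp))
  have h2 := (Real.continuousAt_const_rpow h0.ne').tendsto.comp this
  rwa [Real.rpow_zero] at h2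

theorem exists_pow_pow_lt {α ε : ℝ} (h0 : 0 < α) (h1 : α < 1) {p : ℕ} (hp : 1 < p) (hε : 0 < ε) :
    ∃ n, α ^ p ^ n < ε := by
  obtain ⟨n, hn⟩ := exists_pow_lt_of_lt_one hε h1
  exact ⟨n, (pow_le_pow_of_le_one h0.le h1.le (Nat.lt_pow_self hp).le).trans_lt hn⟩

namespace TPERFAxioms

variable {p : ℕ} {R : Type u} [CommRing R] {dv : R → R → Prop} {ϖ : ℕ+ → R}
  (h : TPERFAxioms p R dv ϖ) [Fact p.Prime] [CharP R p] {α : Set.Ioo (0 : ℝ) 1}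
include h

/-- A Cauchy sequence has eventually constant coefficients at each index. The stable values form a
compatible sequence, which is the limit. -/
theorem norm_complete (s : ℕ → Perfection R p)
    (hs : ∀ ε : ℝ, 0 < ε → ∃ N, ∀ m ≥ N, ∀ n ≥ N, (h.norm α (s m - s n) : ℝ) ≤ ε) :
    ∃ x, ∀ ε : ℝ, 0 < ε → ∃ N, ∀ n ≥ N, (h.norm α (s n - x) : ℝ) ≤ ε := by
  have hp := (Fact.out : p.Prime).one_lt
  have h1 : ∀ k, ∃ N, ∀ m ≥ N, ∀ n ≥ N,
      Perfection.coeff R p k (s m) = Perfection.coeff R p k (s n) := fun k => by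
    have hpos : 0 < α.1 ^ p ^ k := pow_pos α.2.1 _
    obtain ⟨N, hN⟩ := hs _ (half_pos hpos)
    refine ⟨N, fun m hm n hn => ?_⟩
    rw [← sub_eq_zero, ← map_sub]
    exact h.coeff_eq_zero_of_norm_lt ((hN m hm n hn).trans_lt (half_lt_self hpos))
  choose N hN using h1
  obtain ⟨x, hx⟩ : ∃ x : Perfection R p, ∀ k,
      Perfection.coeff R p k x = Perfection.coeff R p k (s (N k)) := by
    refine ⟨⟨fun k => Perfection.coeff R p k (s (N k)), fun k => ?_⟩, fun k => rfl⟩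
    change Perfection.coeff R p (k + 1) (s (N (k + 1))) ^ p = Perfection.coeff R p k (s (N k))
    rw [hN (k + 1) _ le_rfl (N k ⊔ N (k + 1)) le_sup_right, Perfection.coeff_pow_p',
      hN k (N k ⊔ N (k + 1)) le_sup_left _ le_rfl]
  refine ⟨x, fun ε hε => ?_⟩
  obtain ⟨k, hk⟩ := exists_pow_pow_lt α.2.1 α.2.2 hp hε
  refine ⟨N k, fun n hn => (h.norm_le_of_coeff_eq_zero (k := k) ?_).trans hk.le⟩
  rw [map_sub, sub_eq_zero, hx, hN k n hn (N k) le_rfl]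

omit h [CharP R p] [CommRing R] in
theorem iInf_eq_zero_of_le {ι : Type*} {f : ι → unitInterval}
    (hf : ∀ k : ℕ, ∃ i, (f i : ℝ) ≤ α.1 ^ p ^ k) : ⨅ i, f i = 0 := by
  refine le_antisymm (le_of_forall_gt fun ε hε => ?_) bot_le
  obtain ⟨k, hk⟩ := exists_pow_pow_lt α.2.1 α.2.2 (Fact.out : p.Prime).one_lt
    (Subtype.coe_lt_coe.2 hε)
  obtain ⟨i, hi⟩ := hf k
  exact (iInf_le _ i).trans_lt (Subtype.coe_lt_coe.1 (hi.trans_lt hk))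

/-- Once β = α^(1/p^k) exceeds 1 - ε, consecutive powers of β differ by less than ε, and two of them
enclose t. -/
theorem exists_norm_near (t : ℝ) (ht0 : 0 < t) (ht1 : t < 1) (ε : ℝ) (hε : 0 < ε) :
    ∃ x, |(h.norm α x : ℝ) - t| < ε := by
  have hα := α.2
  set β : ℕ → ℝ := fun k => α.1 ^ ((1 : ℝ) / p ^ k) with hβ
  have hlim : Filter.Tendsto β Filter.atTop (nhds 1) :=
    tendsto_rpow_one_div_pow hα.1 (Fact.out : p.Prime).one_lt
  obtain ⟨k, hk⟩ := (hlim.eventually (lt_mem_nhds (show 1 - ε < 1 by linarith))).exists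
  have hβ0 : 0 < β k := Real.rpow_pos_of_pos hα.1 _
  have hβ1 : β k < 1 := Real.rpow_lt_one hα.1.le hα.2
    (by have := (Fact.out : p.Prime).pos; positivity)
  obtain ⟨m, hm1, hm2⟩ := exists_nat_pow_near_of_lt_one ht0 ht1.le hβ0 hβ1
  refine ⟨h.flatUniformizer k ^ m, ?_⟩
  rw [h.norm_flatUniformizer, abs_lt]
  have h3 : β k ^ m * (1 - β k) < ε := by
    have : β k ^ m ≤ 1 := pow_le_one₀ hβ0.le hβ1.le
    nlinarith
  rw [pow_succ] at hm1
  constructor <;> simp only [hβ] at * <;> nlinarith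

/-- If y_k = x_k c and z lifts c at index k, then xz - y has zero k-th coefficient and norm at most
α^(p^k). -/
theorem valuation_flat (x y : Perfection R p) :
    ⨅ z, min (h.norm α (x * z - y)) (h.norm α (y * z - x)) = 0 := by
  refine iInf_eq_zero_of_le (p := p) (α := α) fun k => ?_
  have key : ∀ {x y : Perfection R p}, flatLE p dv x y →
      ∃ z, (h.norm α (x * z - y) : ℝ) ≤ α.1 ^ p ^ k := fun {x y} hxy => by
    obtain ⟨c, hc⟩ := h.flatLE_iff.1 hxy k
    obtain ⟨z, rfl⟩ := h.exists_coeff c k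
    exact ⟨z, h.norm_le_of_coeff_eq_zero (by rw [map_sub, map_mul, hc, sub_self])⟩
  rcases h.flatLE_total x y with hxy | hxy
  · obtain ⟨z, hz⟩ := key hxy
    exact ⟨z, (Subtype.coe_le_coe.2 (min_le_left _ _)).trans hz⟩
  · obtain ⟨z, hz⟩ := key hxy
    exact ⟨z, (Subtype.coe_le_coe.2 (min_le_right _ _)).trans hz⟩

theorem isStructure_flat : (h.flat α).IsStructure :=
  isStructure_of_norm (h.norm α) (fun _ => h.norm_eq_zero) (fun _ => h.norm_neg)
    (fun _ _ => h.norm_mul) (fun _ _ => h.norm_add_le) h.norm_complete _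

theorem perfAxioms_flat : PERFAxioms p α.1 (Perfection R p) (fun x y => h.norm α (x - y))
    (fun x y => ⨅ z, h.norm α (y - x * z)) h.flatUniformizer where
  isDomain := h.flat_isDomain
  d_eq x y := by rw [sub_zero]
  norm_one := by rw [sub_zero, h.norm_one]
  norm_mul x y := by simp only [sub_zero]; exact Subtype.ext h.norm_mul
  norm_add_le x y := by simp only [sub_zero]; exact h.norm_add_le
  valuation := h.valuation_flat
  norm_p := by rw [CharP.cast_eq_zero, sub_zero, h.norm_zero]
  exists_norm := by
    refine le_antisymm (le_of_forall_pos_le_add fun ε hε => ?_)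
      (Real.iInf_nonneg fun _ => abs_nonneg _)
    obtain ⟨x, hx⟩ := h.exists_norm_near (α := α) (1 / 2) (by norm_num) (by norm_num) ε hε
    refine (ciInf_le ⟨0, ?_⟩ x).trans ?_
    · rintro _ ⟨y, rfl⟩; exact abs_nonneg _
    · rw [sub_zero, zero_add]; exact hx.le
  frobenius x := by
    refine le_antisymm ?_ bot_le
    refine (iInf_le _ ((frobeniusEquiv (Perfection R p) p).symm x)).trans ?_
    rw [frobeniusEquiv_symm_pow_p, sub_self, h.norm_zero]
  D_eq x y := rfl
  norm_uniformizer := by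
    have := h.norm_flatUniformizer_pow (α := α) 1
    simpa using this
  root i := by have := h.flatUniformizer_pow i 1; rwa [pow_one] at this

end TPERFAxioms

theorem TPERF.perf_tilt {p : ℕ} [Fact p.Prime] (α : Set.Ioo (0 : ℝ) 1) (A : Str.{u} LDiv)
    (h : TPERF p A) : PERF p α (tilt α A h) := by
  let _ := h.isCommRing.commRing
  have := h.charP
  exact PERF.of_ringStr h.axioms_hold.isStructure_flat h.axioms_hold.perfAxioms_flat

end ContLogic
end

noncomputable section

namespace ContLogic

/-! ### Perfectoid valuation rings of characteristic `p` -/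

/-- Complete rings with an approximately divisible ultrametric norm, approximate `p`-th roots, and a
compatible system of roots of an element of norm `α`. -/
structure IsPerfNorm (p : ℕ) (α : ℝ) {K : Type u} [CommRing K] (nm : K → ℝ) (ϖ : ℕ → K) :
    Prop where
  nonneg : ∀ x, 0 ≤ nm x
  le_one : ∀ x, nm x ≤ 1
  eq_zero : ∀ x, nm x = 0 ↔ x = 0
  one : nm 1 = 1
  mul : ∀ x y, nm (x * y) = nm x * nm y
  add_le : ∀ x y, nm (x + y) ≤ max (nm x) (nm y)
  complete : ∀ s : ℕ → K, (∀ ε : ℝ, 0 < ε → ∃ N, ∀ m ≥ N, ∀ n ≥ N, nm (s m - s n) ≤ ε) →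
    ∃ x, ∀ ε : ℝ, 0 < ε → ∃ N, ∀ n ≥ N, nm (s n - x) ≤ ε
  valuation : ∀ x y, ∀ ε : ℝ, 0 < ε → ∃ z, nm (x * z - y) < ε ∨ nm (y * z - x) < ε
  frobenius : ∀ x, ∀ ε : ℝ, 0 < ε → ∃ y, nm (x - y ^ p) < ε
  natCast : (p : K) = 0
  uniformizer : nm (ϖ 0) = α
  root : ∀ i, ϖ (i + 1) ^ p = ϖ i

theorem PERFAxioms.isPerfNorm {p : ℕ} {α : ℝ} {K : Type u} [CommRing K]
    {d D : K → K → unitInterval} {ϖ : ℕ → K} (h : PERFAxioms p α K d D ϖ)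
    (d_eq_zero : ∀ x y, d x y = 0 ↔ x = y)
    (complete : ∀ s : ℕ → K,
      (∀ ε : ℝ, 0 < ε → ∃ N, ∀ m ≥ N, ∀ n ≥ N, (d (s m) (s n) : ℝ) ≤ ε) →
        ∃ x, ∀ ε : ℝ, 0 < ε → ∃ N, ∀ n ≥ N, (d (s n) x : ℝ) ≤ ε) :
    IsPerfNorm p α (fun x => (d x 0 : ℝ)) ϖ where
  nonneg x := (d x 0).2.1
  le_one x := (d x 0).2.2
  eq_zero x := by rw [← d_eq_zero x 0]; exact Set.Icc.coe_eq_zero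
  one := by rw [h.norm_one]; rfl
  mul x y := by rw [h.norm_mul]; rfl
  add_le x y := by exact_mod_cast h.norm_add_le x y
  complete := by simpa only [← h.d_eq] using complete
  valuation x y ε hε := by
    by_contra! hn
    -- An ε above 1 is no element of the unit interval and cannot be compared with the infimum
    -- there.
    rcases lt_or_ge 1 ε with h1 | h1
    · exact (h1.trans_le (hn 0).1).not_ge (d _ _).2.2
    have : (⟨ε, hε.le, h1⟩ : unitInterval) ≤ ⨅ z, min (d (x * z) y) (d (y * z) x) :=
      le_iInf fun z => le_min
        (Subtype.coe_le_coe.1 (by have := (hn z).1; rwa [← h.d_eq] at this))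
        (Subtype.coe_le_coe.1 (by have := (hn z).2; rwa [← h.d_eq] at this))
    rw [h.valuation] at this
    exact (Subtype.coe_le_coe.2 this).not_gt hε
  frobenius x ε hε := by
    by_contra! hn
    rcases lt_or_ge 1 ε with h1 | h1
    · exact (h1.trans_le (hn 0)).not_ge (d _ _).2.2
    have : (⟨ε, hε.le, h1⟩ : unitInterval) ≤ ⨅ y, d x (y ^ p) :=
      le_iInf fun z => Subtype.coe_le_coe.1 (by have := hn z; rwa [← h.d_eq] at this)
    rw [h.frobenius] at this
    exact (Subtype.coe_le_coe.2 this).not_gt hε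
  natCast := (d_eq_zero _ _).1 h.norm_p
  uniformizer := h.norm_uniformizer
  root := h.root

theorem PERF.isPerfNorm {p : ℕ} {α : ℝ} {N : Str.{u} LD} (h : PERF p α N) :
    letI := h.isCommRing.commRing
    IsPerfNorm p α (fun x => (N.d x 0 : ℝ)) N.const :=
  letI := h.isCommRing.commRing
  h.axioms_hold.isPerfNorm h.isStructure.d_eq_zero h.isStructure.complete

namespace IsPerfNorm

variable {p : ℕ} {α : ℝ} {K : Type u} [CommRing K] {nm : K → ℝ} {ϖ : ℕ → K}
  (h : IsPerfNorm p α nm ϖ)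
include h

theorem neg (x : K) : nm (-x) = nm x := by
  have h1 : nm (-1) ^ 2 = 1 := by rw [sq, ← h.mul, neg_mul_neg, one_mul, h.one]
  have h2 : nm (-1) = 1 := (pow_eq_one_iff_of_nonneg (h.nonneg _) two_ne_zero).1 h1
  rw [← neg_one_mul, h.mul, h2, one_mul]

theorem sub_comm (x y : K) : nm (x - y) = nm (y - x) := by rw [← h.neg, neg_sub]

theorem sub_le (x y z : K) : nm (x - z) ≤ max (nm (x - y)) (nm (y - z)) := by
  have := h.add_le (x - y) (y - z)
  rwa [sub_add_sub_cancel] at this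

theorem pow (x : K) (n : ℕ) : nm (x ^ n) = nm x ^ n := by
  induction n with
  | zero => simp [h.one]
  | succ n ih => rw [pow_succ, h.mul, ih, pow_succ]

theorem pos {x : K} (hx : x ≠ 0) : 0 < nm x :=
  (h.nonneg x).lt_of_ne' fun e => hx ((h.eq_zero x).1 e)

theorem le_of_dvd {x y : K} (hxy : x ∣ y) : nm y ≤ nm x := by
  obtain ⟨c, rfl⟩ := hxy
  rw [h.mul]
  exact mul_le_of_le_one_right (h.nonneg x) (h.le_one c)

theorem isDomain : IsDomain K := by
  have : Nontrivial K := ⟨⟨1, 0, fun e => by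
    have := h.one
    rw [e, (h.eq_zero 0).2 rfl] at this
    exact zero_ne_one this⟩⟩
  have : NoZeroDivisors K := ⟨fun {a b} e => by
    rw [← h.eq_zero, h.mul, mul_eq_zero, h.eq_zero, h.eq_zero] at e
    exact e⟩
  exact NoZeroDivisors.to_isDomain _

/-- Principal ideals are closed: multiplication by x ≠ 0 scales distances by |x|, so the approximate
quotients form a Cauchy sequence. -/
theorem dvd_of_approx {x y : K} (hxy : ∀ ε : ℝ, 0 < ε → ∃ z, nm (x * z - y) < ε) : x ∣ y := by
  by_cases hx : x = 0
  · subst hx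
    have : nm y = 0 := le_antisymm (le_of_forall_pos_le_add fun ε hε => by
      obtain ⟨z, hz⟩ := hxy ε hε
      rw [zero_mul, zero_sub, h.neg] at hz
      linarith) (h.nonneg y)
    rw [(h.eq_zero y).1 this]
  have hx := h.pos hx
  choose! z hz using hxy
  have hlim : ∀ ε : ℝ, 0 < ε → ∃ N : ℕ, ∀ n ≥ N, (1 : ℝ) / (n + 1) < ε := fun ε hε => by
    obtain ⟨N, hN⟩ := exists_nat_one_div_lt hε
    exact ⟨N, fun n hn => (one_div_le_one_div_of_le (by positivity)
      (by have : (N : ℝ) ≤ n := by exact_mod_cast hn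
          linarith)).trans_lt hN⟩
  obtain ⟨w, hw⟩ := h.complete (fun n : ℕ => z (1 / (n + 1))) fun ε hε => by
    obtain ⟨N, hN⟩ := hlim (nm x * ε) (by positivity)
    refine ⟨N, fun m hm n hn => ?_⟩
    refine le_of_mul_le_mul_left ?_ hx
    rw [← h.mul, mul_sub]
    refine (h.sub_le _ y _).trans (max_le ?_ ?_)
    · exact (hz _ (by positivity)).le.trans (hN m hm).le
    · rw [h.sub_comm]
      exact (hz _ (by positivity)).le.trans (hN n hn).le
  refine ⟨w, sub_eq_zero.1 ((h.eq_zero _).1 (le_antisymm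
    (le_of_forall_pos_le_add fun ε hε => ?_) (h.nonneg _)))⟩
  obtain ⟨N, hN⟩ := hlim ε hε
  obtain ⟨M, hM⟩ := hw ε hε
  rw [zero_add]
  refine (h.sub_le _ (x * z (1 / ((N ⊔ M : ℕ) + 1))) _).trans (max_le ?_ ?_)
  · rw [h.sub_comm]
    exact (hz _ (by positivity)).le.trans (hN _ le_sup_left).le
  · rw [← mul_sub, h.mul]
    exact (mul_le_of_le_one_left (h.nonneg _) (h.le_one x)).trans (hM _ le_sup_right)

theorem nm_eq_of_sub_lt {x y : K} (hxy : nm (x - y) < nm y) : nm x = nm y := by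
  refine le_antisymm ?_ ?_
  · have := h.add_le (x - y) y
    rw [sub_add_cancel] at this
    exact this.trans (max_le hxy.le le_rfl)
  · have := h.add_le (y - x) x
    rw [sub_add_cancel] at this
    rcases le_max_iff.1 this with h1 | h1
    · exact absurd (h1.trans_eq (h.sub_comm _ _)) (not_le.2 hxy)
    · exact h1

/-- At precision below |x|, the alternative |yz - x| < |x| would force |yz| = |x| > |y|. So x
divides y approximately, hence exactly. -/
theorem dvd_of_lt {x y : K} (hxy : nm y < nm x) : x ∣ y := by
  refine h.dvd_of_approx fun ε hε => ?_
  obtain ⟨z, hz | hz⟩ := h.valuation x y (min ε (nm x)) (lt_min hε ((h.nonneg y).trans_lt hxy))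
  · exact ⟨z, hz.trans_le (min_le_left _ _)⟩
  · have h1 := h.nm_eq_of_sub_lt (hz.trans_le (min_le_right _ _))
    rw [h.mul] at h1
    have := mul_le_of_le_one_right (h.nonneg y) (h.le_one z)
    linarith

/-- An error xz - y of norm below |x| is itself divisible by x, so approximate divisibility at
precision min(|x|, |y|) is exact. -/
theorem dvd_total (x y : K) : x ∣ y ∨ y ∣ x := by
  by_cases hx : x = 0
  · exact .inr (hx ▸ dvd_zero _)
  by_cases hy : y = 0
  · exact .inl (hy ▸ dvd_zero _)
  obtain ⟨z, hz | hz⟩ := h.valuation x y (min (nm x) (nm y)) (lt_min (h.pos hx) (h.pos hy))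
  · exact .inl ((dvd_sub_right (dvd_mul_right x z)).1
      (h.dvd_of_lt (hz.trans_le (min_le_left _ _))))
  · exact .inr ((dvd_sub_right (dvd_mul_right y z)).1
      (h.dvd_of_lt (hz.trans_le (min_le_right _ _))))

theorem isUnit_one_sub_of_not_isUnit {y : K} (hy : ¬IsUnit y) : IsUnit (1 - y) := by
  rcases h.dvd_total y (1 - y) with ⟨c, hc⟩ | ⟨c, hc⟩
  · exact absurd (IsUnit.of_mul_eq_one (1 + c) (by linear_combination -hc)) hy
  · exact IsUnit.of_mul_eq_one (1 + c) (by linear_combination -hc)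

theorem nm_of_isUnit {x : K} (hx : IsUnit x) : nm x = 1 :=
  le_antisymm (h.le_one x) (by rw [← h.one]; exact h.le_of_dvd hx.dvd)

theorem isUnit_one_sub {y : K} (hy : nm y < 1) : IsUnit (1 - y) :=
  h.isUnit_one_sub_of_not_isUnit fun hu => hy.ne (h.nm_of_isUnit hu)

/-- The distance from `y` to a principal ideal not containing `y` is the norm of `y`. -/
theorem le_nm_sub_mul {x y : K} (hxy : ¬x ∣ y) (z : K) : nm y ≤ nm (y - x * z) := by
  by_contra! hlt
  -- A smaller remainder is y·e with |e| < 1, so y(1 - e) = xz with 1 - e a unit, and x would divide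
  -- y.
  obtain ⟨e, he⟩ := h.dvd_of_lt hlt
  have hy : y ≠ 0 := fun e => hxy (e ▸ dvd_zero x)
  have he1 : nm e < 1 := by
    rw [he, h.mul] at hlt
    exact (mul_lt_iff_lt_one_right (h.pos hy)).1 hlt
  refine hxy ((IsUnit.dvd_mul_right (h.isUnit_one_sub he1)).1 ⟨z, ?_⟩)
  linear_combination he

theorem le_nm_of_not_dvd {x : K} (hx : ¬ϖ 0 ∣ x) : α ≤ nm x := by
  by_contra! hlt
  exact hx (h.dvd_of_lt (by rwa [h.uniformizer]))

/-! ### Frobenius and exact p-th roots -/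

variable [hp : Fact p.Prime]

theorem charP : CharP K p :=
  have := h.isDomain
  (CharP.charP_iff_prime_eq_zero hp.out).2 h.natCast

theorem sub_pow (x y : K) (n : ℕ) : (x - y) ^ p ^ n = x ^ p ^ n - y ^ p ^ n :=
  have := h.charP
  sub_pow_char_pow x y n

/-- Since |a - b|^p = |a^p - b^p|, approximate roots form a Cauchy sequence; precision ε^p on the
powers gives ε on the roots. -/
theorem exists_root (x : K) : ∃ y, y ^ p = x := by
  have hp0 := hp.out.ne_zero
  have hs := fun x y : K => h.sub_pow x y 1
  simp only [pow_one] at hs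
  choose! y hy using h.frobenius x
  have hlim : ∀ ε : ℝ, 0 < ε → ∃ N : ℕ, ∀ n ≥ N, (1 : ℝ) / (n + 1) < ε := fun ε hε => by
    obtain ⟨N, hN⟩ := exists_nat_one_div_lt hε
    exact ⟨N, fun n hn => (one_div_le_one_div_of_le (by positivity)
      (by have : (N : ℝ) ≤ n := by exact_mod_cast hn
          linarith)).trans_lt hN⟩
  obtain ⟨w, hw⟩ := h.complete (fun n : ℕ => y (1 / (n + 1))) fun ε hε => by
    obtain ⟨N, hN⟩ := hlim (ε ^ p) (by positivity)
    refine ⟨N, fun m hm n hn => le_of_pow_le_pow_left₀ hp0 hε.le ?_⟩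
    rw [← h.pow, hs]
    refine (h.sub_le _ x _).trans (max_le ?_ ?_)
    · rw [h.sub_comm]
      exact (hy _ (by positivity)).le.trans (hN m hm).le
    · exact (hy _ (by positivity)).le.trans (hN n hn).le
  refine ⟨w, sub_eq_zero.1 ((h.eq_zero _).1 (le_antisymm
    (le_of_forall_pos_le_add fun ε hε => ?_) (h.nonneg _)))⟩
  obtain ⟨N, hN⟩ := hlim ε hε
  obtain ⟨M, hM⟩ := hw (min ε 1) (lt_min hε one_pos)
  rw [zero_add]
  refine (h.sub_le _ (y (1 / ((N ⊔ M : ℕ) + 1)) ^ p) _).trans (max_le ?_ ?_)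
  · rw [h.sub_comm, ← hs, h.pow]
    have h1 := hM _ (le_sup_right : M ≤ N ⊔ M)
    exact (pow_le_of_le_one (h.nonneg _) (h.le_one _) hp0).trans (h1.trans (min_le_left _ _))
  · rw [h.sub_comm]
    exact (hy _ (by positivity)).le.trans (hN _ le_sup_left).le

theorem perfectRing : haveI := h.charP; PerfectRing K p := by
  have := h.charP
  have := h.isDomain
  exact PerfectRing.ofSurjective K p h.exists_root

omit hp in
theorem uniformizer_pow (i n : ℕ) : ϖ (i + n) ^ p ^ n = ϖ i := by
  induction n with
  | zero => simp
  | succ n ih => rw [pow_succ', pow_mul, ← add_assoc, h.root, ih]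

end IsPerfNorm

/-! ### Residue maps -/

/-- Surjective ring homomorphisms with kernel `(ϖ_0)` compatible with the named constants. -/
structure IsResidueMap {K R : Type u} [CommRing K] [CommRing R] (ϖ : ℕ → K) (c : ℕ+ → R)
    (φ : K →+* R) : Prop where
  surjective : Function.Surjective φ
  eq_zero : ∀ x, φ x = 0 ↔ ϖ 0 ∣ x
  const : ∀ i : ℕ+, φ (ϖ i) = c i

namespace IsResidueMap

variable {p : ℕ} {α : ℝ} {K R : Type u} [CommRing K] [CommRing R] {nm : K → ℝ} {ϖ : ℕ → K}
  {c : ℕ+ → R} {φ : K →+* R} (hφ : IsResidueMap ϖ c φ) (h : IsPerfNorm p α nm ϖ)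
include hφ

theorem eq_iff (x y : K) : φ x = φ y ↔ ϖ 0 ∣ x - y := by
  rw [← hφ.eq_zero, map_sub, sub_eq_zero]

theorem map_uniformizer (i : ℕ) : φ (ϖ i) = uniformizerSeq c i := by
  cases i with
  | zero => exact (hφ.eq_zero _).2 dvd_rfl
  | succ i => exact hφ.const i.succPNat

include h

/-- Here ϖ_0 divides y - xz for some z. If x ∣ ϖ_0, then x divides y; otherwise ϖ_0 ∣ x, and ϖ_0
divides y. -/
theorem dvd_iff (x y : K) : φ x ∣ φ y ↔ x ∣ y ∨ ϖ 0 ∣ y := by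
  constructor
  · rintro ⟨c, hc⟩
    obtain ⟨z, rfl⟩ := hφ.surjective c
    rw [← map_mul, hφ.eq_iff] at hc
    rcases h.dvd_total x (ϖ 0) with hd | hd
    · exact .inl ((dvd_sub_left (dvd_mul_right x z)).1 (hd.trans hc))
    · exact .inr ((dvd_sub_left (hd.trans (dvd_mul_right x z))).1 hc)
  · rintro (hd | hd)
    · exact map_dvd φ hd
    · rw [(hφ.eq_zero y).2 hd]; exact dvd_zero _

theorem tperfAxioms [hp : Fact p.Prime] (h0 : 0 < α) (h1 : α < 1) {dv : R → R → Prop}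
    (hdv : ∀ x y, dv x y ↔ x ∣ y) : TPERFAxioms p R dv c where
  dv_iff := hdv
  dv_total x y := by
    obtain ⟨x, rfl⟩ := hφ.surjective x
    obtain ⟨y, rfl⟩ := hφ.surjective y
    rw [hdv, hdv]
    exact (h.dvd_total x y).imp (map_dvd φ) (map_dvd φ)
  -- The variables of this field have type ℕ, so the claim is cancellation of natural numbers.
  unit x y hx e := by
    rw [Nat.eq_of_mul_eq_mul_right (Nat.pos_of_ne_zero hx) (e.symm.trans (one_mul x).symm)]
    exact isUnit_one
  p_eq_zero := by rw [← map_natCast φ, h.natCast, map_zero]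
  frobenius_surjective x := by
    obtain ⟨x, rfl⟩ := hφ.surjective x
    obtain ⟨y, rfl⟩ := h.exists_root x
    exact ⟨φ y, by rw [map_pow]⟩
  pseudoUniformizer := by
    have hp0 := hp.out.ne_zero
    have e : φ (ϖ 1) = c 1 := hφ.const 1
    have hα : nm (ϖ 1) ^ p = α := by rw [← h.pow, h.root, h.uniformizer]
    refine ⟨fun e' => ?_, ?_, fun x hx => ?_⟩
    · rw [← e, hφ.eq_zero] at e'
      have h2 := h.le_of_dvd e'
      rw [h.uniformizer, ← hα] at h2
      have h3 : 0 < nm (ϖ 1) := (h.nonneg _).lt_of_ne fun e => by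
        rw [← e, zero_pow hp0] at hα; exact h0.ne hα
      have h4 : nm (ϖ 1) < 1 := (h.le_one _).lt_of_ne fun e => by
        rw [e, one_pow] at hα; exact h1.ne' hα
      exact (pow_lt_self_of_lt_one₀ h3 h4 hp.out.one_lt).not_ge h2
    · rw [← e, ← map_pow, h.root, hφ.eq_zero]
    · obtain ⟨x, rfl⟩ := hφ.surjective x
      rw [← map_pow, hφ.eq_zero, ← h.root] at hx
      rw [hdv, ← e]
      have := h.isDomain
      -- In the remaining case ϖ_1 = xe while x^p is a multiple of ϖ_0 = ϖ_1^p. Cancelling x^p in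
      -- the domain makes e a unit.
      refine map_dvd φ ((h.dvd_total _ _).elim id fun ⟨e, he⟩ => ?_)
      by_cases hx0 : x = 0
      · rw [hx0]; exact dvd_zero _
      obtain ⟨b, hb⟩ := hx
      have hxp : x ^ p ≠ 0 := pow_ne_zero _ hx0
      have hu : IsUnit (e ^ p) := by
        refine IsUnit.of_mul_eq_one b (mul_left_cancel₀ hxp ?_)
        rw [mul_one, ← mul_assoc, ← mul_pow, ← he, ← hb]
      rw [he]
      exact (IsUnit.dvd_mul_right ((isUnit_pow_iff hp0).1 hu)).1
        dvd_rfl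
  root i := by
    have := h.root i
    rw [← hφ.const, ← hφ.const, ← map_pow, ← this]
    rfl

end IsResidueMap

end ContLogic
end

noncomputable section

namespace ContLogic

/-! ### The truncation is a model -/

open Classical in
theorem isStructure_discrete {C P : Type} {K : Type u} [CommRing K] (c : C → K)
    (r : P → K → K → unitInterval) :
    (ringStr (P := P) K (fun x y => if x = y then 0 else 1) c r).IsStructure := by
  have hd : ∀ (ε : ℝ) (x y : K), ((if x = y then 0 else 1 : unitInterval) : ℝ) ≤ ε → ε < 1 →
      x = y := fun ε x y h h1 => by
    by_contra hn
    rw [if_neg hn] at h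
    exact h1.not_ge h
  have key : ∀ {n : ℕ} (_ : n ≤ 2) (ε : Set.Ioc (0 : ℝ) 1) (x y : Fin n → K),
      (ringStr (P := P) K (fun x y => if x = y then 0 else 1) c r).tupleDist x y < (ε : ℝ) / 2 →
      x = y := fun hn ε x y hxy => funext fun i => by
    have h1 := Str.d_le_of_tupleDist_lt (ringStr (P := P) K _ c r) hn x y hxy i
    by_contra hne
    have h2 : ((if x i = y i then 0 else 1 : unitInterval) : ℝ) < ε := h1
    rw [if_neg hne] at h2
    exact h2.not_ge ε.2.2
  refine ⟨⟨(0 : K)⟩, fun x y => ?_, fun x y => ?_, fun x y z => ?_, fun s hs => ?_,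
    fun f ε x y hxy => ?_, fun r' ε x y hxy => ?_⟩
  · change (if (x : K) = y then 0 else 1 : unitInterval) = 0 ↔ x = y
    split_ifs with h <;> simp [h]
  · change (if (x : K) = y then 0 else 1 : unitInterval) = if (y : K) = x then 0 else 1
    simp only [eq_comm]
  · change ((if (x : K) = z then 0 else 1 : unitInterval) : ℝ) ≤
      (if (x : K) = y then 0 else 1 : unitInterval) + (if (y : K) = z then 0 else 1 : unitInterval)
    by_cases h1 : (x : K) = y
    · subst h1; simp
    · rw [if_neg h1]
      refine le_add_of_le_of_nonneg (Subtype.coe_le_coe.2 unitInterval.le_one') ?_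
      exact (if (y : K) = z then 0 else 1 : unitInterval).2.1
  · obtain ⟨N, hN⟩ := hs (1 / 2) (by norm_num)
    refine ⟨s N, fun ε hε => ⟨N, fun n hn => ?_⟩⟩
    have e : s n = s N := hd _ _ _ (hN n hn N le_rfl) (by norm_num)
    rw [e]
    change ((if (s N : K) = s N then 0 else 1 : unitInterval) : ℝ) ≤ ε
    rw [if_pos rfl]; exact hε.le
  · have hf : (ringLang C P).fnArity f ≤ 2 := by cases f <;> simp [ringLang, RingFn.arity]
    rw [key hf ε x y hxy]
    refine le_trans (le_of_eq ?_) ε.2.1.le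
    exact congrArg Subtype.val (if_pos rfl)
  · rw [key le_rfl ε x y hxy, sub_self, abs_zero]; exact ε.2.1.le

theorem isResidueMap_mk {K : Type u} [CommRing K] (ϖ : ℕ → K) :
    IsResidueMap ϖ (fun i : ℕ+ => Ideal.Quotient.mk (Ideal.span {ϖ 0}) (ϖ i))
      (Ideal.Quotient.mk (Ideal.span {ϖ 0})) where
  surjective := Ideal.Quotient.mk_surjective
  eq_zero x := by rw [Ideal.Quotient.eq_zero_iff_mem, Ideal.mem_span_singleton]
  const _ := rfl

theorem TPERF.of_ringStr {p : ℕ} {K : Type u} [CommRing K] {d D : K → K → unitInterval}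
    {c : ℕ+ → K} (hs : (ringStr (P := DivRel) K d c fun _ => D).IsStructure)
    (hd : (ringStr (P := DivRel) K d c fun _ => D).IsDiscrete)
    (ha : TPERFAxioms p K (fun x y => D x y = 0) c) :
    TPERF p (ringStr (P := DivRel) K d c fun _ => D) := by
  refine ⟨hs, hd, ringStr_isCommRing K d c _, ?_⟩
  rw [commRing_ringStr K d c _ _]
  exact ha

theorem PERF.tperf_truncation {p : ℕ} [Fact p.Prime] {α : ℝ} (h0 : 0 < α) (h1 : α < 1)
    (N : Str.{u} LD) (h : PERF p α N) : TPERF p (truncation N h) := by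
  classical
  let _ := h.isCommRing.commRing
  refine TPERF.of_ringStr (D := fun x y => if x ∣ y then 0 else 1) (isStructure_discrete _ _)
    ⟨fun x y hxy => if_neg hxy, fun r v => ?_⟩
    ((isResidueMap_mk N.const).tperfAxioms h.isPerfNorm h0 h1 fun x y => ?_)
  · change (if _ then 0 else 1 : unitInterval) = 0 ∨ (if _ then 0 else 1 : unitInterval) = 1
    split_ifs <;> simp
  · by_cases hxy : x ∣ y <;> simp [hxy]

/-! ### Divisibility in the tilt -/

namespace TPERFAxioms

variable {p : ℕ} {R : Type u} [CommRing R] {dv : R → R → Prop} {ϖ : ℕ+ → R}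
  (h : TPERFAxioms p R dv ϖ) [Fact p.Prime] [CharP R p] (α : Set.Ioo (0 : ℝ) 1)
include h

theorem isPerfNorm_flat :
    IsPerfNorm p α.1 (fun x => (h.norm α x : ℝ)) h.flatUniformizer := by
  have := (h.perfAxioms_flat (α := α)).isPerfNorm
    (fun x y => h.norm_eq_zero.trans sub_eq_zero) h.norm_complete
  simpa only [sub_zero] using this

/-- Lift the inverse of x_i to y. Then 1 - xy has zero i-th coefficient, hence norm below 1, and xy
is a unit. -/
theorem isUnit_of_isUnit_coeff {x : Perfection R p} {i : ℕ}
    (hx : IsUnit (Perfection.coeff R p i x)) : IsUnit x := by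
  -- The claim involves no norm; any normalization serves.
  let α : Set.Ioo (0 : ℝ) 1 := ⟨1 / 2, by norm_num, by norm_num⟩
  obtain ⟨v, hv⟩ := isUnit_iff_exists_inv.1 hx
  obtain ⟨y, rfl⟩ := h.exists_coeff v i
  have h1 : (h.norm α (1 - x * y) : ℝ) < 1 :=
    (h.norm_le_of_coeff_eq_zero (k := i) (by rw [map_sub, map_mul, hv, map_one, sub_self])).trans_lt
      (pow_lt_one₀ α.2.1.le α.2.2 (pow_ne_zero _ (Fact.out : p.Prime).ne_zero))
  have h2 := (h.isPerfNorm_flat α).isUnit_one_sub h1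
  rw [sub_sub_cancel] at h2
  exact isUnit_of_mul_isUnit_left h2

/-- Divisibility in R♭ is total by completeness. If x = yc and also v♭(x) ≤ v♭(y), then c is a unit
at an index where y does not vanish, hence a unit. -/
theorem flatLE_iff_dvd {x y : Perfection R p} : flatLE p dv x y ↔ x ∣ y := by
  refine ⟨fun hxy => ?_, h.flatLE_of_dvd⟩
  let α : Set.Ioo (0 : ℝ) 1 := ⟨1 / 2, by norm_num, by norm_num⟩
  by_cases hy : y = 0
  · exact hy ▸ dvd_zero x
  refine ((h.isPerfNorm_flat α).dvd_total x y).elim id fun ⟨c, hc⟩ => ?_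
  obtain ⟨i, hi⟩ : ∃ i, Perfection.coeff R p i y ≠ 0 := by
    by_contra! hn; exact hy (Perfection.ext fun n => by rw [hn, map_zero])
  obtain ⟨e, he⟩ := h.flatLE_iff.1 hxy i
  rw [hc, map_mul, mul_assoc] at he
  have hu := h.isUnit_of_isUnit_coeff (isUnit_of_mul_isUnit_left (h.isUnit_of_eq_mul hi he))
  exact hc ▸ (hu.mul_right_dvd).2 dvd_rfl

theorem isResidueMap_coeff_zero :
    IsResidueMap h.flatUniformizer ϖ (Perfection.coeff R p 0) where
  surjective r := h.exists_coeff r 0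
  eq_zero x := by
    rw [← h.flatLE_iff_dvd]
    refine ⟨fun hx => ?_, fun hx => h.coeff_eq_zero_of_flatLE (k := 0) (by simpa using hx)⟩
    simpa using h.flatLE_of_coeff_eq_zero (k := 0) hx
  const i := by
    rw [coeff_flatUniformizer, zero_add]
    obtain ⟨n, rfl⟩ : ∃ n : ℕ, i = n.succPNat := ⟨i.natPred, (PNat.succPNat_natPred i).symm⟩
    rfl

end TPERFAxioms

/-! ### Residue maps and isomorphisms -/

namespace IsResidueMap

variable {p : ℕ} {K R : Type u} [CommRing K] [CommRing R] {nm : K → ℝ} {ϖ : ℕ → K}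
  {c : ℕ+ → R} {φ : K →+* R} (hφ : IsResidueMap ϖ c φ)
include hφ

theorem exists_quotient_equiv :
    ∃ e : K ⧸ Ideal.span {ϖ 0} ≃+* R, ∀ x, e (Ideal.Quotient.mk _ x) = φ x := by
  have hk : Ideal.span {ϖ 0} = RingHom.ker φ := by
    ext x; rw [Ideal.mem_span_singleton, RingHom.mem_ker, hφ.eq_zero]
  exact ⟨(Ideal.quotEquivOfEq hk).trans (RingHom.quotientKerEquivOfSurjective hφ.surjective),
    fun x => rfl⟩

variable [Fact p.Prime] [CharP R p] {α : Set.Ioo (0 : ℝ) 1} (h : IsPerfNorm p α.1 nm ϖ)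
  {dv : R → R → Prop} (hR : TPERFAxioms p R dv c)
include h

/-- A ring with a perfect norm is the tilt of its residue ring. -/
theorem exists_equiv_perfection : ∃ e : Perfection R p ≃+* K,
    (∀ x, (hR.norm α x : ℝ) = nm (e x)) ∧ (∀ i, e (hR.flatUniformizer i) = ϖ i) ∧
    ∀ (x : Perfection R p) (i : ℕ) (u : K), Perfection.coeff R p i x = φ u →
      nm (e x - u ^ p ^ i) ≤ α.1 ^ p ^ i := by
  have := h.charP
  have := h.isDomain
  have := h.perfectRing
  have hα := α.2
  let g : K →+* Perfection R p := Perfection.lift p K R φ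
  let rt : ℕ → K → K := fun n x => ((frobeniusEquiv K p).symm)^[n] x
  have hrt : ∀ n x, rt n x ^ p ^ n = x := fun n x => by
    induction n with
    | zero => simp [rt]
    | succ n ih =>
      simp only [rt, Function.iterate_succ_apply'] at ih ⊢
      rw [pow_succ', pow_mul, frobeniusEquiv_symm_pow_p, ih]
  have hinj : ∀ n (x y : K), x ^ p ^ n = y ^ p ^ n → x = y := fun n x y e => by
    rw [← sub_eq_zero, ← h.sub_pow] at e
    exact sub_eq_zero.1 (pow_eq_zero_iff (pow_ne_zero _ (Fact.out : p.Prime).ne_zero) |>.1 e)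
  have hg : ∀ n x, Perfection.coeff R p n (g x) = φ (rt n x) := fun n x => rfl
  have hgϖ : ∀ i, g (ϖ i) = hR.flatUniformizer i := fun i => Perfection.ext fun n => by
    rw [hg, hR.coeff_flatUniformizer, ← hφ.map_uniformizer]
    congr 1
    refine hinj n _ _ ?_
    rw [hrt, add_comm, h.uniformizer_pow]
  have hnear : ∀ n (x u : K), Perfection.coeff R p n (g x) = φ u →
      nm (x - u ^ p ^ n) ≤ α.1 ^ p ^ n := fun n x u e => by
    rw [hg, hφ.eq_iff] at e
    have h1 := h.le_of_dvd e
    rw [h.uniformizer] at h1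
    have h2 := pow_le_pow_left₀ (h.nonneg _) h1 (p ^ n)
    rwa [← h.pow, h.sub_pow, hrt] at h2
  have hle : ∀ x y, flatLE p dv (g x) (g y) → nm y ≤ nm x := fun x y hxy => by
    refine le_of_forall_pos_le_add fun ε hε => ?_
    obtain ⟨k, hk⟩ := exists_pow_pow_lt hα.1 hα.2 (Fact.out : p.Prime).one_lt hε
    have h1 := hR.flatLE_iff.1 hxy k
    rw [hg, hg, hφ.dvd_iff h] at h1
    rcases h1 with h1 | h1
    · have := h.le_of_dvd (pow_dvd_pow_of_dvd h1 (p ^ k))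
      rw [hrt, hrt] at this
      linarith
    · have := pow_le_pow_left₀ (h.nonneg _) (h.le_of_dvd h1) (p ^ k)
      rw [h.uniformizer, ← h.pow, hrt] at this
      linarith [h.nonneg x]
  have hnorm : ∀ x, (hR.norm α (g x) : ℝ) = nm x := fun x => by
    apply le_antisymm
    · by_contra! hlt
      obtain ⟨m, n, hn, h1, h2⟩ :=
        exists_rpow_between hα.1 hα.2 (h.nonneg x) hlt (hR.norm α _).2.2
      have h3 : nm (x ^ n) < nm (ϖ 0 ^ m) := by
        rw [h.pow, h.pow, h.uniformizer]
        refine (pow_lt_pow_left₀ h1 (h.nonneg x) hn.ne').trans_eq ?_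
        rw [← Real.rpow_natCast, ← Real.rpow_mul hα.1.le,
          div_mul_cancel₀ _ (by exact_mod_cast hn.ne'), Real.rpow_natCast]
      have h4 := hR.flatLE_of_dvd (map_dvd g (h.dvd_of_lt h3))
      rw [map_pow, map_pow, hgϖ] at h4
      exact (hR.norm_le hn h4).not_gt h2
    · refine hR.le_norm fun m n hn hmn => ?_
      rw [← hgϖ, ← map_pow, ← map_pow] at hmn
      have h1 := hle _ _ hmn
      rw [h.pow, h.pow, h.uniformizer] at h1
      refine le_of_pow_le_pow_left₀ hn.ne' (Real.rpow_nonneg hα.1.le _) (h1.trans_eq ?_)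
      rw [← Real.rpow_natCast (_ ^ _), ← Real.rpow_mul hα.1.le,
          div_mul_cancel₀ _ (by exact_mod_cast hn.ne'), Real.rpow_natCast]
  have hbij : Function.Bijective g := by
    refine ⟨(injective_iff_map_eq_zero g).2 fun x hx => ?_, fun w => ?_⟩
    · rw [← h.eq_zero, ← hnorm, hx, hR.norm_zero]; rfl
    · choose u hu using fun n => hφ.surjective (Perfection.coeff R p n w)
      have hsub : ∀ k m n, k ≤ m → k ≤ n → nm (u m ^ p ^ m - u n ^ p ^ n) ≤ α.1 ^ p ^ k := by
        have key : ∀ k j, nm (u (k + j) ^ p ^ (k + j) - u k ^ p ^ k) ≤ α.1 ^ p ^ k :=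
          fun k j => by
            have e : φ (u (k + j) ^ p ^ j) = φ (u k) := by
              rw [map_pow, hu, hu, TPERFAxioms.coeff_pow]
            rw [hφ.eq_iff] at e
            have h1 := pow_le_pow_left₀ (h.nonneg _) (h.le_of_dvd e) (p ^ k)
            rwa [h.uniformizer, ← h.pow, h.sub_pow, ← pow_mul, ← pow_add, add_comm j] at h1
        intro k m n hm hn
        obtain ⟨m, rfl⟩ := Nat.exists_eq_add_of_le hm
        obtain ⟨n, rfl⟩ := Nat.exists_eq_add_of_le hn
        exact (h.sub_le _ (u k ^ p ^ k) _).trans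
          (max_le (key k m) (by rw [h.sub_comm]; exact key k n))
      obtain ⟨x, hx⟩ := h.complete (fun n => u n ^ p ^ n) fun ε hε => by
        obtain ⟨k, hk⟩ := exists_pow_pow_lt hα.1 hα.2 (Fact.out : p.Prime).one_lt hε
        exact ⟨k, fun m hm n hn => (hsub k m n hm hn).trans hk.le⟩
      have hx' : ∀ k, nm (x - u k ^ p ^ k) ≤ α.1 ^ p ^ k := fun k => by
        obtain ⟨N, hN⟩ := hx _ (pow_pos hα.1 (p ^ k))
        refine (h.sub_le _ (u (N ⊔ k) ^ p ^ (N ⊔ k)) _).trans (max_le ?_ ?_)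
        · rw [h.sub_comm]; exact hN _ le_sup_left
        · exact hsub k _ _ le_sup_right le_rfl
      refine ⟨x, Perfection.ext fun k => ?_⟩
      rw [hg, ← hu, hφ.eq_iff, ← sub_zero (rt k x - u k)]
      have h1 : nm (rt (k + 1) x - u (k + 1)) ≤ α.1 := by
        refine le_of_pow_le_pow_left₀ (pow_ne_zero (k + 1) (Fact.out : p.Prime).ne_zero)
          hα.1.le ?_
        rw [← h.pow, h.sub_pow, hrt]
        exact hx' (k + 1)
      have h2 : ϖ 0 ∣ rt k x - u (k + 1) ^ p := by
        refine h.dvd_of_lt ?_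
        have e : rt k x = rt (k + 1) x ^ p := by
          simp only [rt, Function.iterate_succ_apply', frobeniusEquiv_symm_pow_p]
        have hs := h.sub_pow (rt (k + 1) x) (u (k + 1)) 1
        simp only [pow_one] at hs
        rw [e, ← hs, h.pow, h.uniformizer]
        exact (pow_le_pow_left₀ (h.nonneg _) h1 p).trans_lt
          (pow_lt_self_of_lt_one₀ hα.1 hα.2 (Fact.out : p.Prime).one_lt)
      have h3 : ϖ 0 ∣ u (k + 1) ^ p - u k := by
        rw [← hφ.eq_iff, map_pow, hu, hu, Perfection.coeff_pow_p']
      rw [sub_zero, ← sub_add_sub_cancel _ (u (k + 1) ^ p)]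
      exact dvd_add h2 h3
  let e := RingEquiv.ofBijective g hbij
  refine ⟨e.symm, fun x => ?_, fun i => ?_, fun x i u hx => ?_⟩
  · rw [← hnorm]
    exact congrArg (fun y => (hR.norm α y : ℝ)) (e.apply_symm_apply x).symm
  · rw [← hgϖ]; exact e.symm_apply_apply _
  · exact hnear i _ u (by rw [← hx]; exact congrArg _ (e.apply_symm_apply x))

end IsResidueMap

end ContLogic
end

noncomputable section

namespace ContLogic

/-! ### Isomorphisms with the tilt and the truncation -/

section
variable {p : ℕ} [Fact p.Prime] {α : Set.Ioo (0 : ℝ) 1}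

omit [Fact p.Prime] in
theorem PERF.d_eq_norm {N : Str.{u} LD} (hN : PERF p α N) (x y : N.carrier) :
    letI := hN.isCommRing.commRing
    N.d x y = N.d (x - y) 0 :=
  letI := hN.isCommRing.commRing
  hN.axioms_hold.d_eq x y

omit [Fact p.Prime] in
theorem TPERF.pred_eq_zero_iff {R : Str.{u} LDiv} (hR : TPERF p R) (x y : R.carrier) :
    letI := hR.isCommRing.commRing
    R.pred DivRel.div x y = 0 ↔ x ∣ y :=
  letI := hR.isCommRing.commRing
  hR.axioms_hold.dv_iff x y

omit [Fact p.Prime] in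
theorem TPERF.pred_eq {R : Str.{u} LDiv} (hR : TPERF p R) (x y : R.carrier) [Decidable
    (letI := hR.isCommRing.commRing; x ∣ y)] :
    letI := hR.isCommRing.commRing
    R.pred DivRel.div x y = if x ∣ y then 0 else 1 := by
  split_ifs with h
  · exact (hR.pred_eq_zero_iff x y).2 h
  · exact (hR.isDiscrete.rel_eq DivRel.div ![x, y]).resolve_left
      fun h' => h ((hR.pred_eq_zero_iff x y).1 h')

omit [Fact p.Prime] in
theorem TPERF.d_eq {R : Str.{u} LDiv} (hR : TPERF p R) (x y : R.carrier)
    [Decidable (x = y)] : R.d x y = if x = y then 0 else 1 := by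
  split_ifs with h
  · exact (hR.isStructure.d_eq_zero x y).2 h
  · exact hR.isDiscrete.d_eq_one x y h

omit [Fact p.Prime] in
theorem exists_truncation_iso {N : Str.{u} LD} (hN : PERF p α N) {R : Str.{u} LDiv}
    (hR : TPERF p R) :
    letI := hN.isCommRing.commRing
    letI := hR.isCommRing.commRing
    ∀ {φ : N.carrier →+* R.carrier}, IsResidueMap N.const R.const φ →
      ∃ e : (truncation N hN).Iso R, ∀ x, e.toEquiv (Ideal.Quotient.mk _ x) = φ x := by
  classical
  let _ := hN.isCommRing.commRing
  let _ := hR.isCommRing.commRing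
  intro φ hφ
  obtain ⟨e, he⟩ := hφ.exists_quotient_equiv
  refine ⟨⟨e.toEquiv, fun x y => ?_, fun f v => ?_, fun r v => ?_⟩, he⟩
  · rw [hR.d_eq]
    exact if_congr e.injective.eq_iff rfl rfl
  · cases f with
    | add => exact (map_add e _ _).trans (R.fn_add fun i => e (v i)).symm
    | mul => exact (map_mul e _ _).trans (R.fn_mul fun i => e (v i)).symm
    | neg => exact (map_neg e _).trans (R.fn_neg fun i => e (v i)).symm
    | zero => exact (map_zero e).trans (R.fn_zero fun i => e (v i)).symm
    | one => exact (map_one e).trans (R.fn_one fun i => e (v i)).symm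
    | const i =>
      exact ((he _).trans (hφ.const i)).trans (R.fn_const i fun i => e (v i)).symm
  · have key : ∀ x y, R.pred DivRel.div (e x) (e y) = if x ∣ y then 0 else 1 := fun x y => by
      rw [hR.pred_eq]
      exact if_congr (map_dvd_iff e) rfl rfl
    exact (R.rel_eq_pred r fun i => e (v i)).trans (key _ _)

theorem exists_tilt_iso {N : Str.{u} LD} (hN : PERF p α N) {R : Str.{u} LDiv}
    (hR : TPERF p R) :
    letI := hN.isCommRing.commRing
    letI := hR.isCommRing.commRing
    ∀ {φ : N.carrier →+* R.carrier}, IsResidueMap N.const R.const φ →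
      ∃ e : (tilt α R hR).Iso N, ∀ (x : Perfection R.carrier p) (i : ℕ) (u : N.carrier),
        x.1 i = φ u → (N.d (e.toEquiv x) (u ^ p ^ i) : ℝ) ≤ α.1 ^ p ^ i := by
  let _ := hN.isCommRing.commRing
  let _ := hR.isCommRing.commRing
  have := hR.charP
  intro φ hφ
  obtain ⟨e, he, hc, hu⟩ := hφ.exists_equiv_perfection hN.isPerfNorm hR.axioms_hold
  have hd : ∀ x y, N.d (e x) (e y) = hR.axioms_hold.norm α (x - y) := fun x y => by
    rw [hN.d_eq_norm, ← map_sub]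
    exact (Subtype.ext (he _)).symm
  refine ⟨⟨e.toEquiv, hd, fun f v => ?_, fun r v => ?_⟩, fun x i u hx => ?_⟩
  · cases f with
    | add => exact (map_add e _ _).trans (N.fn_add fun i => e (v i)).symm
    | mul => exact (map_mul e _ _).trans (N.fn_mul fun i => e (v i)).symm
    | neg => exact (map_neg e _).trans (N.fn_neg fun i => e (v i)).symm
    | zero => exact (map_zero e).trans (N.fn_zero fun i => e (v i)).symm
    | one => exact (map_one e).trans (N.fn_one fun i => e (v i)).symm
    | const i => exact (hc i).trans (N.fn_const i fun i => e (v i)).symm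
  · have key : ∀ x y : Perfection R.carrier p, N.pred DRel.D (e x) (e y) =
        ⨅ z, hR.axioms_hold.norm α (y - x * z) := fun x y => by
      rw [hN.axioms_hold.D_eq, ← e.toEquiv.iInf_comp]
      refine iInf_congr fun z => ?_
      rw [← hd, map_mul]; rfl
    exact (N.rel_eq_pred r fun i => e (v i)).trans (key _ _)
  · rw [hN.d_eq_norm]
    exact hu x i u hx

theorem exists_residueMap_tilt (α : Set.Ioo (0 : ℝ) 1) {R : Str.{u} LDiv} (hR : TPERF p R) :
    letI := (hR.perf_tilt α).isCommRing.commRing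
    letI := hR.isCommRing.commRing
    ∃ φ : (tilt α R hR).carrier →+* R.carrier, IsResidueMap (tilt α R hR).const R.const φ ∧
      ∀ x : Perfection R.carrier p, φ x = x.1 0 := by
  let _ := hR.isCommRing.commRing
  have := hR.charP
  have e : (hR.perf_tilt α).isCommRing.commRing =
    Perfection.instCommRing R.carrier p := commRing_ringStr _ _ _ _ _
  rw [e]
  exact ⟨_, hR.axioms_hold.isResidueMap_coeff_zero, fun _ => rfl⟩

theorem exists_residueMap_truncation {N : Str.{u} LD} (hN : PERF p α N) :
    letI := hN.isCommRing.commRing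
    letI := (hN.tperf_truncation α.2.1 α.2.2).isCommRing.commRing
    ∃ φ : N.carrier →+* (truncation N hN).carrier,
      IsResidueMap N.const (truncation N hN).const φ ∧
      ∀ x, φ x = Ideal.Quotient.mk (Ideal.span {N.const 0}) x := by
  let _ := hN.isCommRing.commRing
  have e : (hN.tperf_truncation α.2.1 α.2.2).isCommRing.commRing =
    Ideal.Quotient.commRing (Ideal.span {N.const 0}) := commRing_ringStr _ _ _ _ _
  rw [e]
  exact ⟨_, isResidueMap_mk N.const, fun _ => rfl⟩

end

end ContLogic
end

noncomputable section

namespace ContLogic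

/-! ### Extending the norm of the tilt to all sequences -/

namespace TPERFAxioms

variable {p : ℕ} {R : Type u} [CommRing R] {dv : R → R → Prop} {ϖ : ℕ+ → R}
  (h : TPERFAxioms p R dv ϖ) [Fact p.Prime] [CharP R p] (α : Set.Ioo (0 : ℝ) 1)

/-- The quotient norm on `R` for the projection of `R♭` to the coefficient of index `i`. -/
def coeffNorm (i : ℕ) (r : R) : unitInterval :=
  ⨅ x : {x : Perfection R p // Perfection.coeff R p i x = r}, h.norm α x.1

/-- The bound `1, α, α^p, α^(p^2), …`: elements of `R♭` whose coefficients of index less than `i`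
vanish have norm at most `coeffBound p α i`. -/
def coeffBound (p : ℕ) (α : Set.Ioo (0 : ℝ) 1) : ℕ → unitInterval
  | 0 => 1
  | i + 1 => ⟨α.1 ^ p ^ i, pow_nonneg α.2.1.le _, pow_le_one₀ α.2.1.le α.2.2.le⟩

/-- An extension of the norm of `R♭` to all sequences. -/
def seqNorm (w : ℕ → R) : unitInterval :=
  ⨆ i, h.coeffNorm α i (w i) ⊓ coeffBound p α i

omit [CharP R p] [CommRing R] in
theorem coeffBound_antitone : Antitone (coeffBound p α) := by
  refine antitone_nat_of_succ_le fun i => ?_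
  cases i with
  | zero => exact unitInterval.le_one'
  | succ i =>
    exact Subtype.coe_le_coe.1 (pow_le_pow_of_le_one α.2.1.le α.2.2.le <|
      Nat.pow_le_pow_right (Fact.out : p.Prime).pos i.le_succ)

omit [CharP R p] [CommRing R] in
theorem coeffBound_tendsto :
    Filter.Tendsto (fun i => (coeffBound p α i : ℝ)) Filter.atTop (nhds 0) := by
  rw [← Filter.tendsto_add_atTop_iff_nat 1]
  refine squeeze_zero (fun i => (coeffBound p α _).2.1) (fun i => ?_)
    (tendsto_pow_atTop_nhds_zero_of_lt_one α.2.1.le α.2.2)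
  exact pow_le_pow_of_le_one α.2.1.le α.2.2.le (Nat.lt_pow_self (Fact.out : p.Prime).one_lt).le

variable {α}
include h

theorem coeffNorm_le (x : Perfection R p) (i : ℕ) :
    h.coeffNorm α i (Perfection.coeff R p i x) ≤ h.norm α x :=
  iInf_le_of_le (⟨x, rfl⟩ : {y // Perfection.coeff R p i y = Perfection.coeff R p i x}) le_rfl

theorem coeffNorm_zero (i : ℕ) : h.coeffNorm α i 0 = 0 :=
  le_antisymm (by simpa [h.norm_zero] using h.coeffNorm_le (α := α) 0 i) bot_le

theorem coeffNorm_eq {x : Perfection R p} {i : ℕ} (hx : Perfection.coeff R p i x ≠ 0) :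
    h.coeffNorm α i (Perfection.coeff R p i x) = h.norm α x :=
  le_antisymm (h.coeffNorm_le x i)
    (le_iInf fun y => (h.norm_eq_of_coeff_eq hx y.2.symm).le)

theorem exists_coeffNorm_eq (i : ℕ) (r : R) :
    ∃ x : Perfection R p, Perfection.coeff R p i x = r ∧ h.coeffNorm α i r = h.norm α x := by
  by_cases hr : r = 0
  · exact ⟨0, by rw [map_zero, hr], by rw [hr, h.coeffNorm_zero, h.norm_zero]⟩
  · obtain ⟨x, rfl⟩ := h.exists_coeff r i
    exact ⟨x, rfl, h.coeffNorm_eq hr⟩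

theorem coeffNorm_eq_zero {i : ℕ} {r : R} (hr : h.coeffNorm α i r = 0) : r = 0 := by
  obtain ⟨x, rfl, hx⟩ := h.exists_coeffNorm_eq (α := α) i r
  rw [h.norm_eq_zero.1 (hx.symm.trans hr), map_zero]

theorem coeffNorm_add_le (i : ℕ) (r s : R) :
    h.coeffNorm α i (r + s) ≤ h.coeffNorm α i r ⊔ h.coeffNorm α i s := by
  obtain ⟨x, rfl, hx⟩ := h.exists_coeffNorm_eq (α := α) i r
  obtain ⟨y, rfl, hy⟩ := h.exists_coeffNorm_eq (α := α) i s
  rw [hx, hy, ← map_add]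
  exact (h.coeffNorm_le _ i).trans h.norm_add_le

theorem coeffNorm_neg (i : ℕ) (r : R) : h.coeffNorm α i (-r) = h.coeffNorm α i r := by
  have key : ∀ r, h.coeffNorm α i (-r) ≤ h.coeffNorm α i r := fun r => by
    obtain ⟨x, rfl, hx⟩ := h.exists_coeffNorm_eq (α := α) i r
    rw [hx, ← map_neg, ← h.norm_neg]
    exact h.coeffNorm_le _ i
  exact le_antisymm (key r) (by simpa using key (-r))

theorem coeffNorm_pow_le {i k : ℕ} (hik : i ≤ k) (r : R) :
    h.coeffNorm α i (r ^ p ^ (k - i)) ≤ h.coeffNorm α k r := by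
  obtain ⟨x, rfl, hx⟩ := h.exists_coeffNorm_eq (α := α) k r
  rw [hx, coeff_pow_sub x hik]
  exact h.coeffNorm_le x i

theorem seqNorm_coeff (x : Perfection R p) :
    h.seqNorm α (fun i => Perfection.coeff R p i x) = h.norm α x := by
  classical
  refine le_antisymm (iSup_le fun i => inf_le_left.trans (h.coeffNorm_le x i)) ?_
  by_cases hx : ∃ i, Perfection.coeff R p i x ≠ 0
  · refine le_trans (le_inf (h.coeffNorm_eq (Nat.find_spec hx)).ge ?_)
      (le_iSup (fun i => h.coeffNorm α i (Perfection.coeff R p i x) ⊓ coeffBound p α i)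
        (Nat.find hx))
    have hmin : ∀ j < Nat.find hx, Perfection.coeff R p j x = 0 :=
      fun j hj => by simpa using Nat.find_min hx hj
    generalize Nat.find hx = n at hmin
    cases n with
    | zero => exact unitInterval.le_one'
    | succ n => exact h.norm_le_of_coeff_eq_zero (hmin n n.lt_succ_self)
  · push Not at hx
    rw [show x = 0 from Perfection.ext fun n => by rw [hx, map_zero], h.norm_zero]
    exact bot_le

theorem seqNorm_zero : h.seqNorm α 0 = 0 := by
  have := h.seqNorm_coeff (α := α) 0
  rw [h.norm_zero] at this
  rw [← this]
  exact congrArg _ (funext fun i => (map_zero _).symm)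

theorem seqNorm_neg (w : ℕ → R) : h.seqNorm α (-w) = h.seqNorm α w :=
  iSup_congr fun i => by rw [Pi.neg_apply, h.coeffNorm_neg]

theorem min_le_seqNorm (w : ℕ → R) (i : ℕ) :
    h.coeffNorm α i (w i) ⊓ coeffBound p α i ≤ h.seqNorm α w :=
  le_iSup (fun i => h.coeffNorm α i (w i) ⊓ coeffBound p α i) i

theorem min_add_le (i : ℕ) (r s : R) (b : unitInterval) : h.coeffNorm α i (r + s) ⊓ b ≤
    (h.coeffNorm α i r ⊓ b) ⊔ (h.coeffNorm α i s ⊓ b) := by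
  rw [← inf_sup_right]
  exact inf_le_inf_right _ (h.coeffNorm_add_le i r s)

theorem seqNorm_add_le (w w' : ℕ → R) :
    h.seqNorm α (w + w') ≤ h.seqNorm α w ⊔ h.seqNorm α w' :=
  iSup_le fun i => (h.min_add_le i _ _ _).trans
    (sup_le_sup (h.min_le_seqNorm w i) (h.min_le_seqNorm w' i))

theorem seqNorm_eq_zero {w : ℕ → R} (hw : h.seqNorm α w = 0) : w = 0 := by
  funext i
  have h1 := (h.min_le_seqNorm (α := α) w i).trans hw.le
  rw [inf_le_iff] at h1
  refine h.coeffNorm_eq_zero (le_antisymm (h1.resolve_right fun h2 => ?_) bot_le)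
  refine absurd (Subtype.coe_le_coe.2 h2) (not_le.2 ?_)
  cases i with
  | zero => exact one_pos
  | succ i => exact pow_pos α.2.1 _

/-- The distance to the sequence of powers of the `k`-th entry, up to `coeffBound p α (k + 1)`. -/
def approxDist {p : ℕ} {R : Type u} [CommRing R] {dv : R → R → Prop} {ϖ : ℕ+ → R}
    (h : TPERFAxioms p R dv ϖ) [Fact p.Prime] [CharP R p] (α : Set.Ioo (0 : ℝ) 1)
    (w : ℕ → R) (k : ℕ) : unitInterval :=
  ((Finset.range k).sup fun i =>
    h.coeffNorm α i (w i - w k ^ p ^ (k - i)) ⊓ coeffBound p α i) ⊔ coeffBound p α (k + 1)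

theorem iInf_seqNorm_le (w : ℕ → R) (k : ℕ) :
    ⨅ x : Perfection R p, h.seqNorm α (w - fun i => Perfection.coeff R p i x) ≤
      h.approxDist α w k := by
  obtain ⟨x, hx⟩ := h.exists_coeff (w k) k
  refine (iInf_le _ x).trans (iSup_le fun i => ?_)
  rcases lt_trichotomy i k with hi | rfl | hi
  · refine le_trans ?_ le_sup_left
    refine le_trans (le_of_eq ?_) (Finset.le_sup (f := fun i =>
      h.coeffNorm α i (w i - w k ^ p ^ (k - i)) ⊓ coeffBound p α i) (Finset.mem_range.2 hi))
    rw [Pi.sub_apply, ← hx, coeff_pow_sub x hi.le]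
  · rw [Pi.sub_apply, hx, sub_self, h.coeffNorm_zero]
    exact inf_le_left.trans bot_le
  · exact inf_le_right.trans ((coeffBound_antitone α hi).trans le_sup_right)

theorem approxDist_le (w : ℕ → R) (x : Perfection R p) (n : ℕ) :
    ((Finset.range (n + 1)).inf fun k => h.approxDist α w k) ≤
      h.seqNorm α (w - fun i => Perfection.coeff R p i x) ⊔ coeffBound p α (n + 1) := by
  set t := h.seqNorm α (w - fun i => Perfection.coeff R p i x) with ht
  have hstep : ∀ k, (k = 0 ∨ t < coeffBound p α k) →
      h.approxDist α w k ≤ t ⊔ coeffBound p α (k + 1) := by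
    rintro k hk
    refine sup_le_sup_right (Finset.sup_le fun i hi => ?_) _
    rw [Finset.mem_range] at hi
    have hk := hk.resolve_left (by lia)
    have e : w i - w k ^ p ^ (k - i) = (w i - Perfection.coeff R p i x) +
        -((w k - Perfection.coeff R p k x) ^ p ^ (k - i)) := by
      rw [sub_pow_char_pow, coeff_pow_sub x hi.le]; ring
    rw [e]
    refine (h.min_add_le i _ _ _).trans (sup_le
      (h.min_le_seqNorm (w - fun i => Perfection.coeff R p i x) i) ?_)
    rw [h.coeffNorm_neg]
    refine inf_le_left.trans ((h.coeffNorm_pow_le hi.le _).trans ?_)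
    have h1 := h.min_le_seqNorm (α := α) (w - fun i => Perfection.coeff R p i x) k
    rw [← ht, inf_le_iff] at h1
    exact h1.resolve_right (not_le.2 hk)
  suffices hs : ∃ k ≤ n, (k = 0 ∨ t < coeffBound p α k) ∧
      coeffBound p α (k + 1) ≤ t ⊔ coeffBound p α (n + 1) by
    obtain ⟨k, hk, h1, h2⟩ := hs
    exact (Finset.inf_le (Finset.mem_range.2 (Nat.lt_succ_of_le hk))).trans
      ((hstep k h1).trans (sup_le le_sup_left h2))
  clear hstep
  induction n with
  | zero => exact ⟨0, le_rfl, .inl rfl, le_sup_right⟩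
  | succ n ih =>
    rcases lt_or_ge t (coeffBound p α (n + 1)) with hlt | hge
    · exact ⟨n + 1, le_rfl, .inr hlt, le_sup_right⟩
    · obtain ⟨k, hk, h1, h2⟩ := ih
      exact ⟨k, hk.trans n.le_succ, h1, h2.trans (sup_le le_sup_left (hge.trans le_sup_left))⟩

theorem abs_approxDist_sub_le (w : ℕ → R) (n : ℕ) :
    |(((Finset.range (n + 1)).inf fun k => h.approxDist α w k : unitInterval) : ℝ) -
      (⨅ x : Perfection R p, h.seqNorm α (w - fun i => Perfection.coeff R p i x) :
        unitInterval)| ≤ coeffBound p α (n + 1) := by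
  set a := (Finset.range (n + 1)).inf fun k => h.approxDist α w k
  set b := ⨅ x : Perfection R p, h.seqNorm α (w - fun i => Perfection.coeff R p i x)
  have h1 : b ≤ a := Finset.le_inf fun k _ => h.iInf_seqNorm_le w k
  have h2 : a ≤ b ⊔ coeffBound p α (n + 1) := by
    by_contra! hlt
    obtain ⟨h3, h4⟩ := sup_lt_iff.1 hlt
    obtain ⟨x, hx⟩ := iInf_lt_iff.1 h3
    exact (h.approxDist_le w x n).not_gt (sup_lt_iff.2 ⟨hx, h4⟩)
  have h1' := Subtype.coe_le_coe.2 h1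
  rw [abs_of_nonneg (sub_nonneg.2 h1')]
  rcases le_sup_iff.1 h2 with h3 | h3
  · linarith [Subtype.coe_le_coe.2 h3, (coeffBound p α (n + 1)).2.1]
  · linarith [Subtype.coe_le_coe.2 h3, b.2.1]

/-- The real number `α^(1/p^k)`. -/
def rootNorm (p : ℕ) (α : Set.Ioo (0 : ℝ) 1) (k : ℕ) : unitInterval :=
  ⟨α.1 ^ ((1 : ℝ) / p ^ k), Real.rpow_nonneg α.2.1.le _,
    Real.rpow_le_one α.2.1.le α.2.2.le (by positivity)⟩

omit h in
open Classical in
/-- The approximation of `coeffNorm` by the values of finitely many divisibility predicates. -/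
def approxCoeffNorm (p : ℕ) {R : Type u} [CommRing R] (ϖ : ℕ+ → R) (α : Set.Ioo (0 : ℝ) 1)
    (i k : ℕ) (r : R) : unitInterval :=
  (if r = 0 then 0 else 1) ⊓ (Finset.range (p ^ (i + k) + 1)).inf fun m =>
    rootNorm p α k ^ m ⊔ if uniformizerSeq ϖ (i + k) ^ m ∣ r then 0 else 1

theorem abs_approxCoeffNorm_sub_le (i k : ℕ) (r : R) :
    |(approxCoeffNorm p ϖ α i k r : ℝ) - h.coeffNorm α i r| ≤ 1 - rootNorm p α k := by
  classical
  by_cases hr : r = 0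
  · rw [hr, h.coeffNorm_zero, approxCoeffNorm, if_pos rfl,
      show (0 : unitInterval) ⊓ _ = 0 from bot_inf_eq _, sub_self, abs_zero]
    exact sub_nonneg.2 (rootNorm p α k).2.2
  obtain ⟨x, rfl⟩ := h.exists_coeff r i
  rw [h.coeffNorm_eq hr]
  have hnorm : ∀ m, h.norm α (h.flatUniformizer k ^ m) = rootNorm p α k ^ m := fun m =>
    Subtype.ext ((h.norm_flatUniformizer k m).trans (by simp [rootNorm]))
  have hcoeff : ∀ m, Perfection.coeff R p i (h.flatUniformizer k ^ m) =
      uniformizerSeq ϖ (i + k) ^ m := fun m => by rw [map_pow, h.coeff_flatUniformizer]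
  have h1 : h.norm α x ≤ approxCoeffNorm p ϖ α i k (Perfection.coeff R p i x) := by
    rw [approxCoeffNorm, if_neg hr]
    refine le_inf unitInterval.le_one' (Finset.le_inf fun m _ => ?_)
    split_ifs with hd
    · rw [← hcoeff] at hd
      exact le_sup_of_le_left (by
        rw [← hnorm]; exact h.norm_anti (h.flatLE_of_coeff_dvd hr hd))
    · exact le_sup_of_le_right unitInterval.le_one'
  have h2 : ∃ m, approxCoeffNorm p ϖ α i k (Perfection.coeff R p i x) ≤ rootNorm p α k ^ m ∧
      rootNorm p α k ^ (m + 1) ≤ h.norm α x := by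
    set P : ℕ → Prop := fun m => uniformizerSeq ϖ (i + k) ^ m ∣ Perfection.coeff R p i x with hP
    have hP0 : P 0 := by simp [hP]
    have hPM : ¬P (p ^ (i + k)) := fun hd => by
      have e := h.uniformizerSeq_pow 0 (i + k)
      rw [zero_add] at e
      rw [hP, e, uniformizerSeq, zero_dvd_iff] at hd
      exact hr hd
    have hm := Nat.findGreatest_spec (P := P) (Nat.zero_le (p ^ (i + k))) hP0
    have hle := Nat.findGreatest_le (P := P) (p ^ (i + k))
    have hgt := fun hl hl' => Nat.findGreatest_is_greatest (P := P) (n := p ^ (i + k))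
      (k := Nat.findGreatest P (p ^ (i + k)) + 1) hl hl'
    generalize Nat.findGreatest P (p ^ (i + k)) = m at hm hle hgt
    have hlt : m < p ^ (i + k) := lt_of_le_of_ne hle fun e => hPM (e ▸ hm)
    refine ⟨m, ?_, ?_⟩
    · refine inf_le_right.trans ((Finset.inf_le (Finset.mem_range.2 (by lia) :
        m ∈ Finset.range (p ^ (i + k) + 1))).trans ?_)
      rw [if_pos hm]
      exact sup_le le_rfl bot_le
    · have hnd := hgt m.lt_succ_self hlt
      rw [← hnorm]
      refine h.norm_anti ((h.flatLE_total _ _).resolve_right fun hd => hnd ?_)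
      have := h.flatLE_iff.1 hd i
      rwa [hcoeff] at this
  obtain ⟨m, h2, h3⟩ := h2
  have h1' := Subtype.coe_le_coe.2 h1
  have h2' : (approxCoeffNorm p ϖ α i k (Perfection.coeff R p i x) : ℝ) ≤
    (rootNorm p α k : ℝ) ^ m := by exact_mod_cast h2
  have h3' : (rootNorm p α k : ℝ) ^ (m + 1) ≤ h.norm α x := by exact_mod_cast h3
  rw [abs_of_nonneg (sub_nonneg.2 h1')]
  have h4 : (rootNorm p α k : ℝ) ^ m ≤ 1 := pow_le_one₀ (rootNorm p α k).2.1 (rootNorm p α k).2.2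
  rw [pow_succ] at h3'
  nlinarith [(rootNorm p α k).2.2]

open Classical in
theorem abs_min_sub_iInf_norm_le (x y : Perfection R p) (i : ℕ) :
    |(((if Perfection.coeff R p i x ∣ Perfection.coeff R p i y then 0 else 1) ⊓
      h.coeffNorm α i (Perfection.coeff R p i y) : unitInterval) : ℝ) -
      (⨅ z, h.norm α (y - x * z) : unitInterval)| ≤ coeffBound p α (i + 1) := by
  by_cases hxy : x ∣ y
  · obtain ⟨z, rfl⟩ := hxy
    rw [if_pos (map_dvd _ (dvd_mul_right x z)), show (0 : unitInterval) ⊓ _ = 0 from bot_inf_eq _]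
    have : ⨅ w, h.norm α (x * z - x * w) = 0 :=
      le_antisymm ((iInf_le _ z).trans (by rw [sub_self, h.norm_zero])) bot_le
    rw [this, sub_self, abs_zero]
    exact (coeffBound p α (i + 1)).2.1
  have e : ⨅ z, h.norm α (y - x * z) = h.norm α y :=
    le_antisymm ((iInf_le _ 0).trans (by rw [mul_zero, sub_zero]))
      (le_iInf fun z => (h.isPerfNorm_flat α).le_nm_sub_mul hxy z)
  rw [e]
  by_cases hy : Perfection.coeff R p i y = 0
  · rw [hy, h.coeffNorm_zero, show _ ⊓ (0 : unitInterval) = 0 from inf_bot_eq _]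
    have := h.norm_le_of_coeff_eq_zero (α := α) hy
    rw [abs_sub_comm, Set.Icc.coe_zero, sub_zero, abs_of_nonneg (h.norm α y).2.1]
    exact this
  · rw [if_neg fun hd => hxy (h.flatLE_iff_dvd.1 (h.flatLE_of_coeff_dvd hy hd)),
      show (1 : unitInterval) ⊓ _ = _ from top_inf_eq _, h.coeffNorm_eq hy, sub_self, abs_zero]
    exact (coeffBound p α (i + 1)).2.1

end TPERFAxioms

end ContLogic
end

noncomputable section

namespace ContLogic

/-! ### The tilt as a quantifier-free interpretation -/

theorem QFDef.iSup {L : CLang} {T : Str.{u} L → Prop} {V : Type}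
    {F : ℕ → ∀ A : Str.{u} L, T A → (V → A.carrier) → unitInterval} (hF : ∀ n, QFDef T (F n))
    {b : ℕ → unitInterval} (hb : Antitone b)
    (hb0 : Filter.Tendsto (fun n => (b n : ℝ)) Filter.atTop (nhds 0))
    (hle : ∀ n A h v, F n A h v ≤ b n) : QFDef T (fun A h v => ⨆ n, F n A h v) := by
  refine QFDef.limit (fun n => QFDef.finsetSup hF (Finset.range n)) _ hb0 fun n A h v => ?_
  set s := (Finset.range n).sup fun n => F n A h v
  have h1 : s ≤ ⨆ n, F n A h v := Finset.sup_le fun k _ => le_iSup (fun n => F n A h v) k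
  have h2 : ⨆ n, F n A h v ≤ s ⊔ b n := iSup_le fun k => by
    rcases lt_or_ge k n with hk | hk
    · exact le_sup_of_le_left
        (Finset.le_sup (f := fun n => F n A h v) (Finset.mem_range.2 hk))
    · exact le_sup_of_le_right ((hle k A h v).trans (hb hk))
  rw [abs_sub_comm, abs_of_nonneg (sub_nonneg.2 (Subtype.coe_le_coe.2 h1))]
  rcases le_sup_iff.1 h2 with h3 | h3
  · linarith [Subtype.coe_le_coe.2 h3, (b n).2.1]
  · linarith [Subtype.coe_le_coe.2 h3, s.2.1]

theorem isTermLimit_const {L : CLang} {T : Str.{u} L → Prop} (hT : ∀ A, T A → A.IsStructure)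
    {W κ : Type} [Encodable κ] {X : ∀ A : Str.{u} L, T A → Set (W → A.carrier)}
    {t : κ → Term L W} {F : ∀ (A : Str.{u} L) (h : T A), X A h → κ → A.carrier}
    (hF : ∀ A h w j, (t j).eval A (w : X A h).1 = F A h w j) :
    IsTermLimit T X (fun _ => t) F := by
  refine fun ε hε => ⟨0, fun n _ A h w => A.tupleDist_le hε.le fun j => ?_⟩
  rw [hF, ((hT A h).d_eq_zero _ _).2 rfl, Set.Icc.coe_zero, mul_zero]
  exact hε.le

section
variable {p : ℕ}

theorem exists_extend {A : Str.{u} LDiv} (h : TPERF p A) (x : ℕ → A.carrier) (k : ℕ) :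
    letI := h.isCommRing.commRing
    ∀ _ : ∀ i < k, x (i + 1) ^ p = x i, ∃ y ∈ Omega A h, ∀ i ≤ k, y i = x i := by
  let _ := h.isCommRing.commRing
  intro hx
  choose g hg using h.axioms_hold.frobenius_surjective
  refine ⟨fun i => if i ≤ k then x i else g^[i - k] (x k), fun i => ?_, fun i hi => if_pos hi⟩
  dsimp only
  rcases lt_trichotomy i k with hi | rfl | hi
  · rw [if_pos (Nat.succ_le_of_lt hi), if_pos hi.le, hx i hi]
  · rw [if_neg (by lia), if_pos le_rfl, Nat.add_sub_cancel_left, Function.iterate_one, hg]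
  · rw [if_neg (by lia), if_neg (by lia), Nat.succ_sub hi.le, Function.iterate_succ_apply', hg]

/-- The real number `2^(-(k+1))`. -/
def halfPow (k : ℕ) : unitInterval :=
  ⟨(1 / 2 : ℝ) ^ (k + 1), by positivity, pow_le_one₀ (by norm_num) (by norm_num)⟩

theorem isQFDefinable_Omega : IsQFDefinable (TPERF.{u} p) Omega := by
  have hF : ∀ k, QFDef (TPERF.{u} p) (V := ℕ) fun A _ v =>
      halfPow k * A.d (((Term.var (k + 1)).pow p).eval A v) ((Term.var k).eval A v) := fun k =>
    (QFDef.dist _ _).map (g := fun a => halfPow k * a) (by fun_prop)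
  have hb : Antitone halfPow := antitone_nat_of_succ_le fun i =>
    Subtype.coe_le_coe.1 (pow_le_pow_of_le_one (by norm_num) (by norm_num) (by lia))
  have hb0 : Filter.Tendsto (fun n => (halfPow n : ℝ)) Filter.atTop (nhds 0) :=
    (Filter.tendsto_add_atTop_iff_nat 1).2
      (tendsto_pow_atTop_nhds_zero_of_lt_one (by norm_num) (by norm_num))
  obtain ⟨φ, h1, h2⟩ := QFDef.iSup hF hb hb0 fun n A _ v => unitInterval.mul_le_left
  refine ⟨φ, h1, fun A h x => ?_⟩
  classical
  let _ := h.isCommRing.commRing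
  rw [h2 A h x]
  simp only [Term.eval_pow _ h.isCommRing, Term.eval]
  have hne : Nonempty (Omega A h) := by
    obtain ⟨y, hy, -⟩ := exists_extend h x 0 (fun i hi => absurd hi (Nat.not_lt_zero i))
    exact ⟨⟨y, hy⟩⟩
  have hbdd : BddBelow (Set.range fun y : Omega A h => A.tupleDist x y) :=
    ⟨0, by rintro _ ⟨y, rfl⟩; exact A.tupleDist_nonneg _ _⟩
  have hpow : ∀ {m n : ℕ}, m ≤ n → (1 / 2 : ℝ) ^ n ≤ (1 / 2 : ℝ) ^ m := fun hmn =>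
    pow_le_pow_of_le_one (by norm_num) (by norm_num) hmn
  have hcoord : ∀ (y : ℕ → A.carrier) i, x i ≠ y i → (1 / 2 : ℝ) ^ i ≤ A.tupleDist x y :=
    fun y i hi => by
      have := A.le_tupleDist x y i
      rwa [h.isDiscrete.d_eq_one _ _ hi, Set.Icc.coe_one, mul_one] at this
  apply le_antisymm
  · refine le_ciInf fun y => ?_
    rcases le_or_gt 1 (A.tupleDist x y) with hy1 | hy1
    · exact (⨆ k, halfPow k * A.d (x (k + 1) ^ p) (x k) : unitInterval).2.2.trans hy1
    refine Subtype.coe_le_coe.2 (iSup_le (a := (⟨_, A.tupleDist_nonneg _ _, hy1.le⟩ :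
      unitInterval)) fun k => ?_)
    by_cases hk : x (k + 1) ^ p = x k
    · rw [(h.isStructure.d_eq_zero _ _).2 hk, mul_zero]
      exact bot_le
    refine unitInterval.mul_le_left.trans (Subtype.coe_le_coe.1 ?_)
    by_cases hk' : x (k + 1) = y.1 (k + 1)
    · refine (hpow k.le_succ).trans (hcoord y.1 k fun e => hk ?_)
      rw [hk', e]; exact y.2 k
    · exact hcoord y.1 (k + 1) hk'
  · by_cases hx : ∃ k, x (k + 1) ^ p ≠ x k
    · obtain ⟨y, hy, hxy⟩ := exists_extend h x (Nat.find hx) fun i hi => by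
        simpa using Nat.find_min hx hi
      refine (ciInf_le hbdd ⟨y, hy⟩).trans ((A.tupleDist_le (halfPow (Nat.find hx)).2.1
        fun i => ?_).trans <| le_of_eq_of_le ?_
        (Subtype.coe_le_coe.2 (le_iSup (fun k => halfPow k * A.d (x (k + 1) ^ p) (x k))
          (Nat.find hx))))
      swap
      · rw [h.isDiscrete.d_eq_one _ _ (Nat.find_spec hx), mul_one]
      rcases le_or_gt i (Nat.find hx) with hi | hi
      · dsimp only
        rw [hxy i hi, (h.isStructure.d_eq_zero _ _).2 rfl, Set.Icc.coe_zero, mul_zero]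
        exact (halfPow _).2.1
      · exact (mul_le_of_le_one_right (by positivity) (A.d _ _).2.2).trans (hpow hi)
    · push Not at hx
      refine (ciInf_le hbdd ⟨x, hx⟩).trans ((A.tupleDist_le le_rfl fun i => ?_).trans
        (⨆ k, halfPow k * A.d (x (k + 1) ^ p) (x k) : unitInterval).2.1)
      rw [(h.isStructure.d_eq_zero _ _).2 rfl, Set.Icc.coe_zero, mul_zero]

end

section
variable {p : ℕ} [Fact p.Prime] (α : Set.Ioo (0 : ℝ) 1) {V : Type}

/-- The quotient norm on a model `A` for the projection of `A♭` to the coefficient of index `i`. -/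
def TPERF.coeffNorm {A : Str.{u} LDiv} (h : TPERF p A) (i : ℕ) (r : A.carrier) : unitInterval :=
  letI := h.isCommRing.commRing
  haveI := h.charP
  h.axioms_hold.coeffNorm α i r

/-- The extension to all sequences of the distance on the tilt. -/
def TPERF.seqDist {A : Str.{u} LDiv} (h : TPERF p A) (x y : ℕ → A.carrier) : unitInterval :=
  letI := h.isCommRing.commRing
  haveI := h.charP
  h.axioms_hold.seqNorm α (x - y)

section
variable {α} {A : Str.{u} LDiv} (h : TPERF p A) (x y z : ℕ → A.carrier)

theorem TPERF.seqDist_self : h.seqDist α x x = 0 := by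
  let _ := h.isCommRing.commRing
  have := h.charP
  exact (congrArg _ (sub_self x)).trans h.axioms_hold.seqNorm_zero

theorem TPERF.seqDist_comm : h.seqDist α x y = h.seqDist α y x := by
  let _ := h.isCommRing.commRing
  have := h.charP
  exact (h.axioms_hold.seqNorm_neg _).symm.trans (congrArg _ (neg_sub x y))

theorem TPERF.seqDist_triangle :
    (h.seqDist α x z : ℝ) ≤ h.seqDist α x y + h.seqDist α y z := by
  let _ := h.isCommRing.commRing
  have := h.charP
  have h1 : h.seqDist α x z ≤ h.seqDist α x y ⊔ h.seqDist α y z :=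
    (congrArg _ (sub_add_sub_cancel x y z).symm).trans_le
      (h.axioms_hold.seqNorm_add_le (α := α) (x - y) (y - z))
  rcases le_sup_iff.1 h1 with h2 | h2
  · exact le_add_of_le_of_nonneg (Subtype.coe_le_coe.2 h2) (h.seqDist α y z).2.1
  · exact le_add_of_nonneg_of_le (h.seqDist α x y).2.1 (Subtype.coe_le_coe.2 h2)

variable {x y} in
theorem TPERF.eq_of_seqDist_eq_zero (hxy : h.seqDist α x y = 0) : x = y := by
  let _ := h.isCommRing.commRing
  have := h.charP
  exact sub_eq_zero.1 (h.axioms_hold.seqNorm_eq_zero hxy)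

theorem TPERF.tilt_d (x y : Omega A h) :
    (tilt α A h).d ((tiltInterp.{u} p α).map A h x) ((tiltInterp.{u} p α).map A h y) =
      h.seqDist α x.1 y.1 := by
  let _ := h.isCommRing.commRing
  have := h.charP
  let x' : Perfection A.carrier p := ⟨x.1, x.2⟩
  let y' : Perfection A.carrier p := ⟨y.1, y.2⟩
  exact (h.axioms_hold.seqNorm_coeff (α := α) (x' - y')).symm

end

def uniformizerTerm : ℕ → Term LDiv V
  | 0 => .zero
  | i + 1 => .const i.succPNat

omit [Fact p.Prime] in
theorem eval_uniformizerTerm {A : Str.{u} LDiv} (h : TPERF p A) (v : V → A.carrier) (i : ℕ) :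
    letI := h.isCommRing.commRing
    (uniformizerTerm i).eval A v = uniformizerSeq A.const i := by
  let _ := h.isCommRing.commRing
  cases i with
  | zero => exact Term.eval_zero A v
  | succ i => exact Term.eval_const A v _

theorem qfDef_coeffNorm (i : ℕ) (t : Term LDiv V) :
    QFDef (TPERF.{u} p) fun A h v => h.coeffNorm α i (t.eval A v) := by
  classical
  have hF : ∀ k, QFDef (TPERF.{u} p) fun A _ v => A.d (t.eval A v) (Term.zero.eval A v) ⊓
      (Finset.range (p ^ (i + k) + 1)).inf fun m =>
        TPERFAxioms.rootNorm p α k ^ m ⊔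
          A.pred DivRel.div (((uniformizerTerm (i + k)).pow m).eval A v) (t.eval A v) := fun k =>
    (QFDef.dist _ _).min (QFDef.finsetInf (fun m => (QFDef.const (hV := ⟨t⟩) _).max
      (QFDef.pred DivRel.div ((uniformizerTerm (i + k)).pow m) t)) _)
  have hlim : Filter.Tendsto (fun k => 1 - (TPERFAxioms.rootNorm p α k : ℝ)) Filter.atTop
      (nhds 0) := by
    have := (tendsto_rpow_one_div_pow α.2.1 (Fact.out : p.Prime).one_lt).const_sub 1
    rwa [sub_self] at this
  refine QFDef.limit hF _ hlim fun k A h v => ?_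
  let _ := h.isCommRing.commRing
  have := h.charP
  have key := h.axioms_hold.abs_approxCoeffNorm_sub_le (α := α) i k (t.eval A v)
  refine le_of_eq_of_le ?_ key
  refine congrArg (fun a : unitInterval => |(a : ℝ) - h.coeffNorm α i (t.eval A v)|) ?_
  rw [TPERFAxioms.approxCoeffNorm]
  congr 1
  · rw [h.d_eq]
    exact if_congr (by rw [Term.eval_zero]; rfl) rfl rfl
  · refine Finset.inf_congr rfl fun m _ => ?_
    rw [h.pred_eq, Term.eval_pow _ h.isCommRing, eval_uniformizerTerm h]

theorem qfDef_seqDist (s t : ℕ → Term LDiv V) :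
    QFDef (TPERF.{u} p) fun A h v =>
      h.seqDist α (fun i => (s i).eval A v) (fun i => (t i).eval A v) := by
  refine (QFDef.iSup (fun i => (qfDef_coeffNorm α i ((s i).add (t i).neg)).min
    (QFDef.const (hV := ⟨s 0⟩) (TPERFAxioms.coeffBound p α i)))
    (TPERFAxioms.coeffBound_antitone α) (TPERFAxioms.coeffBound_tendsto α)
    fun _ _ _ _ => inf_le_right).congr fun A h v => ?_
  simp only [Term.eval_sub _ h.isCommRing]
  rfl

theorem qfDef_iInf_seqDist :
    QFDef (TPERF.{u} p) (V := ℕ) fun A h v => ⨅ y : Omega A h, h.seqDist α v y.1 := by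
  have hF : ∀ k : ℕ, QFDef (TPERF.{u} p) (V := ℕ) fun A h v =>
      ((Finset.range k).sup fun i => h.coeffNorm α i (((Term.var i).add
        ((Term.var k).pow (p ^ (k - i))).neg).eval A v) ⊓ TPERFAxioms.coeffBound p α i) ⊔
          TPERFAxioms.coeffBound p α (k + 1) := fun k =>
    (QFDef.finsetSup (fun i => (qfDef_coeffNorm α i _).min (QFDef.const _)) _).max (QFDef.const _)
  refine QFDef.limit (fun n => QFDef.finsetInf hF (Finset.range (n + 1))) _
    ((Filter.tendsto_add_atTop_iff_nat 1).2 (TPERFAxioms.coeffBound_tendsto (p := p) α))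
    fun n A h v => ?_
  let _ := h.isCommRing.commRing
  have := h.charP
  simp only [Term.eval_sub _ h.isCommRing, Term.eval_pow _ h.isCommRing, Term.eval]
  exact h.axioms_hold.abs_approxDist_sub_le (α := α) v n

theorem tiltInterp_isQFPresentedBy : ∃ (pd : Formula LDiv (ℕ ⊕ ℕ) 0) (ds : Formula LDiv ℕ 0),
    (tiltInterp.{u} p α).IsQFPresentedBy pd ds ∧
    ∀ A : Str.{u} LDiv, TPERF p A → ∀ x y : ℕ → A.carrier,
      pd.eval A (Sum.elim x y) = 0 → x = y := by
  obtain ⟨pd, hpd, hpd'⟩ := qfDef_seqDist.{u} (p := p) α (fun i => Term.var (Sum.inl i : ℕ ⊕ ℕ))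
    (fun i => Term.var (Sum.inr i))
  obtain ⟨ds, hds, hds'⟩ := qfDef_iInf_seqDist.{u} (p := p) α
  have e : ∀ (A : Str.{u} LDiv) (h : TPERF p A) (x y : ℕ → A.carrier),
      pd.eval A (Sum.elim x y) = h.seqDist α x y := fun A h x y => hpd' A h _
  refine ⟨pd, ds, ⟨hpd, hds, fun A h x => ?_, fun A h x y => ?_, fun A h x y z => ?_,
    fun A h x => ?_, fun A h x y => ?_, fun A h x => ⟨⟨x.1, x.2⟩, rfl⟩⟩, fun A h x y hxy => ?_⟩
  · exact (e A h x x).trans (h.seqDist_self x)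
  · exact (e A h x y).trans ((h.seqDist_comm x y).trans (e A h y x).symm)
  · have h1 := h.seqDist_triangle (α := α) x y z
    rw [← e A h x z, ← e A h x y, ← e A h y z] at h1
    exact h1
  · exact (hds' A h x).trans (iInf_congr fun y => (e A h x y.1).symm)
  · exact (h.tilt_d x y).trans (e A h x.1 y.1).symm
  · exact h.eq_of_seqDist_eq_zero ((e A h x y).symm.trans hxy)

theorem exists_tilt_term (f : LD.Fn) : ∃ t : ℕ → Term LDiv (Fin (LD.fnArity f) × ℕ),
    ∀ (A : Str.{u} LDiv) (h : TPERF p A) (z : (tiltInterp.{u} p α).domPow (LD.fnArity f) A h)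
      (j : ℕ), (t j).eval A z.1 = Subtype.val (p := fun x : ℕ → A.carrier => x ∈ Omega A h)
        ((tilt α A h).fn f ((tiltInterp.{u} p α).mapPow (LD.fnArity f) A h z)) j := by
  cases f with
  | add => exact ⟨fun j => .add (.var ((0 : Fin 2), j)) (.var ((1 : Fin 2), j)),
      fun A h z j => Term.eval_add A z.1 _ _⟩
  | mul => exact ⟨fun j => .mul (.var ((0 : Fin 2), j)) (.var ((1 : Fin 2), j)),
      fun A h z j => Term.eval_mul A z.1 _ _⟩
  | neg => exact ⟨fun j => .neg (.var ((0 : Fin 1), j)), fun A h z j => Term.eval_neg A z.1 _⟩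
  | zero => exact ⟨fun j => .zero, fun A h z j => Term.eval_zero A z.1⟩
  | one => exact ⟨fun j => .one, fun A h z j => Term.eval_one A z.1⟩
  | const i => exact ⟨fun j => uniformizerTerm (j + i), fun A h z j => eval_uniformizerTerm h z.1 _⟩

theorem tiltInterp_isQFInterpretation : (tiltInterp.{u} p α).IsQFInterpretation := by
  classical
  obtain ⟨pd, ds, hI, hmet⟩ := tiltInterp_isQFPresentedBy.{u} (p := p) α
  refine ⟨pd, ds, hI, fun r => ?_, fun f => ?_⟩
  · have hF : ∀ i, QFDef (TPERF.{u} p) (V := Fin 2 × ℕ) fun A h v =>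
        A.pred DivRel.div ((Term.var (0, i)).eval A v) ((Term.var (1, i)).eval A v) ⊓
          h.coeffNorm α i ((Term.var (1, i)).eval A v) := fun i =>
      (QFDef.pred DivRel.div _ _).min (qfDef_coeffNorm α i _)
    obtain ⟨φ, h1, h2, -⟩ := exists_formula_of_limit hF _
      ((Filter.tendsto_add_atTop_iff_nat 1).2 (TPERFAxioms.coeffBound_tendsto (p := p) α))
    refine ⟨φ, h1, fun A h z z' hz => ?_, fun A h z => h2 A h z.1 _ fun i => ?_⟩
    · have : z = z' := funext fun ⟨j, i⟩ => congrFun (hmet A h _ _ (hz j)) i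
      rw [this]
    · let _ := h.isCommRing.commRing
      have := h.charP
      have key := h.axioms_hold.abs_min_sub_iInf_norm_le (α := α)
        (⟨fun i => z.1 ((0 : Fin 2), i), z.2 (0 : Fin 2)⟩ : Perfection A.carrier p)
        (⟨fun i => z.1 ((1 : Fin 2), i), z.2 (1 : Fin 2)⟩ : Perfection A.carrier p) i
      rw [h.pred_eq]
      exact key
  · obtain ⟨t, ht⟩ := exists_tilt_term.{u} (p := p) α f
    exact ⟨fun _ => t, fun A h z => (tilt α A h).fn f ((tiltInterp.{u} p α).mapPow _ A h z),
      isTermLimit_const (fun A h => h.isStructure) ht, fun A h z => rfl⟩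

end

end ContLogic
end

noncomputable section

namespace ContLogic

/-! ### The truncation as a quantifier-free interpretation -/

section
variable {p : ℕ} {α : ℝ}

/-- The residue map `N → N♮`. -/
def PERF.res {N : Str.{u} LD} (h : PERF p α N) (x : N.carrier) : (truncation N h).carrier :=
  letI := h.isCommRing.commRing
  Ideal.Quotient.mk (Ideal.span {N.const 0}) x

theorem PERF.res_surjective {N : Str.{u} LD} (h : PERF p α N) : Function.Surjective h.res :=
  letI := h.isCommRing.commRing
  Ideal.Quotient.mk_surjective

theorem PERF.pred_eq_zero {N : Str.{u} LD} (h : PERF p α N) {x y : N.carrier}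
    (hxy : letI := h.isCommRing.commRing; x ∣ y) : N.pred DRel.D x y = 0 := by
  let _ := h.isCommRing.commRing
  obtain ⟨z, rfl⟩ := hxy
  rw [h.axioms_hold.D_eq]
  exact le_antisymm ((iInf_le _ z).trans ((h.isStructure.d_eq_zero _ _).2 rfl).le) bot_le

theorem PERF.le_pred {N : Str.{u} LD} (h : PERF p α N) {x y : N.carrier}
    (hxy : letI := h.isCommRing.commRing; ¬x ∣ y)
    (hy : letI := h.isCommRing.commRing; ¬N.const 0 ∣ y) : α ≤ N.pred DRel.D x y := by
  let _ := h.isCommRing.commRing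
  rw [h.axioms_hold.D_eq]
  refine (h.isPerfNorm.le_nm_of_not_dvd hy).trans (Subtype.coe_le_coe.2 (le_iInf fun z => ?_))
  rw [h.axioms_hold.d_eq y (x * z)]
  exact h.isPerfNorm.le_nm_sub_mul hxy z

/-- The function `a ↦ min 1 (a / α)`. -/
def rescale (α : ℝ) (a : unitInterval) : unitInterval :=
  Set.projIcc 0 1 zero_le_one ((a : ℝ) / α)

theorem continuous_rescale : Continuous (rescale α) :=
  continuous_projIcc.comp (continuous_subtype_val.div_const α)

theorem rescale_zero : rescale α 0 = 0 := by
  rw [rescale, Set.Icc.coe_zero, zero_div]; exact Set.projIcc_left _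

theorem rescale_of_le (h0 : 0 < α) {a : unitInterval} (ha : α ≤ a) : rescale α a = 1 :=
  Set.projIcc_of_right_le _ ((one_le_div h0).2 ha)

variable {W : Type}

theorem qfDef_truncation_d (h0 : 0 < α) (s t : Term LD W) :
    QFDef (PERF.{u} p α) fun N h w =>
      (truncation N h).d (h.res (s.eval N w)) (h.res (t.eval N w)) := by
  classical
  refine ((QFDef.pred DRel.D (.const 0) (s.add t.neg)).map (continuous_rescale (α := α))).congr
    fun N h w => ?_
  let _ := h.isCommRing.commRing
  rw [Term.eval_sub _ h.isCommRing, Term.eval_const]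
  have e := (isResidueMap_mk N.const).eq_iff (s.eval N w) (t.eval N w)
  refine Eq.trans ?_ (if_congr e rfl rfl).symm
  split_ifs with hd
  · rw [h.pred_eq_zero hd, rescale_zero]
  · exact rescale_of_le h0 (h.le_pred hd hd)

theorem qfDef_truncation_pred (h0 : 0 < α) (s t : Term LD W) :
    QFDef (PERF.{u} p α) fun N h w =>
      (truncation N h).pred DivRel.div (h.res (s.eval N w)) (h.res (t.eval N w)) := by
  classical
  refine (((QFDef.pred DRel.D s t).min (QFDef.pred DRel.D (.const 0) t)).map
    (continuous_rescale (α := α))).congr fun N h w => ?_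
  let _ := h.isCommRing.commRing
  rw [Term.eval_const]
  have e := (isResidueMap_mk N.const).dvd_iff h.isPerfNorm (s.eval N w) (t.eval N w)
  refine Eq.trans ?_ (if_congr e rfl rfl).symm
  split_ifs with hd
  · rcases hd with hd | hd
    · rw [h.pred_eq_zero hd, show (0 : unitInterval) ⊓ _ = 0 from bot_inf_eq _, rescale_zero]
    · rw [h.pred_eq_zero hd, show _ ⊓ (0 : unitInterval) = 0 from inf_bot_eq _, rescale_zero]
  · push Not at hd
    refine rescale_of_le h0 ?_
    rcases min_choice (N.pred DRel.D (s.eval N w) (t.eval N w))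
      (N.pred DRel.D (N.const 0) (t.eval N w)) with e | e <;> rw [e]
    · exact h.le_pred hd.1 hd.2
    · exact h.le_pred hd.2 hd.2

theorem exists_truncation_term {V : Type} (τ : V → W) (t : Term LDiv V) :
    ∃ t' : Term LD W, ∀ (N : Str.{u} LD) (h : PERF p α N) (w : W → N.carrier),
      h.res (t'.eval N w) = t.eval (truncation N h) fun v => h.res (w (τ v)) := by
  induction t with
  | var v => exact ⟨.var (τ v), fun _ _ _ => rfl⟩
  | app f ts ih =>
    choose ts' hts using ih
    have key : ∀ (N : Str.{u} LD) (h : PERF p α N) (w : W → N.carrier),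
        (Term.app f ts).eval (truncation N h) (fun v => h.res (w (τ v))) =
          (truncation N h).fn f fun i => h.res ((ts' i).eval N w) := fun N h w =>
      congrArg ((truncation N h).fn f) (funext fun i => (hts i N h w).symm)
    simp only [key]
    cases f with
    | add => exact ⟨.add (ts' (0 : Fin 2)) (ts' (1 : Fin 2)), fun N h w =>
        congrArg h.res (Term.eval_add N w _ _)⟩
    | mul => exact ⟨.mul (ts' (0 : Fin 2)) (ts' (1 : Fin 2)), fun N h w =>
        congrArg h.res (Term.eval_mul N w _ _)⟩
    | neg => exact ⟨.neg (ts' (0 : Fin 1)), fun N h w => congrArg h.res (Term.eval_neg N w _)⟩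
    | zero => exact ⟨.zero, fun N h w => congrArg h.res (Term.eval_zero N w)⟩
    | one => exact ⟨.one, fun N h w => congrArg h.res (Term.eval_one N w)⟩
    | const i => exact ⟨.const (i : ℕ), fun N h w => congrArg h.res (Term.eval_const N w (i : ℕ))⟩

/-- Quantifier-free formulas of the truncation translate into quantifier-free formulas. -/
theorem qfDef_truncation (h0 : 0 < α) {V : Type} {n : ℕ} (φ : Formula LDiv V n) (hφ : φ.IsQF)
    (τ : V ⊕ Fin n → W) :
    QFDef (PERF.{u} p α) fun N h (w : W → N.carrier) =>
      φ.realize (truncation N h) (fun v => h.res (w (τ (.inl v))))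
        (fun i => h.res (w (τ (.inr i)))) := by
  have hsum : ∀ (N : Str.{u} LD) (h : PERF p α N) (w : W → N.carrier),
      (Sum.elim (fun v => h.res (w (τ (.inl v)))) fun i => h.res (w (τ (.inr i)))) =
        fun x => h.res (w (τ x)) := fun N h w => funext fun x => by cases x <;> rfl
  induction φ with
  | dist s t =>
    obtain ⟨s', hs⟩ := exists_truncation_term.{u} (p := p) (α := α) τ s
    obtain ⟨t', ht⟩ := exists_truncation_term.{u} (p := p) (α := α) τ t
    refine (qfDef_truncation_d h0 s' t').congr fun N h w => ?_
    rw [Formula.realize, hsum, hs, ht]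
  | rel r ts =>
    choose ts' hts using fun i => exists_truncation_term.{u} (p := p) (α := α) τ (ts i)
    refine (qfDef_truncation_pred h0 (ts' (0 : Fin 2)) (ts' (1 : Fin 2))).congr fun N h w => ?_
    rw [Formula.realize, hsum]
    cases r
    exact (congrArg₂ _ (hts (0 : Fin 2) N h w) (hts (1 : Fin 2) N h w)).trans
      ((truncation N h).rel_eq_pred DivRel.div fun i : Fin 2 =>
        (ts i).eval (truncation N h) fun x => h.res (w (τ x))).symm
  | conn c φ ih => exact QFDef.conn (fun k => ih k (hφ k) τ hsum) c
  | sup φ ih => exact hφ.elim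
  | inf φ ih => exact hφ.elim

theorem qfDef_truncation_eval (h0 : 0 < α) {V : Type} (φ : Formula LDiv V 0) (hφ : φ.IsQF)
    (τ : V → W) :
    QFDef (PERF.{u} p α) fun N h (w : W → N.carrier) =>
      φ.eval (truncation N h) fun v => h.res (w (τ v)) :=
  (qfDef_truncation h0 φ hφ (Sum.elim τ Fin.elim0)).congr fun N h w =>
    congrArg (φ.realize (truncation N h) fun v => h.res (w (τ v))) (funext fun i => i.elim0)

variable [Fact p.Prime]

theorem resInterp_isQFInterpretation (h0 : 0 < α) (h1 : α < 1) :
    (resInterp.{u} p α).IsQFInterpretation := by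
  have hT := fun (N : Str.{u} LD) (h : PERF p α N) => (h.tperf_truncation h0 h1 N).isStructure
  obtain ⟨pd, hpd, hpd'⟩ := qfDef_truncation_d.{u} (p := p) h0
    (.var (.inl () : Unit ⊕ Unit)) (.var (.inr ()))
  obtain ⟨ds, hds, hds'⟩ := QFDef.const (T := PERF.{u} p α) (V := Unit) 0
  have e : ∀ (N : Str.{u} LD) (h : PERF p α N) (x y : Unit → N.carrier),
      pd.eval N (Sum.elim x y) = (truncation N h).d (h.res (x ())) (h.res (y ())) :=
    fun N h x y => hpd' N h _
  have e0 : ∀ (N : Str.{u} LD) (h : PERF p α N) (x y : Unit → N.carrier),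
      pd.eval N (Sum.elim x y) = 0 → h.res (x ()) = h.res (y ()) := fun N h x y hxy =>
    ((hT N h).d_eq_zero _ _).1 ((e N h x y).symm.trans hxy)
  refine ⟨pd, ds, ⟨hpd, hds, fun N h x => ?_, fun N h x y => ?_, fun N h x y z => ?_,
    fun N h x => ?_, fun N h x y => ?_, fun N h x => ?_⟩, fun r => ?_, fun f => ?_⟩
  · exact (e N h x x).trans (((hT N h).d_eq_zero _ _).2 rfl)
  · exact (e N h x y).trans (((hT N h).d_comm _ _).trans (e N h y x).symm)
  · have h1 := (hT N h).d_triangle (h.res (x ())) (h.res (y ())) (h.res (z ()))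
    rw [← e N h x z, ← e N h x y, ← e N h y z] at h1
    exact h1
  · refine (hds' N h x).trans (le_antisymm bot_le ?_)
    refine (iInf_le _ ⟨x, trivial⟩).trans (le_of_eq ?_)
    exact (e N h x x).trans (((hT N h).d_eq_zero _ _).2 rfl)
  · exact (e N h x.1 y.1).symm
  · obtain ⟨y, hy⟩ := h.res_surjective x
    exact ⟨⟨fun _ => y, trivial⟩, hy⟩
  · obtain ⟨φ, h1, h2⟩ := qfDef_truncation_pred.{u} (p := p) h0
      (.var ((0 : Fin 2), ())) (.var ((1 : Fin 2), ()))
    refine ⟨φ, h1, fun N h z z' hz => ?_, fun N h z => ?_⟩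
    · refine (h2 N h z).trans (Eq.trans ?_ (h2 N h z').symm)
      exact congrArg₂ _ (e0 N h _ _ (hz (0 : Fin 2))) (e0 N h _ _ (hz (1 : Fin 2)))
    · cases r
      exact (h2 N h z.1).trans ((truncation N h).rel_eq_pred DivRel.div
        (fun i : Fin 2 => h.res (z.1 (i, ())))).symm
  · obtain ⟨t, ht⟩ := exists_truncation_term.{u} (p := p) (α := α)
      (fun i : Fin (LDiv.fnArity f) => (i, ())) (.app f fun i => .var i)
    exact ⟨fun _ _ => t, fun N h z => ⟨fun _ => t.eval N z.1, trivial⟩,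
      isTermLimit_const (fun N h => h.isStructure) fun N h z j => rfl, fun N h z => ht N h z.1⟩

end

/-! ### The bi-interpretation -/

section
variable {p : ℕ} [Fact p.Prime] (α : Set.Ioo (0 : ℝ) 1)

omit [Fact p.Prime] in
theorem PERF.d_le_max {α : ℝ} {N : Str.{u} LD} (h : PERF p α N) (a b c : N.carrier) :
    N.d a c ≤ N.d a b ⊔ N.d b c := by
  let _ := h.isCommRing.commRing
  rw [h.axioms_hold.d_eq a c, h.axioms_hold.d_eq a b, h.axioms_hold.d_eq b c,
    ← sub_add_sub_cancel a b c]
  exact h.axioms_hold.norm_add_le _ _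

omit [Fact p.Prime] in
theorem PERF.sup_le_sup_of_d_le {α : ℝ} {N : Str.{u} LD} (h : PERF p α N) {β : unitInterval}
    (a b c : N.carrier) (hab : N.d a b ≤ β) : N.d a c ⊔ β ≤ N.d b c ⊔ β :=
  sup_le ((h.d_le_max a b c).trans
    (sup_le (hab.trans le_sup_right) le_sup_left)) le_sup_right

omit [Fact p.Prime] in
theorem PERF.abs_sup_sub_le {α : ℝ} {N : Str.{u} LD} (h : PERF p α N) {β : unitInterval}
    (f a y : N.carrier) (hfa : N.d f a ≤ β) :
    |((N.d a y ⊔ β : unitInterval) : ℝ) - N.d f y| ≤ β := by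
  have h5 := h.isStructure.d_triangle f a y
  have h6 := h.isStructure.d_triangle a f y
  rw [h.isStructure.d_comm a f] at h6
  have hfa' := Subtype.coe_le_coe.2 hfa
  rw [abs_le]
  have h7 := Subtype.coe_le_coe.2 (le_sup_left : N.d a y ≤ _ ⊔ β)
  constructor
  · linarith
  · rcases max_choice (N.d a y) β with e1 | e1 <;> rw [e1]
    · linarith
    · linarith [(N.d f y).2.1]

/-- Elements with the same residue have close `p^i`-th powers. -/
theorem PERF.d_pow_le {N : Str.{u} LD} (h : PERF p α N) {a b : N.carrier}
    (hab : h.res a = h.res b) (i : ℕ) :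
    letI := h.isCommRing.commRing
    N.d (a ^ p ^ i) (b ^ p ^ i) ≤ TPERFAxioms.coeffBound p α (i + 1) := by
  let _ := h.isCommRing.commRing
  have e2 := h.isPerfNorm.le_of_dvd (((isResidueMap_mk N.const).eq_iff _ _).1 hab)
  have e3 := pow_le_pow_left₀ (h.isPerfNorm.nonneg _) e2 (p ^ i)
  rw [h.isPerfNorm.uniformizer, ← h.isPerfNorm.pow, h.isPerfNorm.sub_pow] at e3
  rw [h.axioms_hold.d_eq]
  exact e3

theorem tilt_comp_res_homotopic
    (hI : ∀ (A : Str.{u} LDiv) (h : TPERF p A), PERF p α (tilt α A h)) :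
    ∃ e : ∀ A h, (((tiltInterp.{u} p α).comp (resInterp p α) hI).target A h).Iso A,
      ((tiltInterp.{u} p α).comp (resInterp p α) hI).IsQFHomotopicToId e := by
  have he : ∀ (A : Str.{u} LDiv) (h : TPERF p A),
      ∃ e : (truncation (tilt α A h) (hI A h)).Iso A, ∀ x : (tilt α A h).carrier,
        e.toEquiv ((hI A h).res x) =
          Subtype.val (p := fun x : ℕ → A.carrier => x ∈ Omega A h) x 0 := fun A h => by
    obtain ⟨φ, h1, h2⟩ := exists_residueMap_tilt α h
    obtain ⟨e, he⟩ := exists_truncation_iso (hI A h) h h1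
    exact ⟨e, fun x => (he x).trans (h2 x)⟩
  choose e he using he
  refine ⟨e, ?_⟩
  set K := (tiltInterp.{u} p α).comp (resInterp p α) hI
  obtain ⟨pd, hpd, hpd'⟩ := QFDef.dist (T := TPERF.{u} p)
    (.var (.inl ((), (0 : ℕ)) : (Unit × ℕ) ⊕ (Unit × ℕ))) (.var (.inr ((), (0 : ℕ))))
  obtain ⟨ds, hds, hds'⟩ := QFDef.const (T := TPERF.{u} p) (V := Unit × ℕ) 0
  have hmap : ∀ (A : Str.{u} LDiv) (h : TPERF p A) (u : K.dom A h),
      (e A h).toEquiv (K.map A h u) = u.1 ((), (0 : ℕ)) := fun A h u => he A h _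
  have epd : ∀ (A : Str.{u} LDiv) (_ : TPERF p A) (x y : Unit × ℕ → A.carrier),
      pd.eval A (Sum.elim x y) = A.d (x ((), (0 : ℕ))) (y ((), (0 : ℕ))) := fun A h x y => hpd' A h _
  have hdom : ∀ (A : Str.{u} LDiv) (h : TPERF p A) (a : A.carrier),
      ∃ u : K.dom A h, u.1 ((), (0 : ℕ)) = a := fun A h a => by
    obtain ⟨y, hy, hy'⟩ := exists_extend h (fun _ => a) 0 fun i hi => absurd hi (Nat.not_lt_zero i)
    exact ⟨⟨fun v => y v.2, fun _ => hy, trivial⟩, hy' 0 le_rfl⟩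
  refine ⟨pd, ds, ⟨hpd, hds, fun A h x => ?_, fun A h x y => ?_, fun A h x y z => ?_,
    fun A h x => ?_, fun A h x y => ?_, fun A h x => ?_⟩, ?_, ?_⟩
  · exact (epd A h x x).trans ((h.isStructure.d_eq_zero _ _).2 rfl)
  · exact (epd A h x y).trans ((h.isStructure.d_comm _ _).trans (epd A h y x).symm)
  · have h1 := h.isStructure.d_triangle (x ((), (0 : ℕ))) (y ((), (0 : ℕ))) (z ((), (0 : ℕ)))
    refine le_of_eq_of_le (congrArg _ (epd A h x z)) (h1.trans_eq ?_)
    exact congrArg₂ (fun a b : unitInterval => (a : ℝ) + b)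
      (epd A h x y).symm (epd A h y z).symm
  · refine (hds' A h x).trans (le_antisymm bot_le ?_)
    obtain ⟨u, hu⟩ := hdom A h (x ((), (0 : ℕ)))
    refine (iInf_le _ u).trans (le_of_eq ((epd A h x u.1).trans ?_))
    exact (h.isStructure.d_eq_zero _ _).2 hu.symm
  · exact ((e A h).map_d _ _).symm.trans
      ((congrArg₂ A.d (hmap A h x) (hmap A h y)).trans (epd A h x.1 y.1).symm)
  · obtain ⟨u, hu⟩ := hdom A h ((e A h).toEquiv x)
    exact ⟨u, (e A h).toEquiv.injective ((hmap A h u).trans hu)⟩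
  · obtain ⟨Φ, hΦ, hΦ'⟩ := QFDef.dist (T := TPERF.{u} p)
      (.var (.inl ((), (0 : ℕ)) : (Unit × ℕ) ⊕ Unit)) (.var (.inr ()))
    refine ⟨Φ, hΦ, fun A h u u' y huu' => ?_, fun A h u y => ?_⟩
    · have e1 := (h.isStructure.d_eq_zero _ _).1 ((epd A h u u').symm.trans huu')
      refine (hΦ' A h _).trans (Eq.trans ?_ (hΦ' A h _).symm)
      exact congrArg (fun a => A.d a y) e1
    · exact (hΦ' A h _).trans (congrArg (fun a => A.d a y) (hmap A h u)).symm
  · exact ⟨fun _ _ => .var ((), (0 : ℕ)), isTermLimit_const (fun A h => h.isStructure)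
      fun A h u _ => (hmap A h u).symm⟩

theorem res_comp_tilt_homotopic
    (hJ : ∀ (N : Str.{u} LD) (h : PERF p α N), TPERF p (truncation N h)) :
    ∃ e : ∀ N h, (((resInterp.{u} p α).comp (tiltInterp p α) hJ).target N h).Iso N,
      ((resInterp.{u} p α).comp (tiltInterp p α) hJ).IsQFHomotopicToId e := by
  have he : ∀ (N : Str.{u} LD) (h : PERF p α N),
      ∃ e : (tilt α (truncation N h) (hJ N h)).Iso N,
        ∀ (x : Omega (truncation N h) (hJ N h)) (i : ℕ) (u : N.carrier), x.1 i = h.res u →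
          (N.d (e.toEquiv ((tiltInterp.{u} p α).map _ (hJ N h) x))
            (letI := h.isCommRing.commRing; u ^ p ^ i) : ℝ) ≤
            TPERFAxioms.coeffBound p α (i + 1) := fun N h => by
    obtain ⟨φ, h1, h2⟩ := exists_residueMap_truncation (α := α) h
    obtain ⟨e, he⟩ := exists_tilt_iso h (hJ N h) h1
    exact ⟨e, fun x i u hx => he _ i u (hx.trans (h2 u).symm)⟩
  choose e he using he
  refine ⟨e, ?_⟩
  set K := (resInterp.{u} p α).comp (tiltInterp p α) hJ
  obtain ⟨pd₁, ds₁, hI, hmet⟩ := tiltInterp_isQFPresentedBy.{u} (p := p) α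
  obtain ⟨pd, hpd, hpd'⟩ := qfDef_truncation_eval.{u} (p := p) α.2.1 pd₁ hI.pd_qf
    (Sum.map (fun i => (i, ())) (fun i => (i, ())) : ℕ ⊕ ℕ → (ℕ × Unit) ⊕ (ℕ × Unit))
  obtain ⟨ds, hds, hds'⟩ := qfDef_truncation_eval.{u} (p := p) α.2.1 ds₁ hI.ds_qf
    (fun i => (i, ()))
  let r : ∀ (N : Str.{u} LD) (h : PERF p α N), (ℕ × Unit → N.carrier) →
    ℕ → (truncation N h).carrier := fun N h x i => h.res (x (i, ()))
  have epd : ∀ (N : Str.{u} LD) (h : PERF p α N) (x y : ℕ × Unit → N.carrier),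
      pd.eval N (Sum.elim x y) = pd₁.eval (truncation N h) (Sum.elim (r N h x) (r N h y)) :=
    fun N h x y => (hpd' N h _).trans
      (congrArg (pd₁.eval (truncation N h)) (funext fun v => by cases v <;> rfl))
  have hrdom : ∀ (N : Str.{u} LD) (h : PERF p α N) (u : K.dom N h),
      r N h u.1 ∈ Omega (truncation N h) (hJ N h) := fun N h u => u.2.2
  have hsurj : ∀ (N : Str.{u} LD) (h : PERF p α N), Function.Surjective
      fun u : K.dom N h => (⟨r N h u.1, hrdom N h u⟩ : Omega (truncation N h) (hJ N h)) :=
    fun N h x => by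
      choose u hu using fun i => h.res_surjective (x.1 i)
      have e : r N h (fun v => u v.1) = x.1 := funext hu
      exact ⟨⟨fun v => u v.1, fun _ => trivial,
        show r N h (fun v => u v.1) ∈ Omega (truncation N h) (hJ N h) from e ▸ x.2⟩,
        Subtype.ext e⟩
  have hmap : ∀ (N : Str.{u} LD) (h : PERF p α N) (u : K.dom N h), K.map N h u =
      (tiltInterp.{u} p α).map (truncation N h) (hJ N h) ⟨r N h u.1, hrdom N h u⟩ :=
    fun N h u => rfl
  have hclose : ∀ (N : Str.{u} LD) (h : PERF p α N) (u : K.dom N h) (i : ℕ),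
      (N.d (e N h |>.toEquiv (K.map N h u))
        (letI := h.isCommRing.commRing; u.1 (i, ()) ^ p ^ i) : ℝ) ≤
          TPERFAxioms.coeffBound p α (i + 1) :=
    fun N h u i => he N h ⟨r N h u.1, hrdom N h u⟩ i (u.1 (i, ())) rfl
  have hb := (Filter.tendsto_add_atTop_iff_nat 1).2
    (TPERFAxioms.coeffBound_tendsto (p := p) α)
  refine ⟨pd, ds, ⟨hpd, hds, fun N h x => ?_, fun N h x y => ?_, fun N h x y z => ?_,
    fun N h x => ?_, fun N h x y => ?_, fun N h x => ?_⟩, ?_, ?_⟩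
  · exact (epd N h x x).trans (hI.pd_self _ (hJ N h) _)
  · exact (epd N h x y).trans ((hI.pd_comm _ (hJ N h) _ _).trans (epd N h y x).symm)
  · have h1 := hI.pd_triangle _ (hJ N h) (r N h x) (r N h y) (r N h z)
    refine le_of_eq_of_le (congrArg _ (epd N h x z)) (h1.trans_eq ?_)
    exact congrArg₂ (fun a b : unitInterval => (a : ℝ) + b)
      (epd N h x y).symm (epd N h y z).symm
  · refine (hds' N h x).trans ((hI.ds_eq _ (hJ N h) (r N h x)).trans ?_)
    refine ((hsurj N h).iInf_comp fun y : Omega (truncation N h) (hJ N h) =>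
      pd₁.eval (truncation N h) (Sum.elim (r N h x) y.1)).symm.trans ?_
    exact iInf_congr fun u => (epd N h x u.1).symm
  · exact (hI.isometry _ (hJ N h) ⟨_, hrdom N h x⟩ ⟨_, hrdom N h y⟩).trans
      (epd N h x.1 y.1).symm
  · obtain ⟨y, hy⟩ := hI.surjective _ (hJ N h) x
    obtain ⟨u, hu⟩ := hsurj N h y
    exact ⟨u, (congrArg _ hu).trans hy⟩
  · have hF : ∀ i : ℕ, QFDef (PERF.{u} p α) (V := (ℕ × Unit) ⊕ Unit) fun N _ v =>
        N.d (((Term.var (.inl (i, ()))).pow (p ^ i)).eval N v) ((Term.var (.inr ())).eval N v) ⊔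
          TPERFAxioms.coeffBound p α (i + 1) := fun i =>
      (QFDef.dist _ _).max (QFDef.const _)
    have heval : ∀ (N : Str.{u} LD) (h : PERF p α N) (u : ℕ × Unit → N.carrier) (y : N.carrier)
        (i : ℕ), N.d (((Term.var (.inl (i, ()) : (ℕ × Unit) ⊕ Unit)).pow (p ^ i)).eval N
            (Sum.elim u fun _ => y))
          ((Term.var (.inr ())).eval N (Sum.elim u fun _ => y)) ⊔
            TPERFAxioms.coeffBound p α (i + 1) =
        N.d (letI := h.isCommRing.commRing; u (i, ()) ^ p ^ i) y ⊔
          TPERFAxioms.coeffBound p α (i + 1) := fun N h u y i =>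
      congrArg (fun a => N.d a y ⊔ _) (Term.eval_pow _ h.isCommRing _ _)
    obtain ⟨Φ, h1, h2, h3⟩ := exists_formula_of_limit hF _ hb
    refine ⟨Φ, h1, fun N h u u' y huu' => h3 N h _ _ fun i => ?_,
      fun N h u y => h2 N h _ _ fun i => ?_⟩
    · have e1 : h.res (u (i, ())) = h.res (u' (i, ())) :=
        congrFun (hmet _ (hJ N h) _ _ ((epd N h u u').symm.trans huu')) i
      have e2 := h.d_pow_le (α := α) e1 i
      refine (heval N h u y i).trans (Eq.trans ?_ (heval N h u' y i).symm)
      refine le_antisymm (h.sup_le_sup_of_d_le _ _ _ e2) (h.sup_le_sup_of_d_le _ _ _ ?_)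
      exact (h.isStructure.d_comm _ _).trans_le e2
    · exact le_of_eq_of_le (congrArg (fun a : unitInterval => |(a : ℝ) - _|)
        (heval N h u.1 y i)) (h.abs_sup_sub_le _ _ _ (hclose N h u i))
  · refine ⟨fun n _ => (Term.var (n, ())).pow (p ^ n), fun ε hε => ?_⟩
    obtain ⟨M, hM⟩ := Filter.eventually_atTop.1 (hb.eventually (gt_mem_nhds hε))
    refine ⟨M, fun n hn N h u => N.tupleDist_le hε.le fun _ => ?_⟩
    refine (mul_le_of_le_one_left (N.d _ _).2.1
      (pow_le_one₀ (by norm_num) (by norm_num))).trans ?_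
    refine le_of_eq_of_le (congrArg Subtype.val (h.isStructure.d_comm _ _)) ?_
    refine le_of_eq_of_le (congrArg (fun a => (N.d ((e N h).toEquiv (K.map N h u)) a : ℝ))
      (Term.eval_pow (u.1 : ℕ × Unit → N.carrier) h.isCommRing _ _)) ?_
    exact (hclose N h u n).trans (hM n hn).le

end

end ContLogic

end

open ContLogic in
theorem mainTheorem2 (p : ℕ) [Fact p.Prime] (α : Set.Ioo (0 : ℝ) 1) :
    IsQFDefinable (TPERF.{u} p) Omega ∧
    ((∀ (R : Str.{u} LDiv) (h : TPERF p R), PERF p α (tilt α R h)) ∧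
      (tiltInterp.{u} p α).IsQFInterpretation) ∧
    ((∀ (N : Str.{u} LD) (h : PERF p α N), TPERF p (truncation N h)) ∧
      (resInterp.{u} p α).IsQFInterpretation) ∧
    IsQFBiInterpretation (TPERF.{u} p) (PERF.{u} p α) (tiltInterp p α) (resInterp p α) := by
  have hI : ∀ (R : Str.{u} LDiv) (h : TPERF p R), PERF p α (tilt α R h) :=
    fun R h => h.perf_tilt α R
  have hJ : ∀ (N : Str.{u} LD) (h : PERF p α N), TPERF p (truncation N h) :=
    fun N h => h.tperf_truncation α.2.1 α.2.2 N
  have h1 := tiltInterp_isQFInterpretation.{u} (p := p) α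
  have h2 := resInterp_isQFInterpretation.{u} (p := p) α.2.1 α.2.2
  exact ⟨isQFDefinable_Omega, ⟨hI, h1⟩, ⟨hJ, h2⟩, hI, hJ, h1, h2,
    tilt_comp_res_homotopic α hI, res_comp_tilt_homotopic α hJ⟩
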